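/- **Theorem (worst-case bound for $k$-median Sensitivity Sampling).** For a $k$-tuple $S$ of centers in $\mathbb{R}^d$ and a finite set $P\subset\mathbb{R}^d$ let $\mathrm{cost}(p,S)=\min_{c\in S}\|p-c\|_2$ and $\mathrm{cost}(P,S)=\sum_{p\in P}\mathrm{cost}(p,S)$. For every constant $\gamma\ge 1$ there are constants $C>0$ and $c\in\mathbb{N}$, depending only on $\gamma$, such that the following holds for all integers $d\ge 0$, $k\ge 1$, all $\varepsilon\in(0,1)$ and all finite nonempty sets $P\subset\mathbb{R}^d$. Let $A=(a_1,\dots,a_k)$ be a $\gamma$-approximate $k$-median solution of $P$, i.e. $\mathrm{cost}(P,A)\le\gamma\,\mathrm{cost}(P,S)$ for all $k$-tuples $S$, and let $C_1,\dots,C_k$ be the partition of $P$ obtained by assigning each point to a nearest center of $A$, with ties broken arbitrarily. For $p\in C_j$ let $\Delta_p=\mathrm{cost}(C_j,A)/|C_j|$ and $$\mu(p)=\frac14\left(\frac1{k|C_j|}+\frac{\mathrm{cost}(p,A)}{k\,\mathrm{cost}(C_j,A)}+\frac{\mathrm{cost}(p,A)}{\mathrm{cost}(P,A)}+\frac{\Delta_p}{\mathrm{cost}(P,A)}\right),$$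 which is a probability distribution on $P$ if all clusters have positive cost; in the degenerate cases (an empty cluster or a cluster of cost $0$) read $0/0$ as $0$ and divide $\mu$ by its total mass. Let $m$ be any integer with $$m\;\ge\; C\,\min\left(k^{4/3}\varepsilon^{-2},\,k\varepsilon^{-3}\right)\,\log^{c}(2k/\varepsilon),$$ let $q_1,\dots,q_m$ be independent samples from $\mu$, and give $q_i$ the weight $w_i=1/(m\,\mu(q_i))$. Then with probability at least $2/3$ the weighted points $(q_i,w_i)_{i\le m}$ form an $\varepsilon$-coreset of $P$ for $k$-median: $$\Big|\sum_{i=1}^m w_i\,\mathrm{cost}(q_i,S)-\mathrm{cost}(P,S)\Big|\le\varepsilon\,\mathrm{cost}(P,S)\quad\text{for all } k\text{-tuples } S \text{ of centers in } \mathbb{R}^d.$$ -/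

import Mathlib

open MeasureTheory
open scoped ENNReal BigOperators

noncomputable section

namespace KMedian

variable {d k : ℕ}

/-- Points of the Euclidean space `ℝ^d`, with the Euclidean norm. -/
abbrev Pt (d : ℕ) : Type := EuclideanSpace ℝ (Fin d)

/-- The `k`-median cost of a point `p` for the centers `S = (c_1, …, c_k)`: the Euclidean distance
to the nearest center (for `k ≥ 1` the infimum over the finite index set is a minimum). -/
def pointCost (S : Fin k → Pt d) (p : Pt d) : ℝ := ⨅ j, dist p (S j)

/-- The `k`-median cost of a finite point set `P` for the centers `S`. -/
def cost (P : Finset (Pt d)) (S : Fin k → Pt d) : ℝ := ∑ p ∈ P, pointCost S p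

/-- `A` is a `γ`-approximate `k`-median solution for `P`: its cost is at most `γ` times the cost
of every `k`-tuple of centers. -/
def IsApproxSolution (γ : ℝ) (P : Finset (Pt d)) (A : Fin k → Pt d) : Prop :=
  ∀ S : Fin k → Pt d, cost P A ≤ γ * cost P S

/-- `τ` assigns every point of `P` to (the index of) a nearest center of `A`; ties are broken
arbitrarily. Values of `τ` outside `P` play no role. -/
def IsNearestAssignment (P : Finset (Pt d)) (A : Fin k → Pt d) (τ : Pt d → Fin k) : Prop :=
  ∀ p ∈ P, dist p (A (τ p)) = pointCost A p

/-- The cluster `C_j` of the points of `P` that are assigned to the center with index `j`. -/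
def cluster (P : Finset (Pt d)) (τ : Pt d → Fin k) (j : Fin k) : Finset (Pt d) :=
  P.filter (fun p => τ p = j)

/-- The average cost `Δ_p = cost(C_j, A) / |C_j|` of the cluster `C_j` that contains `p`. -/
def avgCost (P : Finset (Pt d)) (A : Fin k → Pt d) (τ : Pt d → Fin k) (p : Pt d) : ℝ :=
  cost (cluster P τ (τ p)) A / ((cluster P τ (τ p)).card : ℝ)

/-- The score of `p ∈ C_j`,
`1/4 (1/(k|C_j|) + cost(p,A)/(k cost(C_j,A)) + cost(p,A)/cost(P,A) + Δ_p/cost(P,A))`.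
A quotient with denominator `0` (its numerator is then `0` as well) is read as `0`. -/
def score (P : Finset (Pt d)) (A : Fin k → Pt d) (τ : Pt d → Fin k) (p : Pt d) : ℝ :=
  (1 / 4) * (1 / ((k : ℝ) * ((cluster P τ (τ p)).card : ℝ))
    + pointCost A p / ((k : ℝ) * cost (cluster P τ (τ p)) A)
    + pointCost A p / cost P A
    + avgCost P A τ p / cost P A)

/-- The sampling distribution `μ` of Sensitivity Sampling. If every cluster has positive cost, the
scores already sum to `1` (see `sum_score_eq_one`), so `μ` is the score itself; dividing by
the sum matters only for degenerate clusterings (empty clusters or clusters of cost `0`). -/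
def prob (P : Finset (Pt d)) (A : Fin k → Pt d) (τ : Pt d → Fin k) (p : Pt d) : ℝ :=
  score P A τ p / ∑ q ∈ P, score P A τ q

/-- The distribution `μ` as a measure on the finite set `P`. -/
def sampleMeasure (P : Finset (Pt d)) (A : Fin k → Pt d) (τ : Pt d → Fin k) :
    Measure P :=
  ∑ p : P, ENNReal.ofReal (prob P A τ p) • Measure.dirac p

/-- The law of the `m` independent samples `q_1, …, q_m` from `μ`. -/
def sampleLaw (P : Finset (Pt d)) (A : Fin k → Pt d) (τ : Pt d → Fin k) (m : ℕ) :
    Measure (Fin m → P) :=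
  Measure.pi (fun _ => sampleMeasure P A τ)

/-- The weight `1 / (m μ(q))` of a sample `q`. -/
def weight (P : Finset (Pt d)) (A : Fin k → Pt d) (τ : Pt d → Fin k) (m : ℕ) (q : Pt d) : ℝ :=
  1 / ((m : ℝ) * prob P A τ q)

/-- The points `q_1, …, q_m` (repetitions allowed) with weights `w_1, …, w_m` are an `ε`-coreset of
`P` for `k`-median: for all `k`-tuples of centers `S`, the weighted cost lies in
`(1 ± ε) cost(P, S)`. -/
def IsCoreset (k : ℕ) (ε : ℝ) (P : Finset (Pt d)) {m : ℕ} (q : Fin m → Pt d) (w : Fin m → ℝ) :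
    Prop :=
  ∀ S : Fin k → Pt d, |∑ i, w i * pointCost S (q i) - cost P S| ≤ ε * cost P S

theorem pointCost_nonneg (S : Fin k → Pt d) (p : Pt d) : 0 ≤ pointCost S p :=
  Real.iInf_nonneg fun _ => dist_nonneg

theorem cost_nonneg (P : Finset (Pt d)) (S : Fin k → Pt d) : 0 ≤ cost P S :=
  Finset.sum_nonneg fun p _ => pointCost_nonneg S p

theorem score_pos (P : Finset (Pt d)) (A : Fin k → Pt d) (τ : Pt d → Fin k) {p : Pt d}
    (hp : p ∈ P) : 0 < score P A τ p := by
  have hk : (0 : ℝ) < k := by exact_mod_cast (τ p).pos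
  have hc : (0 : ℝ) < ((cluster P τ (τ p)).card : ℝ) := by
    exact_mod_cast Finset.card_pos.2 ⟨p, by simp [cluster, hp]⟩
  have h1 := pointCost_nonneg A p
  have h2 := cost_nonneg (cluster P τ (τ p)) A
  have h3 := cost_nonneg P A
  unfold score avgCost
  positivity

/-- The law of one sample is a probability measure. -/
theorem isProbabilityMeasure_sampleMeasure (P : Finset (Pt d)) (A : Fin k → Pt d)
    (τ : Pt d → Fin k) (hP : P.Nonempty) : IsProbabilityMeasure (sampleMeasure P A τ) := by
  have hs : 0 < ∑ q ∈ P, score P A τ q := Finset.sum_pos (fun q hq => score_pos P A τ hq) hP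
  constructor
  simp only [sampleMeasure, Measure.coe_finsetSum, Finset.sum_apply, Measure.smul_apply,
    measure_univ, smul_eq_mul, mul_one]
  have hn : ∀ p ∈ (Finset.univ : Finset P), 0 ≤ prob P A τ p :=
    fun p _ => div_nonneg (score_pos P A τ p.2).le hs.le
  rw [← ENNReal.ofReal_sum_of_nonneg hn]
  rw [Finset.sum_coe_sort P (fun p => prob P A τ p)]
  simp only [prob]
  rw [← Finset.sum_div, div_self hs.ne', ENNReal.ofReal_one]

/-- If all clusters have positive cost (in particular they are nonempty), the scores sum to `1`. -/
theorem sum_score_eq_one (P : Finset (Pt d)) (A : Fin k → Pt d) (τ : Pt d → Fin k) (hk : 0 < k)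
    (h : ∀ j, 0 < cost (cluster P τ j) A) : ∑ p ∈ P, score P A τ p = 1 := by
  have hk' : (k : ℝ) ≠ 0 := by exact_mod_cast hk.ne'
  have hfib : ∀ f : Pt d → ℝ, ∑ p ∈ P, f p = ∑ j, ∑ p ∈ cluster P τ j, f p := fun f =>
    (Finset.sum_fiberwise P τ f).symm
  have hcost : cost P A = ∑ j, cost (cluster P τ j) A := hfib _
  have hpos : 0 < cost P A := by
    rw [hcost]
    exact Finset.sum_pos (fun j _ => h j) ⟨⟨0, hk⟩, Finset.mem_univ _⟩
  have hcard : ∀ j, ((cluster P τ j).card : ℝ) ≠ 0 := by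
    intro j hj
    have h0 : cluster P τ j = ∅ := Finset.card_eq_zero.1 (by exact_mod_cast hj)
    have := h j
    simp [h0, cost] at this
  have key : ∀ j, ∑ p ∈ cluster P τ j, score P A τ p
      = (1 / 4) * (1 / k + 1 / k + cost (cluster P τ j) A / cost P A
        + cost (cluster P τ j) A / cost P A) := by
    intro j
    have hj : ∀ p ∈ cluster P τ j, score P A τ p
        = (1 / 4) * (1 / ((k : ℝ) * ((cluster P τ j).card : ℝ))
          + pointCost A p / ((k : ℝ) * cost (cluster P τ j) A)
          + pointCost A p / cost P A
          + cost (cluster P τ j) A / ((cluster P τ j).card : ℝ) / cost P A) := by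
      intro p hp
      have : τ p = j := (Finset.mem_filter.1 hp).2
      simp only [score, avgCost, this]
    have hs : ∑ p ∈ cluster P τ j, pointCost A p = cost (cluster P τ j) A := rfl
    rw [Finset.sum_congr rfl hj, ← Finset.mul_sum]
    simp only [Finset.sum_add_distrib, Finset.sum_const, nsmul_eq_mul, ← Finset.sum_div, hs]
    have h1 := hcard j
    have h2 := (h j).ne'
    field_simp
  rw [hfib, Finset.sum_congr rfl (fun j _ => key j), ← Finset.mul_sum]
  simp only [Finset.sum_add_distrib, Finset.sum_const, nsmul_eq_mul, ← Finset.sum_div,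
    ← hcost, Finset.card_univ, Fintype.card_fin]
  field_simp
  norm_num

end KMedian

end

/-! Write Φ = cost(P,A). For p in C_j the difference cost(p,S) - cost(a_j,S) is at most cost(p,A) in
absolute value, by the triangle inequality. The subtracted part Σ_j |C_j| cost(a_j,S) is well
estimated once the sample estimates every cluster size, which is Bernstein's inequality and a union
bound over clusters. Errors are measured against W(S) = Φ + Σ_j |C_j| cost(a_j,S), and W(S) ≤ (1 +
2γ) cost(P,S) because A is γ-approximate (`errScale_le`).

For the differences, symmetrization (`mass_symmetrization_le`) fixes the sample and leaves a
randomly signed sum. Clusters are grouped by two dyadic scales: T ≈ cost(a_j,S)/Δ_j and b ≈ min(Φ, k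
cost(C_j,A)). Clusters with T beyond about 1/ε or b below about εΦ contribute O(ε W) trivially, so
O(log²(1/ε)) pairs of scales remain (`mass_core_le`). In a class G of total cost Ψ each term is at
most 4b/m and the terms sum to at most 4Ψ, so the squares sum to at most 16bΨ/m; the error allowed
is ε max(Φ, TΨ) up to logarithms. If there are nets of size exp(B 4^h) at scale 2^(-h), chaining
(`mass_chaining_le`) asks, up to logarithms, for B b Ψ ≤ ε² m max(Φ, TΨ)².

Two nets compete, both free of the dimension by a perceptron argument. The near net has B ≈ k T²;
with b ≤ Φ this asks for ε² m ≳ k T. The far net uses that centers at distance at least T Δ_j from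
every a_j in G are described by rounded distances to these a_j and by one vector whose accuracy is
relative to that distance; it has B ≈ k |G|, and |G| b ≤ 2kΨ turns this into ε² m ≳ k²/T². The
smaller of k T and k²/T² is at most k^(4/3), with balance at T = k^(1/3), and it is O(k/ε) because T
= O(1/ε) (`net_option_le`). These are the two terms of the minimum in the theorem. -/

namespace KMedian

/-! ### Perceptron nets and comparison of square roots -/

section Nets

variable {E : Type*} [NormedAddCommGroup E] [InnerProductSpace ℝ E]

/-- One round of the perceptron construction multiplies the size of the net by `2 M + 1` and lowers
the squared distance of every badly approximated vector by `(η R)²`. -/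
theorem exists_perceptron_net_aux {ι : Type*} [Fintype ι] (u : ι → E) (hu : ∀ i, ‖u i‖ ≤ 1)
    {η R : ℝ} (hη : 0 < η) (hR : 0 < R) (n : ℕ) :
    ∃ N : Finset E, N.card ≤ (2 * Fintype.card ι + 1) ^ n ∧
      ∀ v : E, ‖v‖ ≤ R → ∃ v' ∈ N, (∀ i, |inner ℝ (u i) (v - v')| ≤ η * R) ∨
        ‖v - v'‖ ^ 2 ≤ R ^ 2 - n * (η * R) ^ 2 := by
  classical
  induction n with
  | zero =>
    refine ⟨{0}, by simp, fun v hv => ⟨0, by simp, Or.inr ?_⟩⟩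
    have := norm_nonneg v
    simp only [sub_zero, Nat.cast_zero, zero_mul]
    gcongr
  | succ n ih =>
    obtain ⟨N, hN, h⟩ := ih
    let stp : Option (ι × Bool) → E := fun o =>
      o.elim 0 fun x => (if x.2 then η * R else -(η * R)) • u x.1
    refine ⟨(N ×ˢ (Finset.univ : Finset (Option (ι × Bool)))).image fun x => x.1 + stp x.2, ?_, ?_⟩
    · refine Finset.card_image_le.trans ?_
      rw [Finset.card_product, Finset.card_univ, Fintype.card_option, Fintype.card_prod,
        Fintype.card_bool, pow_succ, mul_comm (Fintype.card ι)]
      gcongr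
    · intro v hv
      obtain ⟨v', hv', hor⟩ := h v hv
      by_cases hgood : ∀ i, |inner ℝ (u i) (v - v')| ≤ η * R
      · refine ⟨v', Finset.mem_image.2 ⟨(v', none), by simp [hv'], by simp [stp]⟩, Or.inl hgood⟩
      · have hle := hor.resolve_left hgood
        push Not at hgood
        obtain ⟨i, hi⟩ := hgood
        have hpos : 0 < η * R := mul_pos hη hR
        have hui : ‖u i‖ ^ 2 ≤ 1 := pow_le_one₀ (norm_nonneg _) (hu i)
        -- A step `e • u i` changes the squared distance by `-2 e ⟪u i, v - v'⟫ + e² ‖u i‖²`, which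
        -- is at most `-2 (η R)² + (η R)²`.
        have key : ∀ e : ℝ, e ^ 2 = (η * R) ^ 2 → (η * R) ^ 2 ≤ e * inner ℝ (u i) (v - v') →
            ‖v - (v' + e • u i)‖ ^ 2 ≤ R ^ 2 - ((n + 1 : ℕ) : ℝ) * (η * R) ^ 2 := by
          intro e he1 he2
          have : v - (v' + e • u i) = (v - v') - e • u i := by abel
          rw [this, norm_sub_sq_real, inner_smul_right, real_inner_comm, norm_smul, mul_pow,
            Real.norm_eq_abs, sq_abs, he1]
          push_cast
          nlinarith [sq_nonneg (η * R)]
        rcases lt_abs.1 hi with h1 | h1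
        · refine ⟨v' + (η * R) • u i, Finset.mem_image.2
            ⟨(v', some (i, true)), by simp [hv'], by simp [stp]⟩, Or.inr (key _ rfl ?_)⟩
          nlinarith
        · refine ⟨v' + (-(η * R)) • u i, Finset.mem_image.2
            ⟨(v', some (i, false)), by simp [hv'], by simp [stp]⟩, Or.inr (key _ (by ring) ?_)⟩
          nlinarith

/-- A dimension-free net: the ball of radius `R` is approximated up to `η R` in the direction of
`M` given vectors of norm at most one by `(2 M + 1) ^ n` vectors, where `n ≥ η⁻²`. -/
theorem exists_perceptron_net {ι : Type*} [Fintype ι] (u : ι → E) (hu : ∀ i, ‖u i‖ ≤ 1)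
    {η R : ℝ} (hη : 0 < η) (hR : 0 < R) (n : ℕ) (hn : 1 ≤ n * η ^ 2) :
    ∃ N : Finset E, N.card ≤ (2 * Fintype.card ι + 1) ^ n ∧
      ∀ v : E, ‖v‖ ≤ R → ∃ v' ∈ N, ∀ i, |inner ℝ (u i) (v - v')| ≤ η * R := by
  obtain ⟨N, hN, h⟩ := exists_perceptron_net_aux u hu hη hR n
  refine ⟨N, hN, fun v hv => ?_⟩
  obtain ⟨v', hv', h1 | h1⟩ := h v hv
  · exact ⟨v', hv', h1⟩
  · refine ⟨v', hv', fun i => ?_⟩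
    -- After `n ≥ η⁻²` rounds the budget `R²` is used up, so `v' = v`.
    have h2 : ‖v - v'‖ ^ 2 ≤ 0 := by
      rw [mul_pow] at h1
      nlinarith [mul_nonneg (sub_nonneg.2 hn) (sq_nonneg R)]
    have h3 : v - v' = 0 := by
      have := pow_eq_zero_iff (two_ne_zero) |>.1 (le_antisymm h2 (sq_nonneg _))
      exact norm_eq_zero.1 this
    rw [h3, inner_zero_right, abs_zero]
    positivity

/-- The net of `exists_perceptron_net` for vectors that are not normalized. -/
theorem exists_inner_net {ι : Type*} [Fintype ι] (x : ι → E)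
    {η R : ℝ} (hη : 0 < η) (hR : 0 < R) (n : ℕ) (hn : 1 ≤ n * η ^ 2) :
    ∃ N : Finset E, N.card ≤ (2 * Fintype.card ι + 1) ^ n ∧
      ∀ v : E, ‖v‖ ≤ R → ∃ v' ∈ N, ∀ i, |inner ℝ (x i) (v - v')| ≤ η * R * ‖x i‖ := by
  have hu : ∀ i, ‖(‖x i‖⁻¹) • x i‖ ≤ 1 := by
    intro i
    rw [norm_smul, norm_inv, norm_norm]
    exact inv_mul_le_one
  obtain ⟨N, hN, h⟩ := exists_perceptron_net (fun i => (‖x i‖⁻¹) • x i) hu hη hR n hn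
  refine ⟨N, hN, fun v hv => ?_⟩
  obtain ⟨v', hv', h1⟩ := h v hv
  refine ⟨v', hv', fun i => ?_⟩
  rcases eq_or_ne (x i) 0 with h0 | h0
  · simp [h0]
  · have h2 := h1 i
    have h3 : 0 < ‖x i‖ := norm_pos_iff.2 h0
    rw [inner_smul_left, abs_mul] at h2
    simp only [map_inv₀, conj_trivial, abs_inv, abs_norm] at h2
    rwa [inv_mul_le_iff₀ h3, mul_comm] at h2

/-- Difference of two squares; for `X < 0` the root is `0` and `t² ≤ t² - X`. The factor `√X + t` is
kept so that each application can choose its own lower bound for it. -/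
theorem abs_sqrt_sub_mul_le {X t δ : ℝ} (ht : 0 ≤ t) (h : |X - t ^ 2| ≤ δ) :
    |√X - t| * (√X + t) ≤ δ := by
  have h0 := Real.sqrt_nonneg X
  rw [← abs_of_nonneg (add_nonneg h0 ht), ← abs_mul]
  have : (√X - t) * (√X + t) = √X ^ 2 - t ^ 2 := by ring
  rw [this]
  rcases le_total 0 X with hX | hX
  · rwa [Real.sq_sqrt hX]
  · rw [Real.sqrt_eq_zero_of_nonpos hX]
    rw [abs_le] at *
    constructor <;> nlinarith

/-- Truncation turns an error relative to `t` into one relative to `B`. When `t > B`, `e ≥ (1 - a) t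
- b ≥ (1 - a) B - b`, which is where `a ≤ 1` enters. -/
theorem abs_min_sub_min_le_of_rel {e t a b B : ℝ} (ha : a ≤ 1) (ha0 : 0 ≤ a) (hb : 0 ≤ b)
    (hB : 0 ≤ B) (h : |e - t| ≤ a * t + b) : |min e B - min t B| ≤ a * B + b := by
  rw [abs_le] at h ⊢
  have := mul_nonneg ha0 hB
  rcases le_total e B with h1 | h1 <;> rcases le_total t B with h2 | h2 <;>
    simp only [min_eq_left, min_eq_right, h1, h2] <;>
    constructor <;> nlinarith [mul_le_mul_of_nonneg_left h2 ha0,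
      mul_nonneg (sub_nonneg.2 ha) (sub_nonneg.2 h2)]

end Nets
-- The near net for a single center
section Nets

variable {E : Type*} [NormedAddCommGroup E] [InnerProductSpace ℝ E]

/-- The core estimate of the near net: `c` is at distance `R` from `p`, and `v'` approximates
`c - p` in the direction of `x = q - p`. -/
theorem abs_sqrt_estimate_sub_le {q p c v' : E} {s σ η κ T R' : ℝ} (hη : 0 < η)
    (hη1 : 44 * η ≤ 1) (hκ : 0 < κ) (hσ : 0 < σ) (hσs : σ ≤ s)
    (hρ : ‖p - c‖ ≤ ‖q - c‖ + κ * s) (hR1 : ‖p - c‖ ≤ R')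
    (hR2 : R' ≤ ‖p - c‖ + η * κ * σ)
    (hv : |inner ℝ (q - p) (c - p - v')| ≤ η * R' * ‖q - p‖) (hT : 0 ≤ T) :
    |min (√(‖q - p‖ ^ 2 - 2 * inner ℝ (q - p) v' + R' ^ 2)) (T * s) - min ‖q - c‖ (T * s)|
      ≤ 44 * η * (T * s) + 7 * (κ * s) := by
  set R := ‖p - c‖ with hR
  set t := ‖q - c‖ with ht
  have ht0 : 0 ≤ t := norm_nonneg _
  have hR0 : 0 ≤ R := norm_nonneg _
  have hs : 0 < s := hσ.trans_le hσs
  -- `ρ` controls all lengths: `R ≤ ρ`, while `‖q - p‖` and `R'` are at most `2 ρ`. Hence the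
  -- squared distance is off by `O(η ρ²)`.
  set ρ := t + κ * s with hρd
  have hκs : 0 < κ * s := mul_pos hκ hs
  have hκσ : κ * σ ≤ ρ := by nlinarith
  have hκσ0 : 0 < κ * σ := mul_pos hκ hσ
  have hx : ‖q - p‖ ≤ 2 * ρ := by
    have : ‖q - p‖ ≤ t + R := by
      have h := norm_sub_le_norm_sub_add_norm_sub q c p
      rwa [norm_sub_rev c p] at h
    linarith
  have hx0 : 0 ≤ ‖q - p‖ := norm_nonneg _
  have hR'ρ : R' ≤ 2 * ρ := by nlinarith
  have hR'0 : 0 ≤ R' := hR0.trans hR1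
  have htrue : t ^ 2 = ‖q - p‖ ^ 2 - 2 * inner ℝ (q - p) (c - p) + R ^ 2 := by
    have : q - c = (q - p) - (c - p) := by abel
    rw [ht, this, norm_sub_sq_real, hR, norm_sub_rev p c]
  have hdiff : |(‖q - p‖ ^ 2 - 2 * inner ℝ (q - p) v' + R' ^ 2) - t ^ 2| ≤ 11 * η * ρ ^ 2 := by
    have e1 : (‖q - p‖ ^ 2 - 2 * inner ℝ (q - p) v' + R' ^ 2) - t ^ 2
        = 2 * inner ℝ (q - p) (c - p - v') + (R' - R) * (R' + R) := by
      rw [htrue, inner_sub_right (q - p) (c - p) v']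
      ring
    rw [e1]
    have e2 : η * R' * ‖q - p‖ ≤ η * (2 * ρ) * (2 * ρ) := by gcongr
    have e3 : (R' - R) * (R' + R) ≤ (η * ρ) * (3 * ρ) := by
      have a1 : R' - R ≤ η * ρ := by nlinarith
      have a2 : R' + R ≤ 3 * ρ := by linarith
      exact mul_le_mul a1 a2 (by linarith) (by positivity)
    have e4 : 0 ≤ (R' - R) * (R' + R) := mul_nonneg (by linarith) (by linarith)
    rw [abs_le] at hv ⊢
    constructor <;> nlinarith
  have hmain := abs_sqrt_sub_mul_le ht0 hdiff
  set e := √(‖q - p‖ ^ 2 - 2 * inner ℝ (q - p) v' + R' ^ 2) with he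
  have he0 : 0 ≤ e := Real.sqrt_nonneg _
  -- If `t ≥ κ s`, then `ρ ≤ 2 t` and division by `t` gives a relative error. Otherwise `ρ ≤ 2 κ s`,
  -- and `|e - t|² ≤ 44 η (κ s)² ≤ (7 κ s)²`.
  have hrel : |e - t| ≤ 44 * η * t + 7 * (κ * s) := by
    rcases le_total (κ * s) t with h | h
    · have h1 : |e - t| * t ≤ 44 * η * t * t := by
        have : |e - t| * t ≤ |e - t| * (e + t) := by gcongr; linarith
        have h2 : ρ ≤ 2 * t := by linarith
        have h3 : ρ ^ 2 ≤ (2 * t) ^ 2 := by gcongr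
        nlinarith
      have := le_of_mul_le_mul_right h1 (hκs.trans_le h)
      linarith
    · have h1 : |e - t| * |e - t| ≤ (7 * (κ * s)) * (7 * (κ * s)) := by
        have h4 : |e - t| ≤ e + t := by
          rw [abs_le]; constructor <;> linarith
        have : |e - t| * |e - t| ≤ |e - t| * (e + t) := by gcongr
        have h2 : ρ ≤ 2 * (κ * s) := by linarith
        have h3 : ρ ^ 2 ≤ (2 * (κ * s)) ^ 2 := by gcongr
        nlinarith [sq_nonneg (κ * s)]
      have := abs_le_of_sq_le_sq' (a := |e - t|) (b := 7 * (κ * s)) (by nlinarith) (by positivity)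
      have h5 : 0 ≤ 44 * η * t := by positivity
      linarith [this.2]
  exact abs_min_sub_min_le_of_rel hη1 (by positivity) (by positivity) (by positivity) hrel

/-- Up to the stated error, `c` is determined by an anchor among the points, the smallest relevant
scale, the rounded distance to the anchor and a perceptron vector for `c` minus the anchor; the
polarization identity recovers all distances. -/
theorem exists_near_net_card {ι : Type*} [Fintype ι] (I : Finset ι) (q : ι → E) (s : ι → ℝ)
    (hs : ∀ i ∈ I, 0 < s i) {T η κ : ℝ} (hT : 1 ≤ T) (hη : 0 < η) (hη1 : 44 * η ≤ 1) (hκ : 0 < κ)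
    (n : ℕ) (hn : 1 ≤ n * η ^ 2) :
    ∃ N : Finset (ι → ℝ), N.card ≤ Fintype.card ι * Fintype.card ι *
        (⌊2 * T / (η * κ)⌋₊ + 1) * (2 * Fintype.card ι + 1) ^ n + 1 ∧
      ∀ c : E, ∃ g ∈ N, ∀ i ∈ I,
        |g i - min ‖q i - c‖ (T * s i)| ≤ 44 * η * (T * s i) + 7 * (κ * s i) := by
  classical
  have hηκ : 0 < η * κ := mul_pos hη hκ
  have hnet : ∀ (a : ι × I × Fin (⌊2 * T / (η * κ)⌋₊ + 1)), ∃ N : Finset E,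
      N.card ≤ (2 * Fintype.card ι + 1) ^ n ∧
      ∀ v : E, ‖v‖ ≤ η * κ * s a.2.1 * ((a.2.2 : ℕ) + 1) → ∃ v' ∈ N, ∀ i,
        |inner ℝ (q i - q a.1) (v - v')|
          ≤ η * (η * κ * s a.2.1 * ((a.2.2 : ℕ) + 1)) * ‖q i - q a.1‖ := by
    intro a
    have h0 := hs _ a.2.1.2
    exact exists_inner_net (fun i => q i - q a.1) hη (by positivity) n hn
  choose N hN hN2 using hnet
  let gf : (ι × I × Fin (⌊2 * T / (η * κ)⌋₊ + 1)) → E → ι → ℝ := fun a v' i =>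
    if s i < s a.2.1 then T * s i else
      min (√(‖q i - q a.1‖ ^ 2 - 2 * inner ℝ (q i - q a.1) v'
        + (η * κ * s a.2.1 * ((a.2.2 : ℕ) + 1)) ^ 2)) (T * s i)
  refine ⟨insert (fun i => T * s i) (Finset.univ.biUnion fun a => (N a).image (gf a)), ?_, ?_⟩
  · refine (Finset.card_insert_le _ _).trans (Nat.add_le_add_right ?_ 1)
    refine (Finset.card_biUnion_le_card_mul _ _ ((2 * Fintype.card ι + 1) ^ n) fun a _ =>
      Finset.card_image_le.trans (hN a)).trans ?_
    rw [Finset.card_univ, Fintype.card_prod, Fintype.card_prod, Fintype.card_fin,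
      Fintype.card_coe]
    refine Nat.mul_le_mul_right _ ?_
    rw [mul_assoc (Fintype.card ι) (Fintype.card ι)]
    exact Nat.mul_le_mul_left _ (Nat.mul_le_mul_right _ (Finset.card_le_univ I))
  · intro c
    have hnonneg : ∀ i ∈ I, 0 ≤ 44 * η * (T * s i) + 7 * (κ * s i) := by
      intro i hi
      have := hs i hi
      positivity
    by_cases hrel : ∃ i ∈ I, ‖q i - c‖ ≤ T * s i
    swap
    · push Not at hrel
      refine ⟨_, Finset.mem_insert_self _ _, fun i hi => ?_⟩
      rw [min_eq_right (hrel i hi).le, sub_self, abs_zero]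
      exact hnonneg i hi
    -- `i2` has the smallest scale among the points within their truncation radius, so every point
    -- of smaller scale is truncated. The anchor `i1` satisfies `‖q i1 - c‖ ≤ ‖q i - c‖ + κ s i` for
    -- all remaining `i`.
    obtain ⟨i2, hi2, hmin2⟩ := Finset.exists_min_image (I.filter fun i => ‖q i - c‖ ≤ T * s i) s
      (by obtain ⟨i, hi, h⟩ := hrel; exact ⟨i, by simp [hi, h]⟩)
    rw [Finset.mem_filter] at hi2
    obtain ⟨i1, hi1, hmin1⟩ := Finset.exists_min_image (I.filter fun i => s i2 ≤ s i)
      (fun i => ‖q i - c‖ + κ * s i) ⟨i2, by simp [hi2.1]⟩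
    rw [Finset.mem_filter] at hi1
    have hs2 := hs i2 hi2.1
    have hs1 := hs i1 hi1.1
    have hθ : 0 < η * κ * s i2 := mul_pos hηκ hs2
    set R := ‖q i1 - c‖ with hR
    have hR0 : 0 ≤ R := norm_nonneg _
    have hR2 : R ≤ 2 * T * s i2 := by
      have := hmin1 i2 (by simp [hi2.1])
      have h3 := hi2.2
      nlinarith
    set l := ⌊R / (η * κ * s i2)⌋₊ with hl
    have hlt : l < ⌊2 * T / (η * κ)⌋₊ + 1 := by
      refine Nat.lt_succ_of_le (Nat.floor_le_floor ?_)
      rw [div_le_div_iff₀ hθ hηκ]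
      nlinarith
    set R' := η * κ * s i2 * ((l : ℝ) + 1) with hR'
    have hRR' : R ≤ R' := by
      have := (Nat.lt_floor_add_one (R / (η * κ * s i2))).le
      rw [div_le_iff₀ hθ] at this
      rw [hR']
      linarith
    have hR'R : R' ≤ R + η * κ * s i2 := by
      have := Nat.floor_le (div_nonneg hR0 hθ.le)
      rw [le_div_iff₀ hθ] at this
      rw [hR']
      linarith
    obtain ⟨v', hv', hv⟩ := hN2 (i1, ⟨i2, hi2.1⟩, ⟨l, hlt⟩) (c - q i1) (by
      rw [norm_sub_rev]; exact hRR')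
    refine ⟨gf (i1, ⟨i2, hi2.1⟩, ⟨l, hlt⟩) v', Finset.mem_insert_of_mem
      (Finset.mem_biUnion.2 ⟨_, Finset.mem_univ _, Finset.mem_image_of_mem _ hv'⟩), fun i hi => ?_⟩
    by_cases hsi : s i < s i2
    · have hbig : T * s i < ‖q i - c‖ := by
        by_contra hcon
        exact absurd (hmin2 i (by simp [hi, not_lt.1 hcon])) (not_le.2 hsi)
      simp only [gf, hsi, if_true]
      rw [min_eq_right hbig.le, sub_self, abs_zero]
      exact hnonneg i hi
    · simp only [gf, hsi, if_false]
      have hsi' := not_lt.1 hsi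
      refine abs_sqrt_estimate_sub_le hη hη1 hκ hs2 hsi' ?_ hRR' hR'R (hv i) (by linarith)
      have := hmin1 i (by simp [hi, hsi'])
      have h4 : 0 ≤ κ * s i1 := by positivity
      linarith

theorem one_le_log_two_mul_add_one {M : ℕ} (hM : 1 ≤ M) : 1 ≤ Real.log (2 * M + 1) := by
  have h1 : (3 : ℝ) ≤ 2 * M + 1 := by
    have : (1 : ℝ) ≤ M := by exact_mod_cast hM
    linarith
  rw [Real.le_log_iff_exp_le (by linarith)]
  exact (Real.exp_one_lt_d9.le.trans (by norm_num)).trans h1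

theorem natCast_two_mul_add_one_pow (M n : ℕ) :
    (((2 * M + 1) ^ n : ℕ) : ℝ) = Real.exp (n * Real.log (2 * M + 1)) := by
  rw [Real.exp_nat_mul, Real.exp_log (by positivity)]
  push_cast
  rfl

/-- A net for the distances to a single center, truncated at `T s_i`. -/
theorem exists_near_net {ι : Type*} [Fintype ι] {M : ℕ} (hM : 1 ≤ M) (hιM : Fintype.card ι ≤ M)
    (I : Finset ι) (q : ι → E) (s : ι → ℝ)
    (hs : ∀ i ∈ I, 0 < s i) {T α : ℝ} (hT : 1 ≤ T) (hα : 0 < α) (hα1 : α ≤ 1) :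
    ∃ N : Finset (ι → ℝ), (N.card : ℝ) ≤ Real.exp (11000 * (T / α) ^ 2 * Real.log (2 * M + 1)) ∧
      ∀ c : E, ∃ g ∈ N, ∀ i ∈ I, |g i - min ‖q i - c‖ (T * s i)| ≤ α * s i := by
  have hT0 : 0 < T := by linarith
  set z := (T / α) ^ 2 with hz
  have hz1 : 1 ≤ z := one_le_pow₀ (by rw [le_div_iff₀ hα]; linarith)
  -- With `η = α / (88 T)` and `κ = α / 14` the two error terms `44 η T s` and `7 κ s` are both `α s
  -- / 2`.
  have hη : 0 < α / (88 * T) := by positivity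
  have hη1 : 44 * (α / (88 * T)) ≤ 1 := by
    rw [mul_div_assoc', div_le_one (by positivity)]
    nlinarith
  have hηz : 1 / (α / (88 * T)) ^ 2 = 7744 * z := by
    rw [hz]; field_simp; norm_num
  have hqz : 2 * T / (α / (88 * T) * (α / 14)) = 2464 * z := by
    rw [hz]; field_simp; norm_num
  obtain ⟨N, hN, h⟩ := exists_near_net_card I q s hs hT hη hη1 (κ := α / 14) (by positivity)
    ⌈1 / (α / (88 * T)) ^ 2⌉₊ (by
      have := Nat.le_ceil (1 / (α / (88 * T)) ^ 2)
      rwa [div_le_iff₀ (by positivity)] at this)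
  refine ⟨N, ?_, fun c => ?_⟩
  · rw [hηz, hqz] at hN
    set L := Real.log (2 * M + 1)
    have hL : 1 ≤ L := one_le_log_two_mul_add_one hM
    set n := ⌈7744 * z⌉₊ with hn
    have hnz : (n : ℝ) ≤ 7745 * z := by
      have := Nat.ceil_lt_add_one (a := 7744 * z) (by positivity)
      linarith
    have hN' : N.card ≤ (2 * M + 1) ^ 2 * (⌊2464 * z⌋₊ + 1) * (2 * M + 1) ^ n := by
      refine hN.trans ?_
      have e1 : 1 ≤ (⌊2464 * z⌋₊ + 1) * (2 * M + 1) ^ n := Nat.one_le_iff_ne_zero.2 (by positivity)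
      calc _ ≤ M * M * (⌊2464 * z⌋₊ + 1) * (2 * M + 1) ^ n + 1 := by gcongr
        _ ≤ _ := by nlinarith
    calc (N.card : ℝ) ≤ (((2 * M + 1) ^ 2 : ℕ) : ℝ) * ((⌊2464 * z⌋₊ : ℝ) + 1)
            * (((2 * M + 1) ^ n : ℕ) : ℝ) := by exact_mod_cast hN'
      _ ≤ Real.exp ((2 : ℕ) * L) * Real.exp (2465 * z) * Real.exp (n * L) := by
          rw [natCast_two_mul_add_one_pow, natCast_two_mul_add_one_pow]
          gcongr
          have h1 := Nat.floor_le (a := 2464 * z) (by positivity)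
          have h2 := Real.add_one_le_exp (2465 * z)
          linarith
      _ ≤ Real.exp (11000 * z * L) := by
          rw [← Real.exp_add, ← Real.exp_add]
          refine Real.exp_le_exp.2 ?_
          have h1 : (n : ℝ) * L ≤ 7745 * z * L := by gcongr
          have h2 : L ≤ z * L := by nlinarith
          have h3 : z ≤ z * L := by nlinarith
          push_cast
          nlinarith
  · obtain ⟨g, hg, h2⟩ := h c
    refine ⟨g, hg, fun i hi => (h2 i hi).trans (le_of_eq ?_)⟩
    field_simp
    ring

end Nets
-- The far net for a single center
section Nets

variable {E : Type*} [NormedAddCommGroup E] [InnerProductSpace ℝ E]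

/-- The core estimate of the far net: `b` approximates `‖a - c‖`, and `v'` approximates `c - p` in
the direction of `q - a`. -/
theorem abs_sqrt_far_estimate_sub_le {q a c p v' : E} {b Δ α B : ℝ}
    (hA : 0 < ‖a - c‖) (hr : ‖q - a‖ ≤ ‖a - c‖ / 2) (hb0 : 0 ≤ b) (hb : b ≤ ‖a - c‖)
    (hb' : ‖a - c‖ - b ≤ α / 4 * Δ) (hB : 0 ≤ B)
    (hv : |inner ℝ (q - a) (c - p - v')| ≤ α / 4 * ‖a - c‖ * ‖q - a‖) :
    |min (√(b ^ 2 + ‖q - a‖ ^ 2 - 2 * inner ℝ (q - a) (p + v' - a))) B - min ‖q - c‖ B|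
      ≤ α * (‖q - a‖ + Δ) := by
  set A := ‖a - c‖ with hAd
  set r := ‖q - a‖ with hrd
  set t := ‖q - c‖ with htd
  have ht0 : 0 ≤ t := norm_nonneg _
  have hr0 : 0 ≤ r := norm_nonneg _
  -- The gain over the near net: `‖q - c‖` is comparable to `A`, so an error of the squared distance
  -- is divided by `A / 2`.
  have htA : A / 2 ≤ t := by
    have h := norm_sub_le_norm_sub_add_norm_sub a q c
    rw [norm_sub_rev a q] at h
    linarith
  have htrue : t ^ 2 = r ^ 2 - 2 * inner ℝ (q - a) (c - a) + A ^ 2 := by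
    have : q - c = (q - a) - (c - a) := by abel
    rw [htd, this, norm_sub_sq_real, hAd, norm_sub_rev a c]
  have hΔ : 0 ≤ α / 4 * Δ := by linarith
  have hdiff : |(b ^ 2 + r ^ 2 - 2 * inner ℝ (q - a) (p + v' - a)) - t ^ 2|
      ≤ A / 2 * (α * (r + Δ)) := by
    have e0 : inner ℝ (q - a) (p + v' - a)
        = inner ℝ (q - a) (c - a) - inner ℝ (q - a) (c - p - v') := by
      rw [← inner_sub_right]
      congr 1
      abel
    have e1 : (b ^ 2 + r ^ 2 - 2 * inner ℝ (q - a) (p + v' - a)) - t ^ 2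
        = 2 * inner ℝ (q - a) (c - p - v') - (A - b) * (A + b) := by
      rw [htrue, e0]
      ring
    rw [e1]
    have e3 : (A - b) * (A + b) ≤ (α / 4 * Δ) * (2 * A) :=
      mul_le_mul hb' (by linarith) (by linarith) hΔ
    have e4 : 0 ≤ (A - b) * (A + b) := mul_nonneg (by linarith) (by linarith)
    rw [abs_le] at hv ⊢
    constructor <;> nlinarith
  have hmain := abs_sqrt_sub_mul_le ht0 hdiff
  set e := √(b ^ 2 + r ^ 2 - 2 * inner ℝ (q - a) (p + v' - a)) with he
  have he0 : 0 ≤ e := Real.sqrt_nonneg _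
  have hrel : |e - t| ≤ α * (r + Δ) := by
    have h1 : |e - t| * (A / 2) ≤ |e - t| * (e + t) := by gcongr; linarith
    refine le_of_mul_le_mul_right (h1.trans (hmain.trans (le_of_eq ?_))) (half_pos hA)
    ring
  have := abs_min_sub_min_le_of_rel (a := 0) (b := α * (r + Δ)) (e := e) (t := t) (B := B)
    zero_le_one le_rfl ((abs_nonneg _).trans hrel) hB (by linarith)
  linarith

/-- Rounding `‖a j - c‖` separately for each `j ∈ G` costs a power `G.card` of `T / α`. In return
the perceptron net needs accuracy relative to `‖a j - c‖` only, so its exponent is `α⁻²` without the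
factor `T²`. -/
theorem exists_far_net_card {ι κ : Type*} [Fintype ι] [Fintype κ] (cl : ι → κ) (G : Finset κ)
    (I : Finset ι) (hI : ∀ i ∈ I, cl i ∈ G) (q : ι → E) (a : κ → E) (Δ : κ → ℝ)
    (hΔ : ∀ j ∈ G, 0 < Δ j) {T α : ℝ} (hT : 1 ≤ T) (hα : 0 < α)
    (hr : ∀ i ∈ I, ‖q i - a (cl i)‖ ≤ T * Δ (cl i) / 2) (n : ℕ) (hn : 1 ≤ n * (α / 20) ^ 2) :
    ∃ N : Finset (ι → ℝ), N.card ≤ Fintype.card κ * (⌊20 * T / α⌋₊ + 2) ^ G.card *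
        (2 * Fintype.card ι + 1) ^ n + 1 ∧
      ∀ c : E, (∀ j ∈ G, T * Δ j ≤ ‖a j - c‖) → ∃ g ∈ N, ∀ i ∈ I,
        |g i - min ‖q i - c‖ (4 * T * Δ (cl i))| ≤ α * (‖q i - a (cl i)‖ + Δ (cl i)) := by
  classical
  have hT0 : 0 < T := by linarith
  set F := ⌊20 * T / α⌋₊ with hF
  have hnet : ∀ j1 : G, ∃ N : Finset E, N.card ≤ (2 * Fintype.card ι + 1) ^ n ∧
      ∀ v : E, ‖v‖ ≤ 5 * T * Δ j1 → ∃ v' ∈ N, ∀ i,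
        |inner ℝ (q i - a (cl i)) (v - v')|
          ≤ (α / 20) * (5 * T * Δ j1) * ‖q i - a (cl i)‖ := by
    intro j1
    have h0 := hΔ _ j1.2
    exact exists_inner_net (fun i => q i - a (cl i)) (by positivity) (by positivity) n hn
  choose N hN hN2 using hnet
  -- Level `F + 1` marks clusters beyond `5 T Δ`, all of whose points in `I` are truncated. Lower
  -- levels are `‖a j - c‖` rounded down to a multiple of `α / 4 * Δ j`.
  let gf : (G × (G → Fin (F + 2))) → E → ι → ℝ := fun b v' i =>
    if h : cl i ∈ G then
      if ((b.2 ⟨cl i, h⟩ : Fin (F + 2)) : ℕ) = F + 1 then 4 * T * Δ (cl i) else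
      min (√((α / 4 * Δ (cl i) * ((b.2 ⟨cl i, h⟩ : Fin (F + 2)) : ℕ)) ^ 2 + ‖q i - a (cl i)‖ ^ 2
        - 2 * inner ℝ (q i - a (cl i)) (a b.1 + v' - a (cl i)))) (4 * T * Δ (cl i))
    else 0
  refine ⟨insert (fun i => 4 * T * Δ (cl i))
    (Finset.univ.biUnion fun b => (N b.1).image (gf b)), ?_, ?_⟩
  · refine (Finset.card_insert_le _ _).trans (Nat.add_le_add_right ?_ 1)
    refine (Finset.card_biUnion_le_card_mul _ _ ((2 * Fintype.card ι + 1) ^ n) fun b _ =>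
      Finset.card_image_le.trans (hN b.1)).trans ?_
    rw [Finset.card_univ, Fintype.card_prod, Fintype.card_fun, Fintype.card_fin, Fintype.card_coe]
    exact Nat.mul_le_mul_right _ (Nat.mul_le_mul_right _ (Finset.card_le_univ G))
  · intro c hc
    have hnonneg : ∀ i ∈ I, 0 ≤ α * (‖q i - a (cl i)‖ + Δ (cl i)) := by
      intro i hi
      have := hΔ _ (hI i hi)
      positivity
    have hfar : ∀ i ∈ I, 5 * T * Δ (cl i) < ‖a (cl i) - c‖ →
        |4 * T * Δ (cl i) - min ‖q i - c‖ (4 * T * Δ (cl i))|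
          ≤ α * (‖q i - a (cl i)‖ + Δ (cl i)) := by
      intro i hi h
      have h1 := norm_sub_le_norm_sub_add_norm_sub (a (cl i)) (q i) c
      rw [norm_sub_rev (a (cl i)) (q i)] at h1
      have h2 := hr i hi
      have h3 := mul_pos hT0 (hΔ _ (hI i hi))
      rw [min_eq_right (by linarith), sub_self, abs_zero]
      exact hnonneg i hi
    by_cases hrel : ∃ j ∈ G, ‖a j - c‖ ≤ 5 * T * Δ j
    swap
    · push Not at hrel
      exact ⟨_, Finset.mem_insert_self _ _, fun i hi => hfar i hi (hrel _ (hI i hi))⟩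
    obtain ⟨j1, hj1, hmin⟩ := Finset.exists_min_image (G.filter fun j => ‖a j - c‖ ≤ 5 * T * Δ j)
      (fun j => ‖a j - c‖) (by obtain ⟨j, hj, h⟩ := hrel; exact ⟨j, by simp [hj, h]⟩)
    rw [Finset.mem_filter] at hj1
    obtain ⟨v', hv', hv⟩ := hN2 ⟨j1, hj1.1⟩ (c - a j1) (by rw [norm_sub_rev]; exact hj1.2)
    have hlt : ∀ j : G, ‖a j - c‖ ≤ 5 * T * Δ j → ⌊‖a j - c‖ / (α / 4 * Δ j)⌋₊ < F + 1 := by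
      intro j hj
      have h0 := hΔ j j.2
      refine Nat.lt_succ_of_le (Nat.floor_le_floor ?_)
      rw [div_le_div_iff₀ (by positivity) hα]
      nlinarith
    let lev : G → Fin (F + 2) := fun j =>
      if h : ‖a j - c‖ ≤ 5 * T * Δ j then
        ⟨⌊‖a j - c‖ / (α / 4 * Δ j)⌋₊, (hlt j h).trans (Nat.lt_succ_self _)⟩
      else Fin.last _
    refine ⟨gf (⟨j1, hj1.1⟩, lev) v', Finset.mem_insert_of_mem
      (Finset.mem_biUnion.2 ⟨_, Finset.mem_univ _, Finset.mem_image_of_mem _ hv'⟩), fun i hi => ?_⟩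
    have hG := hI i hi
    have h0 := hΔ _ hG
    by_cases hnear : ‖a (cl i) - c‖ ≤ 5 * T * Δ (cl i)
    · have hlev : ((lev ⟨cl i, hG⟩ : Fin (F + 2)) : ℕ)
          = ⌊‖a (cl i) - c‖ / (α / 4 * Δ (cl i))⌋₊ := by
        simp only [lev, hnear, dif_pos]
      have hlt' := hlt ⟨cl i, hG⟩ hnear
      simp only [gf, hG, dif_pos, hlev]
      rw [if_neg hlt'.ne]
      have hpos : 0 < α / 4 * Δ (cl i) := by positivity
      have hf1 := Nat.floor_le (div_nonneg (norm_nonneg (a (cl i) - c)) hpos.le)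
      have hf2 := (Nat.lt_floor_add_one (‖a (cl i) - c‖ / (α / 4 * Δ (cl i)))).le
      rw [le_div_iff₀ hpos] at hf1
      rw [div_le_iff₀ hpos] at hf2
      have hcG := hc _ hG
      have hTΔ := mul_pos hT0 h0
      refine abs_sqrt_far_estimate_sub_le (hTΔ.trans_le hcG) ((hr i hi).trans (by linarith))
        (by positivity) (by linarith) (by linarith) (by positivity) ((hv i).trans ?_)
      -- By minimality of `j1` the radius `5 T Δ j1` is at most `5 ‖a (cl i) - c‖`, so accuracy `α /
      -- 20` becomes `α / 4` relative to the distance of the cluster at hand.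
      have h5 : T * Δ j1 ≤ ‖a (cl i) - c‖ :=
        (hc j1 hj1.1).trans (hmin (cl i) (by simp [hG, hnear]))
      refine mul_le_mul_of_nonneg_right ?_ (norm_nonneg _)
      simp only
      nlinarith
    · have hlev : ((lev ⟨cl i, hG⟩ : Fin (F + 2)) : ℕ) = F + 1 := by
        simp only [lev, hnear, dif_neg, not_false_eq_true, Fin.val_last]
      simp only [gf, hG, dif_pos, hlev, if_true]
      exact hfar i hi (not_le.1 hnear)

/-- A net for the distances to a single center that is far from all clusters in `G`, truncated at
`4 T Δ`. -/
theorem exists_far_net {ι κ : Type*} [Fintype ι] [Fintype κ] {M : ℕ} (hM : 1 ≤ M)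
    (hιM : Fintype.card ι ≤ M) (hκM : Fintype.card κ ≤ M) (cl : ι → κ) (G : Finset κ)
    (I : Finset ι) (hI : ∀ i ∈ I, cl i ∈ G) (q : ι → E) (a : κ → E) (Δ : κ → ℝ)
    (hΔ : ∀ j ∈ G, 0 < Δ j) {T α : ℝ} (hT : 1 ≤ T) (hα : 0 < α) (hα1 : α ≤ 1)
    (hr : ∀ i ∈ I, ‖q i - a (cl i)‖ ≤ T * Δ (cl i) / 2) :
    ∃ N : Finset (ι → ℝ), (N.card : ℝ) ≤ Real.exp (G.card * Real.log (22 * T / α)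
        + 402 / α ^ 2 * Real.log (2 * M + 1)) ∧
      ∀ c : E, (∀ j ∈ G, T * Δ j ≤ ‖a j - c‖) → ∃ g ∈ N, ∀ i ∈ I,
        |g i - min ‖q i - c‖ (4 * T * Δ (cl i))| ≤ α * (‖q i - a (cl i)‖ + Δ (cl i)) := by
  set z := 1 / α ^ 2 with hz
  have hz1 : 1 ≤ z := by rw [hz, le_div_iff₀ (by positivity), one_mul]; exact pow_le_one₀ hα.le hα1
  obtain ⟨N, hN, h⟩ := exists_far_net_card cl G I hI q a Δ hΔ hT hα hr ⌈1 / (α / 20) ^ 2⌉₊ (by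
      have := Nat.le_ceil (1 / (α / 20) ^ 2)
      rwa [div_le_iff₀ (by positivity)] at this)
  refine ⟨N, ?_, h⟩
  have hηz : 1 / (α / 20) ^ 2 = 400 * z := by
    rw [hz]; field_simp; norm_num
  rw [hηz] at hN
  set L := Real.log (2 * M + 1)
  have hL : 1 ≤ L := one_le_log_two_mul_add_one hM
  set n := ⌈400 * z⌉₊ with hn
  have hnz : (n : ℝ) ≤ 401 * z := by
    have := Nat.ceil_lt_add_one (a := 400 * z) (by positivity)
    linarith
  have hN' : N.card ≤ (2 * M + 1) ^ 1 * (⌊20 * T / α⌋₊ + 2) ^ G.card * (2 * M + 1) ^ n := by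
    refine hN.trans ?_
    have e1 : 1 ≤ (⌊20 * T / α⌋₊ + 2) ^ G.card * (2 * M + 1) ^ n :=
      Nat.one_le_iff_ne_zero.2 (by positivity)
    calc _ ≤ M * (⌊20 * T / α⌋₊ + 2) ^ G.card * (2 * M + 1) ^ n + 1 := by gcongr
      _ ≤ _ := by nlinarith
  have hTα : 1 ≤ T / α := by rw [le_div_iff₀ hα]; linarith
  have hF : ((⌊20 * T / α⌋₊ : ℝ) + 2) ≤ 22 * T / α := by
    have h1 := Nat.floor_le (a := 20 * T / α) (by positivity)
    have h2 : 22 * T / α = 20 * T / α + 2 * (T / α) := by ring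
    linarith
  calc (N.card : ℝ) ≤ (((2 * M + 1) ^ 1 : ℕ) : ℝ) * ((⌊20 * T / α⌋₊ : ℝ) + 2) ^ G.card
          * (((2 * M + 1) ^ n : ℕ) : ℝ) := by exact_mod_cast hN'
    _ ≤ Real.exp ((1 : ℕ) * L) * (22 * T / α) ^ G.card * Real.exp (n * L) := by
        rw [natCast_two_mul_add_one_pow, natCast_two_mul_add_one_pow]
        gcongr
    _ = Real.exp ((1 : ℕ) * L + G.card * Real.log (22 * T / α) + n * L) := by
        rw [Real.exp_add, Real.exp_add, Real.exp_nat_mul (Real.log (22 * T / α)),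
          Real.exp_log (by positivity)]
    _ ≤ Real.exp (G.card * Real.log (22 * T / α) + 402 / α ^ 2 * L) := by
        refine Real.exp_le_exp.2 ?_
        have h1 : (n : ℝ) * L ≤ 401 * z * L := by gcongr
        have h2 : L ≤ z * L := by nlinarith
        have h3 : 402 / α ^ 2 = 402 * z := by rw [hz]; ring
        rw [h3]
        push_cast
        linarith

end Nets
-- Nets for cost differences of `k`-tuples
section TupleNets

variable {d k : ℕ}

theorem pointCost_le (S : Fin k → Pt d) (p : Pt d) (c : Fin k) : pointCost S p ≤ dist p (S c) :=
  ciInf_le (Set.finite_range _).bddBelow c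

theorem exists_pointCost_eq (hk : 1 ≤ k) (S : Fin k → Pt d) (p : Pt d) :
    ∃ c, pointCost S p = dist p (S c) := by
  have : Nonempty (Fin k) := ⟨⟨0, hk⟩⟩
  obtain ⟨c, hc⟩ := exists_eq_ciInf_of_finite (f := fun j => dist p (S j))
  exact ⟨c, hc.symm⟩

theorem pointCost_le_dist_add (S : Fin k → Pt d) (p a : Pt d) :
    pointCost S p ≤ dist p a + pointCost S a := by
  rcases Nat.eq_zero_or_pos k with rfl | hk
  · simp [pointCost]
  · obtain ⟨c, hc⟩ := exists_pointCost_eq hk S a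
    rw [hc]
    exact (pointCost_le S p c).trans (dist_triangle _ _ _)

theorem abs_pointCost_sub_le (S : Fin k → Pt d) (p a : Pt d) :
    |pointCost S p - pointCost S a| ≤ dist p a := by
  have h1 := pointCost_le_dist_add S p a
  have h2 := pointCost_le_dist_add S a p
  rw [dist_comm a p] at h2
  rw [abs_le]
  constructor <;> linarith

/-- A net for a single center yields a net for the costs of `k`-tuples of centers. -/
theorem exists_tuple_net (hk : 1 ≤ k) {ι : Type*} (I : Finset ι) (x : ι → Pt d)
    (B tol : ι → ℝ) (Q : Pt d → Prop) (N : Finset (ι → ℝ))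
    (hN : ∀ c, Q c → ∃ g ∈ N, ∀ i ∈ I, |g i - min ‖x i - c‖ (B i)| ≤ tol i) :
    ∃ N' : Finset (ι → ℝ), N'.card ≤ N.card ^ k ∧
      ∀ S : Fin k → Pt d, (∀ c, Q (S c)) → (∀ i ∈ I, pointCost S (x i) ≤ B i) →
        ∃ g ∈ N', ∀ i ∈ I, |g i - pointCost S (x i)| ≤ tol i := by
  classical
  have : Nonempty (Fin k) := ⟨⟨0, hk⟩⟩
  refine ⟨(Fintype.piFinset fun _ : Fin k => N).image fun G i => ⨅ c, G c i, ?_, ?_⟩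
  · refine Finset.card_image_le.trans ?_
    simp [Fintype.card_piFinset]
  · intro S hQ hB
    choose g hg h using fun c => hN (S c) (hQ c)
    refine ⟨_, Finset.mem_image_of_mem _ (Fintype.mem_piFinset.2 hg), fun i hi => ?_⟩
    obtain ⟨c1, hc1⟩ := exists_eq_ciInf_of_finite (f := fun c => g c i)
    obtain ⟨c2, hc2⟩ := exists_pointCost_eq hk S (x i)
    have e1 : (⨅ c, g c i) ≤ g c2 i := ciInf_le (Set.finite_range _).bddBelow c2
    have e2 := pointCost_le S (x i) c1
    have h1 := abs_le.1 (h c1 i hi)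
    have h2 := abs_le.1 (h c2 i hi)
    have hBi := hB i hi
    rw [dist_eq_norm] at e2 hc2
    -- Truncation is inactive at the nearest center; at the other centers the truncated distance
    -- only has to stay above the minimum.
    rw [min_eq_left (hc2 ▸ hBi)] at h2
    have h3 : pointCost S (x i) ≤ min ‖x i - S c1‖ (B i) := le_min e2 hBi
    rw [← hc1] at e1 ⊢
    rw [abs_le]
    constructor <;> linarith [h1.1, h2.2]

variable {m : ℕ}

/-- A net for the functions `p ↦ cost(p, S) - cost(a_j, S)` where `cost(a_j, S) ≤ 2 T Δ_j`. -/
theorem exists_costDiff_net_near (hk : 1 ≤ k) (q : Fin m → Pt d) (a : Fin k → Pt d)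
    (cl : Fin m → Fin k) (Δ : Fin k → ℝ) (G : Finset (Fin k)) (hΔ : ∀ j ∈ G, 0 < Δ j)
    {T α : ℝ} (hT : 1 ≤ T) (hα : 0 < α) (hα1 : α ≤ 1) :
    ∃ N : Finset (Fin m → ℝ),
      (N.card : ℝ) ≤ Real.exp (176000 * k * T ^ 2 / α ^ 2 * Real.log (2 * (m + k : ℕ) + 1)) ∧
      ∀ S : Fin k → Pt d, (∀ j ∈ G, pointCost S (a j) ≤ 2 * T * Δ j) →
        ∃ g ∈ N, ∀ i, cl i ∈ G → |g i - (pointCost S (q i) - pointCost S (a (cl i)))|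
          ≤ α * (dist (q i) (a (cl i)) + Δ (cl i)) := by
  classical
  -- The centers are adjoined to the sample points, so that one net serves both terms of the
  -- difference, each with precision `α / 2`. A center has scale `Δ`.
  let cl' : Fin m ⊕ Fin k → Fin k := Sum.elim cl id
  let x : Fin m ⊕ Fin k → Pt d := Sum.elim q a
  let s : Fin m ⊕ Fin k → ℝ := fun i => dist (x i) (a (cl' i)) + Δ (cl' i)
  let I : Finset (Fin m ⊕ Fin k) := Finset.univ.filter fun i => cl' i ∈ G
  have hs : ∀ i ∈ I, 0 < s i := by
    intro i hi
    have := hΔ _ (Finset.mem_filter.1 hi).2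
    have := dist_nonneg (x := x i) (y := a (cl' i))
    simp only [s]
    linarith
  obtain ⟨N, hN, h⟩ := exists_near_net (M := m + k) (by lia) (by simp) I x s hs
    (T := 2 * T) (by linarith) (half_pos hα) (by linarith)
  obtain ⟨N', hN', h'⟩ := exists_tuple_net hk I x (fun i => 2 * T * s i) (fun i => α / 2 * s i)
    (fun _ => True) N (fun c _ => h c)
  refine ⟨N'.image fun g i => g (Sum.inl i) - g (Sum.inr (cl i)), ?_, fun S hS => ?_⟩
  · calc (((N'.image fun g i => g (Sum.inl i) - g (Sum.inr (cl i))).card : ℕ) : ℝ)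
        ≤ (N.card : ℝ) ^ k := by exact_mod_cast Finset.card_image_le.trans hN'
      _ ≤ _ := by
        refine (pow_le_pow_left₀ (Nat.cast_nonneg _) hN k).trans (le_of_eq ?_)
        rw [← Real.exp_nat_mul]
        congr 1
        field_simp
        ring
  · obtain ⟨g, hg, hgi⟩ := h' S (fun _ => trivial) (by
      intro i hi
      have h1 := hS _ (Finset.mem_filter.1 hi).2
      have h2 := pointCost_le_dist_add S (x i) (a (cl' i))
      have h3 := dist_nonneg (x := x i) (y := a (cl' i))
      simp only [s]
      nlinarith)
    refine ⟨_, Finset.mem_image_of_mem _ hg, fun i hi => ?_⟩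
    have h1 := abs_le.1 (hgi (Sum.inl i) (by simpa [I, cl'] using hi))
    have h2 := abs_le.1 (hgi (Sum.inr (cl i)) (by simpa [I, cl'] using hi))
    simp only [s, x, cl', Sum.elim_inl, Sum.elim_inr, id, dist_self, zero_add] at h1 h2
    have h3 := mul_nonneg hα.le (dist_nonneg (x := q i) (y := a (cl i)))
    rw [abs_le]
    constructor <;> linarith [h1.1, h1.2, h2.1, h2.2]

/-- A net for the functions `p ↦ cost(p, S) - cost(a_j, S)` where
`T Δ_j ≤ cost(a_j, S) ≤ 2 T Δ_j`. -/
theorem exists_costDiff_net_far (hk : 1 ≤ k) (q : Fin m → Pt d) (a : Fin k → Pt d)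
    (cl : Fin m → Fin k) (Δ : Fin k → ℝ) (G : Finset (Fin k)) (hΔ : ∀ j ∈ G, 0 < Δ j)
    {T α : ℝ} (hT : 1 ≤ T) (hα : 0 < α) (hα1 : α ≤ 1) :
    ∃ N : Finset (Fin m → ℝ),
      (N.card : ℝ) ≤ Real.exp (k * (1101608 / α ^ 2 * Real.log (2 * (m + k : ℕ) + 1)
        + G.card * Real.log (44 * T / α))) ∧
      ∀ S : Fin k → Pt d, (∀ j ∈ G, pointCost S (a j) ≤ 2 * T * Δ j) →
        (∀ j ∈ G, T * Δ j ≤ pointCost S (a j)) →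
        ∃ g ∈ N, ∀ i, cl i ∈ G → |g i - (pointCost S (q i) - pointCost S (a (cl i)))|
          ≤ α * (dist (q i) (a (cl i)) + Δ (cl i)) := by
  classical
  let cl' : Fin m ⊕ Fin k → Fin k := Sum.elim cl id
  let x : Fin m ⊕ Fin k → Pt d := Sum.elim q a
  let r : Fin m ⊕ Fin k → ℝ := fun i => dist (x i) (a (cl' i))
  let s : Fin m ⊕ Fin k → ℝ := fun i => r i + Δ (cl' i)
  let I : Finset (Fin m ⊕ Fin k) := Finset.univ.filter fun i => cl' i ∈ G
  have hIG : ∀ i ∈ I, cl' i ∈ G := fun i hi => (Finset.mem_filter.1 hi).2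
  have hr0 : ∀ i, 0 ≤ r i := fun i => dist_nonneg
  have hs : ∀ i ∈ I, 0 < s i := by
    intro i hi
    have := hΔ _ (hIG i hi)
    have := hr0 i
    simp only [s]
    linarith
  -- Here `2 T Δ < 4 r`, so costs are at most `5 r` and a near net with truncation factor `5`
  -- suffices, whatever `T` is. The other points satisfy the hypothesis of the far net.
  let I1 := I.filter fun i => T * Δ (cl' i) / 2 < r i
  let I2 := I.filter fun i => ¬ T * Δ (cl' i) / 2 < r i
  obtain ⟨N1, hN1, h1⟩ := exists_near_net (M := m + k) (by lia) (by simp) I1 x s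
    (fun i hi => hs i (Finset.mem_filter.1 hi).1)
    (T := 5) (by norm_num) (half_pos hα) (by linarith)
  obtain ⟨N1', hN1', h1'⟩ := exists_tuple_net hk I1 x (fun i => 5 * s i) (fun i => α / 2 * s i)
    (fun _ => True) N1 (fun c _ => h1 c)
  obtain ⟨N2, hN2, h2⟩ := exists_far_net (M := m + k) (by lia) (by simp) (by simp) cl' G I2
    (fun i hi => hIG i (Finset.mem_filter.1 hi).1) x a Δ hΔ hT (half_pos hα) (by linarith)
    (fun i hi => by
      rw [← dist_eq_norm]
      exact not_lt.1 (Finset.mem_filter.1 hi).2)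
  obtain ⟨N2', hN2', h2'⟩ := exists_tuple_net hk I2 x (fun i => 4 * T * Δ (cl' i))
    (fun i => α / 2 * (‖x i - a (cl' i)‖ + Δ (cl' i)))
    (fun c => ∀ j ∈ G, T * Δ j ≤ ‖a j - c‖) N2 h2
  let g' : (Fin m ⊕ Fin k → ℝ) × (Fin m ⊕ Fin k → ℝ) → Fin m ⊕ Fin k → ℝ := fun g i =>
    if T * Δ (cl' i) / 2 < r i then g.1 i else g.2 i
  refine ⟨(N1' ×ˢ N2').image fun g i => g' g (Sum.inl i) - g' g (Sum.inr (cl i)), ?_,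
    fun S hS hS' => ?_⟩
  · have hc : ((N1' ×ˢ N2').image fun g i => g' g (Sum.inl i) - g' g (Sum.inr (cl i))).card
        ≤ (N1.card * N2.card) ^ k := by
      refine Finset.card_image_le.trans ?_
      rw [Finset.card_product, mul_pow]
      exact Nat.mul_le_mul hN1' hN2'
    refine (Nat.cast_le.2 hc).trans ?_
    push_cast
    refine (pow_le_pow_left₀ (by positivity)
      (mul_le_mul hN1 hN2 (by positivity) (by positivity)) k).trans (le_of_eq ?_)
    rw [← Real.exp_add, ← Real.exp_nat_mul]
    congr 2
    have : 22 * T / (α / 2) = 44 * T / α := by field_simp; norm_num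
    rw [this]
    push_cast
    field_simp
    ring
  · have hle : ∀ i ∈ I, pointCost S (x i) ≤ r i + 2 * T * Δ (cl' i) := by
      intro i hi
      have h1 := hS _ (hIG i hi)
      have h2 := pointCost_le_dist_add S (x i) (a (cl' i))
      simp only [r]
      linarith
    obtain ⟨g1, hg1, hgi1⟩ := h1' S (fun _ => trivial) (by
      intro i hi
      have h1 := hle i (Finset.mem_filter.1 hi).1
      have h2 := (Finset.mem_filter.1 hi).2
      have h3 := hΔ _ (hIG i (Finset.mem_filter.1 hi).1)
      simp only [s]
      linarith)
    obtain ⟨g2, hg2, hgi2⟩ := h2' S (fun c j hj => (hS' j hj).trans (by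
        rw [← dist_eq_norm]; exact pointCost_le S (a j) c)) (by
      intro i hi
      have h1 := hle i (Finset.mem_filter.1 hi).1
      have h2 := not_lt.1 (Finset.mem_filter.1 hi).2
      have h3 := mul_pos (zero_lt_one.trans_le hT) (hΔ _ (hIG i (Finset.mem_filter.1 hi).1))
      linarith)
    have hg' : ∀ i ∈ I, |g' (g1, g2) i - pointCost S (x i)| ≤ α / 2 * s i := by
      intro i hi
      by_cases h : T * Δ (cl' i) / 2 < r i
      · simp only [g', h, if_true]
        exact hgi1 i (Finset.mem_filter.2 ⟨hi, h⟩)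
      · simp only [g', h, if_false]
        have := hgi2 i (Finset.mem_filter.2 ⟨hi, h⟩)
        rwa [← dist_eq_norm] at this
    refine ⟨_, Finset.mem_image_of_mem _ (Finset.mk_mem_product hg1 hg2), fun i hi => ?_⟩
    have h1 := abs_le.1 (hg' (Sum.inl i) (by simpa [I, cl'] using hi))
    have h2 := abs_le.1 (hg' (Sum.inr (cl i)) (by simpa [I, cl'] using hi))
    simp only [s, r, x, cl', Sum.elim_inl, Sum.elim_inr, id, dist_self, zero_add] at h1 h2
    have h3 := mul_nonneg hα.le (dist_nonneg (x := q i) (y := a (cl i)))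
    rw [abs_le]
    constructor <;> linarith [h1.1, h1.2, h2.1, h2.2]

end TupleNets
end KMedian

noncomputable section

namespace KMedian

/-! ### Masses on finite probability spaces -/

section Mass

variable {Ω : Type*} [Fintype Ω]

/-- The mass of a set for a weight function on a finite type. -/
def mass (ω : Ω → ℝ) (A : Set Ω) : ℝ := ∑ x, A.indicator ω x

theorem mass_mono {ω : Ω → ℝ} (hω : ∀ x, 0 ≤ ω x) {A B : Set Ω} (h : A ⊆ B) :
    mass ω A ≤ mass ω B :=
  Finset.sum_le_sum fun x _ => Set.indicator_le_indicator_of_subset h (fun a => hω a) x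

theorem mass_union_le {ω : Ω → ℝ} (hω : ∀ x, 0 ≤ ω x) (A B : Set Ω) :
    mass ω (A ∪ B) ≤ mass ω A + mass ω B := by
  rw [mass, mass, mass, ← Finset.sum_add_distrib]
  refine Finset.sum_le_sum fun x _ => ?_
  have h0 := hω x
  by_cases h1 : x ∈ A <;> by_cases h2 : x ∈ B <;> simp [h1, h2, h0]

theorem mass_empty (ω : Ω → ℝ) : mass ω ∅ = 0 := by simp [mass]

theorem mass_univ (ω : Ω → ℝ) : mass ω Set.univ = ∑ x, ω x := by simp [mass]

theorem mass_compl (ω : Ω → ℝ) (A : Set Ω) : mass ω Aᶜ = ∑ x, ω x - mass ω A := by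
  rw [eq_sub_iff_add_eq, mass, mass, ← Finset.sum_add_distrib]
  refine Finset.sum_congr rfl fun x _ => ?_
  by_cases h : x ∈ A <;> simp [h]

theorem mass_biUnion_le {ω : Ω → ℝ} (hω : ∀ x, 0 ≤ ω x) {β : Type*} (s : Finset β)
    (A : β → Set Ω) : mass ω (⋃ b ∈ s, A b) ≤ ∑ b ∈ s, mass ω (A b) := by
  classical
  induction s using Finset.induction_on with
  | empty => simp [mass_empty]
  | insert b s hb ih =>
    rw [Finset.sum_insert hb, Finset.set_biUnion_insert]
    exact (mass_union_le hω _ _).trans (by linarith)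

theorem mass_biUnion_le_card_mul {ω : Ω → ℝ} (hω : ∀ x, 0 ≤ ω x) {β : Type*} (s : Finset β)
    (A : β → Set Ω) {δ : ℝ} (h : ∀ b ∈ s, mass ω (A b) ≤ δ) :
    mass ω (⋃ b ∈ s, A b) ≤ s.card * δ := by
  refine (mass_biUnion_le hω s A).trans ?_
  rw [← nsmul_eq_mul]
  exact Finset.sum_le_card_nsmul s _ δ h

end Mass

/-! ### Product weights and Chernoff's bound -/

section Product

variable {α : Type*} [Fintype α] {m : ℕ}

/-- The weight of the `m`-fold product of a weight function. -/
def prodWeight (μ : α → ℝ) (m : ℕ) (q : Fin m → α) : ℝ := ∏ i, μ (q i)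

omit [Fintype α] in
theorem prodWeight_nonneg {μ : α → ℝ} (hμ : ∀ a, 0 ≤ μ a) (q : Fin m → α) :
    0 ≤ prodWeight μ m q := Finset.prod_nonneg fun i _ => hμ (q i)

theorem sum_prodWeight_mul_prod (μ : α → ℝ) (f : Fin m → α → ℝ) :
    ∑ q, prodWeight μ m q * ∏ i, f i (q i) = ∏ i, ∑ a, μ a * f i a := by
  rw [Finset.prod_univ_sum, Fintype.piFinset_univ]
  refine Finset.sum_congr rfl fun q _ => ?_
  rw [prodWeight, Finset.prod_mul_distrib]

theorem sum_prodWeight {μ : α → ℝ} (hμ : ∑ a, μ a = 1) : ∑ q, prodWeight μ m q = 1 := by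
  have := sum_prodWeight_mul_prod (m := m) μ (fun _ _ => 1)
  simpa [hμ] using this

/-- Chernoff's bound from a bound for the moment generating functions. -/
theorem mass_lt_sum_le {μ : α → ℝ} (hμ : ∀ a, 0 ≤ μ a) (x : Fin m → α → ℝ) (b : Fin m → ℝ)
    {l t : ℝ} (hl : 0 ≤ l) (h : ∀ i, ∑ a, μ a * Real.exp (l * x i a) ≤ Real.exp (b i)) :
    mass (prodWeight μ m) {q | t < ∑ i, x i (q i)} ≤ Real.exp (∑ i, b i - l * t) := by
  have h1 : mass (prodWeight μ m) {q | t < ∑ i, x i (q i)}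
      ≤ ∑ q, prodWeight μ m q * (∏ i, Real.exp (l * x i (q i))) * Real.exp (-(l * t)) := by
    refine Finset.sum_le_sum fun q _ => ?_
    have h0 := prodWeight_nonneg (m := m) hμ q
    rw [← Real.exp_sum, mul_assoc, ← Real.exp_add, ← Finset.mul_sum]
    by_cases hq : q ∈ {q : Fin m → α | t < ∑ i, x i (q i)}
    · rw [Set.indicator_of_mem hq]
      refine le_mul_of_one_le_right h0 (Real.one_le_exp ?_)
      have : t < ∑ i, x i (q i) := hq
      nlinarith
    · rw [Set.indicator_of_notMem hq]
      positivity
  refine h1.trans ?_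
  rw [← Finset.sum_mul, sum_prodWeight_mul_prod μ (fun i a => Real.exp (l * x i a)), sub_eq_add_neg,
    Real.exp_add, Real.exp_sum]
  refine mul_le_mul_of_nonneg_right (Finset.prod_le_prod (fun i _ => ?_) fun i _ => h i)
    (Real.exp_pos _).le
  exact Finset.sum_nonneg fun a _ => mul_nonneg (hμ a) (Real.exp_pos _).le

theorem mass_lt_abs_sum_le {μ : α → ℝ} (hμ : ∀ a, 0 ≤ μ a) (x : Fin m → α → ℝ) (b b' : Fin m → ℝ)
    {l t u : ℝ} (hl : 0 ≤ l) (h : ∀ i, ∑ a, μ a * Real.exp (l * x i a) ≤ Real.exp (b i))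
    (h' : ∀ i, ∑ a, μ a * Real.exp (l * -x i a) ≤ Real.exp (b' i)) :
    mass (prodWeight μ m) {q | t < |∑ i, x i (q i) - u|}
      ≤ Real.exp (∑ i, b i - l * (u + t)) + Real.exp (∑ i, b' i - l * (t - u)) := by
  refine le_trans ?_ (add_le_add (mass_lt_sum_le hμ x b hl h)
    (mass_lt_sum_le hμ (fun i a => -x i a) b' hl h'))
  refine le_trans (mass_mono (prodWeight_nonneg hμ) ?_)
    (mass_union_le (prodWeight_nonneg hμ) _ _)
  intro q hq
  rcases lt_abs.1 (show t < |∑ i, x i (q i) - u| from hq) with h1 | h1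
  · left
    show u + t < _
    linarith
  · right
    show t - u < _
    rw [Finset.sum_neg_distrib]
    linarith

end Product

/-! ### Random signs: Hoeffding's inequality and chaining -/

section Signs

variable {m : ℕ}

/-- The uniform weight on `Bool`. -/
def coin (_ : Bool) : ℝ := 1 / 2

/-- The sign of a Boolean. -/
def sgn (b : Bool) : ℝ := if b then 1 else -1

theorem coin_nonneg (b : Bool) : 0 ≤ coin b := by norm_num [coin]

theorem abs_sgn (b : Bool) : |sgn b| = 1 := by cases b <;> simp [sgn]

theorem abs_sum_sgn_le (σ : Fin m → Bool) (z e : Fin m → ℝ) (h : ∀ i, |z i| ≤ e i) :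
    |∑ i, sgn (σ i) * z i| ≤ ∑ i, e i := by
  refine (Finset.abs_sum_le_sum_abs _ _).trans (Finset.sum_le_sum fun i _ => ?_)
  rw [abs_mul, abs_sgn, one_mul]
  exact h i

/-- Hoeffding's inequality for a signed sum. -/
theorem mass_lt_abs_signed_sum_le (z : Fin m → ℝ) {V t : ℝ} (hV : 0 < V) (ht : 0 ≤ t)
    (hz : ∑ i, z i ^ 2 ≤ V) :
    mass (prodWeight coin m) {σ | t < |∑ i, sgn (σ i) * z i|}
      ≤ 2 * Real.exp (-(t ^ 2 / (2 * V))) := by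
  have hmgf : ∀ l y : ℝ, ∑ a, coin a * Real.exp (l * (sgn a * y)) ≤ Real.exp (l ^ 2 * y ^ 2 / 2) := by
    intro l y
    have h := Real.cosh_le_exp_half_sq (l * y)
    rw [Real.cosh_eq] at h
    simp only [Fintype.sum_bool, coin, sgn, if_true, Bool.false_eq_true, if_false]
    rw [← mul_pow]
    refine le_trans (le_of_eq ?_) h
    rw [one_mul, neg_one_mul, mul_neg]
    ring
  have h1 := mass_lt_abs_sum_le (m := m) (t := t) (u := 0) (l := t / V) coin_nonneg
    (fun i a => sgn a * z i)
    (fun i => (t / V) ^ 2 * z i ^ 2 / 2) (fun i => (t / V) ^ 2 * z i ^ 2 / 2) (by positivity)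
    (fun i => hmgf _ _) (fun i => by
      have := hmgf (t / V) (-z i)
      simpa only [mul_neg, neg_sq] using this)
  simp only [sub_zero, zero_add] at h1
  refine h1.trans ?_
  rw [← two_mul]
  refine mul_le_mul_of_nonneg_left (Real.exp_le_exp.2 ?_) zero_le_two
  rw [← Finset.sum_div, ← Finset.mul_sum]
  have h2 : (t / V) ^ 2 * ∑ i, z i ^ 2 ≤ (t / V) ^ 2 * V := by gcongr
  have h3 : (t / V) ^ 2 * V / 2 - t / V * t = -(t ^ 2 / (2 * V)) := by
    field_simp
    ring
  linarith

/-- Chaining for signed sums: a family with nets of size `exp(B 4 ^ h)` at scale `2 ^ (-h)`. -/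
theorem mass_chaining_le (F : Set (Fin m → ℝ)) (e : Fin m → ℝ) {V B t : ℝ}
    (H : ℕ) (hV : 0 < V) (heV : ∑ i, e i ^ 2 ≤ V) (hB : 0 ≤ B) (hF : ∀ z ∈ F, ∀ i, |z i| ≤ e i)
    (hnet : ∀ h, 1 ≤ h → h ≤ H → ∃ N : Finset (Fin m → ℝ), (N.card : ℝ) ≤ Real.exp (B * 4 ^ h) ∧
      ∀ z ∈ F, ∃ g ∈ N, ∀ i, |g i - z i| ≤ (1 / 2) ^ h * e i)
    (ht : 0 ≤ t) (htB : 72 * B * V ≤ t ^ 2) :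
    mass (prodWeight coin m) {σ | ∃ z ∈ F, (1 / 2) ^ H * ∑ i, e i + H * t
      < |∑ i, sgn (σ i) * z i|} ≤ 2 * H * Real.exp (-(8 * B)) := by
  classical
  -- At level `0` the zero function alone is a net, because `|z| ≤ e`; levels above `H` are filled
  -- arbitrarily.
  have hnet' : ∀ h, ∃ N : Finset (Fin m → ℝ), (h = 0 → N = {0}) ∧ (h ≤ H →
      (N.card : ℝ) ≤ Real.exp (B * 4 ^ h) ∧
      ∀ z ∈ F, ∃ g ∈ N, ∀ i, |g i - z i| ≤ (1 / 2) ^ h * e i) := by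
    intro h
    rcases Nat.eq_zero_or_pos h with rfl | hpos
    · refine ⟨{0}, fun _ => rfl, fun _ => ⟨by simpa using hB, fun z hz => ⟨0, by simp, fun i => ?_⟩⟩⟩
      simpa using hF z hz i
    · by_cases hH : h ≤ H
      · obtain ⟨N, hN⟩ := hnet h hpos hH
        exact ⟨N, fun h0 => absurd h0 hpos.ne', fun _ => hN⟩
      · exact ⟨∅, fun h0 => absurd h0 hpos.ne', fun h0 => absurd h0 hH⟩
  choose N hN0 hN using hnet'
  -- Only pairs that can approximate a common function matter: `2⁻ʰ + 2⁻⁽ʰ⁺¹⁾ = 3 · 2⁻⁽ʰ⁺¹⁾`. This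
  -- gives the variance `9 · 4⁻⁽ʰ⁺¹⁾ V` of a link.
  let pairs : ℕ → Finset ((Fin m → ℝ) × (Fin m → ℝ)) := fun h =>
    (N h ×ˢ N (h + 1)).filter fun g => ∀ i, |g.2 i - g.1 i| ≤ 3 * (1 / 2) ^ (h + 1) * e i
  let bad : ℕ → Set (Fin m → Bool) := fun h =>
    ⋃ g ∈ pairs h, {σ | t < |∑ i, sgn (σ i) * (g.2 i - g.1 i)|}
  have hnn : ∀ σ, 0 ≤ prodWeight coin m σ := prodWeight_nonneg coin_nonneg
  have hbad : ∀ h ∈ Finset.range H, mass (prodWeight coin m) (bad h)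
      ≤ 2 * Real.exp (-(8 * B)) := by
    intro h hh
    have hhH := Finset.mem_range.1 hh
    have h1 := mass_biUnion_le_card_mul hnn (pairs h)
      (fun g => {σ : Fin m → Bool | t < |∑ i, sgn (σ i) * (g.2 i - g.1 i)|})
      (δ := 2 * Real.exp (-(4 * B * 4 ^ (h + 1)))) (by
        intro g hg
        have hgi := (Finset.mem_filter.1 hg).2
        have hV' : 0 < 9 * (1 / 4) ^ (h + 1) * V := by positivity
        refine (mass_lt_abs_signed_sum_le _ hV' ht ?_).trans ?_
        · calc ∑ i, (g.2 i - g.1 i) ^ 2 ≤ ∑ i, 9 * (1 / 4) ^ (h + 1) * e i ^ 2 := by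
                refine Finset.sum_le_sum fun i _ => ?_
                rw [← sq_abs]
                refine (pow_le_pow_left₀ (abs_nonneg _) (hgi i) 2).trans (le_of_eq ?_)
                rw [mul_pow, mul_pow, ← pow_mul, mul_comm (h + 1) 2, pow_mul]
                norm_num
            _ ≤ _ := by
                rw [← Finset.mul_sum]
                gcongr
        · refine mul_le_mul_of_nonneg_left (Real.exp_le_exp.2 (neg_le_neg ?_)) zero_le_two
          rw [le_div_iff₀ (by positivity)]
          have h4 : (4 : ℝ) ^ (h + 1) * (1 / 4) ^ (h + 1) = 1 := by
            rw [← mul_pow]; norm_num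
          calc 4 * B * 4 ^ (h + 1) * (2 * (9 * (1 / 4) ^ (h + 1) * V))
              = 72 * B * V * (4 ^ (h + 1) * (1 / 4) ^ (h + 1)) := by ring
            _ ≤ t ^ 2 := by rw [h4, mul_one]; exact htB)
    refine h1.trans ?_
    have hcard : ((pairs h).card : ℝ) ≤ Real.exp (B * 4 ^ h) * Real.exp (B * 4 ^ (h + 1)) := by
      have : (pairs h).card ≤ (N h).card * (N (h + 1)).card := by
        rw [← Finset.card_product]
        exact Finset.card_filter_le _ _
      calc ((pairs h).card : ℝ) ≤ (N h).card * (N (h + 1)).card := by exact_mod_cast this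
        _ ≤ _ := by
          have a1 := (hN h hhH.le).1
          have a2 := (hN (h + 1) hhH).1
          gcongr
    refine (mul_le_mul_of_nonneg_right hcard (by positivity)).trans ?_
    rw [mul_left_comm, ← Real.exp_add, ← Real.exp_add]
    refine mul_le_mul_of_nonneg_left (Real.exp_le_exp.2 ?_) zero_le_two
    -- The exponent is `B 4ʰ + 4 B 4ʰ` from the pairs and `-16 B 4ʰ` from Hoeffding, in total `-11 B
    -- 4ʰ ≤ -8 B`.
    have h4 : (1 : ℝ) ≤ 4 ^ h := one_le_pow₀ (by norm_num)
    rw [pow_succ]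
    nlinarith [mul_nonneg hB (sub_nonneg.2 h4)]
  refine le_trans (mass_mono hnn ?_) ((mass_biUnion_le_card_mul hnn (Finset.range H) bad
    hbad).trans (le_of_eq ?_))
  · intro σ hσ
    obtain ⟨z, hz, hlt⟩ := hσ
    by_contra hcon
    simp only [Set.mem_iUnion, not_exists] at hcon
    have hgood : ∀ h < H, ∀ g ∈ pairs h, |∑ i, sgn (σ i) * (g.2 i - g.1 i)| ≤ t := by
      intro h hh g hg
      by_contra hc
      refine hcon h (Finset.mem_range.2 hh) ?_
      simp only [bad, Set.mem_iUnion]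
      exact ⟨g, hg, not_le.1 hc⟩
    have happ : ∀ h ≤ H, ∃ g ∈ N h, (∀ i, |g i - z i| ≤ (1 / 2) ^ h * e i) ∧
        |∑ i, sgn (σ i) * g i| ≤ h * t := by
      intro h
      induction h with
      | zero =>
        intro _
        refine ⟨0, by simp [hN0 0 rfl], fun i => ?_, by simp⟩
        simpa using hF z hz i
      | succ h ih =>
        intro hh
        obtain ⟨g, hg, hgz, hgs⟩ := ih (by lia)
        obtain ⟨g', hg', hgz'⟩ := (hN (h + 1) hh).2 z hz
        refine ⟨g', hg', hgz', ?_⟩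
        have h1 := hgood h (by lia) (g, g') (Finset.mem_filter.2
          ⟨Finset.mk_mem_product hg hg', fun i => by
            have a1 := abs_le.1 (hgz i)
            have a2 := abs_le.1 (hgz' i)
            have a3 : (1 / 2 : ℝ) ^ h = 2 * (1 / 2) ^ (h + 1) := by rw [pow_succ]; ring
            rw [a3] at a1
            rw [abs_le]
            constructor <;> linarith [a1.1, a1.2, a2.1, a2.2]⟩)
        have h2 : ∑ i, sgn (σ i) * g' i
            = ∑ i, sgn (σ i) * (g' i - g i) + ∑ i, sgn (σ i) * g i := by
          rw [← Finset.sum_add_distrib]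
          exact Finset.sum_congr rfl fun i _ => by ring
        rw [h2]
        push_cast
        exact (abs_add_le _ _).trans (by linarith)
    obtain ⟨g, hg, hgz, hgs⟩ := happ H le_rfl
    have h2 : ∑ i, sgn (σ i) * z i
        = ∑ i, sgn (σ i) * (z i - g i) + ∑ i, sgn (σ i) * g i := by
      rw [← Finset.sum_add_distrib]
      exact Finset.sum_congr rfl fun i _ => by ring
    have h3 := abs_sum_sgn_le σ (fun i => z i - g i) (fun i => (1 / 2) ^ H * e i)
      (fun i => by rw [abs_sub_comm]; exact hgz i)
    rw [← Finset.mul_sum] at h3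
    rw [h2] at hlt
    have h4 := abs_add_le (∑ i, sgn (σ i) * (z i - g i)) (∑ i, sgn (σ i) * g i)
    linarith
  · rw [Finset.card_range]
    ring

end Signs
-- The error on one class of clusters
section ClassBound

variable {d k m : ℕ}

theorem add_one_le_two_pow (n : ℕ) : ((n : ℝ) + 1) ≤ 2 ^ n := by
  exact_mod_cast Nat.succ_le_of_lt (Nat.lt_two_pow_self (n := n))

/-- The error of the sample on a class of clusters, given nets for the cost differences. -/
theorem mass_class_le_of_net (q : Fin m → Pt d) (a : Fin k → Pt d)
    (cl : Fin m → Fin k) (Δ : Fin k → ℝ) (w : Fin m → ℝ) (hw : ∀ i, 0 ≤ w i)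
    (G : Finset (Fin k)) (𝒮 : Set (Fin k → Pt d)) {Φ Ψ b T U ε L C : ℝ} {N : ℕ}
    (hΔ : ∀ j ∈ G, 0 < Δ j) (hb : 0 < b) (hΨ : 0 < Ψ) (hΨΦ : Ψ ≤ Φ) (hm : 1 ≤ m)
    (hk : 1 ≤ k) (hC : 1 ≤ C) (hL : 1 ≤ L) (hU : 1 ≤ U) (hε : 0 < ε) (hεN : 1 ≤ ε * 2 ^ N)
    (hwb : ∀ i, cl i ∈ G → w i * (dist (q i) (a (cl i)) + Δ (cl i)) ≤ 4 / m * b)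
    (hwΨ : ∑ i, (if cl i ∈ G then w i * (dist (q i) (a (cl i)) + Δ (cl i)) else 0) ≤ 4 * Ψ)
    (hnet : ∀ h, 1 ≤ h → h ≤ 3 * N + 3 → ∃ 𝒩 : Finset (Fin m → ℝ),
      (𝒩.card : ℝ) ≤ Real.exp (C * k * U * L * (4 * N + 13) * 4 ^ h) ∧
      ∀ S ∈ 𝒮, ∃ g ∈ 𝒩, ∀ i, cl i ∈ G →
        |g i - (pointCost S (q i) - pointCost S (a (cl i)))|
          ≤ (1 / 2) ^ h * (dist (q i) (a (cl i)) + Δ (cl i)))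
    (hmC : 539136 * C * (N + 1) ^ 7 * L * (k * U * (b * Ψ)) ≤ ε ^ 2 * m * max Φ (T * Ψ) ^ 2) :
    mass (prodWeight coin m) {σ | ∃ S ∈ 𝒮, ε / (N + 1) ^ 2 * max Φ (T * Ψ) < |∑ i, sgn (σ i) *
        (if cl i ∈ G then w i * (pointCost S (q i) - pointCost S (a (cl i))) else 0)|}
      ≤ 2 * (3 * N + 3 : ℕ) * Real.exp (-(8 * (k * (4 * N + 13)))) := by
  classical
  set X := max Φ (T * Ψ) with hX
  have hXΦ : Φ ≤ X := le_max_left _ _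
  have hX0 : 0 < X := hΨ.trans_le (hΨΦ.trans hXΦ)
  have hm0 : (0 : ℝ) < m := by exact_mod_cast hm
  have hk1 : (1 : ℝ) ≤ k := by exact_mod_cast hk
  let e : Fin m → ℝ := fun i =>
    if cl i ∈ G then w i * (dist (q i) (a (cl i)) + Δ (cl i)) else 0
  have hs0 : ∀ i, cl i ∈ G → 0 ≤ dist (q i) (a (cl i)) + Δ (cl i) := fun i hi =>
    add_nonneg dist_nonneg (hΔ _ hi).le
  have he : ∀ i, 0 ≤ e i := by
    intro i
    by_cases hi : cl i ∈ G
    · simp only [e, hi, if_true]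
      exact mul_nonneg (hw i) (hs0 i hi)
    · simp [e, hi]
  have heb : ∀ i, e i ≤ 4 / m * b := by
    intro i
    by_cases hi : cl i ∈ G
    · simp only [e, hi, if_true]
      exact hwb i hi
    · simp only [e, hi, if_false]
      positivity
  let F : Set (Fin m → ℝ) := (fun (S : Fin k → Pt d) i =>
    if cl i ∈ G then w i * (pointCost S (q i) - pointCost S (a (cl i))) else 0) '' 𝒮
  have hV : 0 < 16 * b * Ψ / m := by positivity
  -- The sum of squares is at most the maximum `4 b / m` times the sum `4 Ψ`.
  have heV : ∑ i, e i ^ 2 ≤ 16 * b * Ψ / m := by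
    calc ∑ i, e i ^ 2 ≤ ∑ i, 4 / m * b * e i := by
          refine Finset.sum_le_sum fun i _ => ?_
          rw [sq]
          exact mul_le_mul_of_nonneg_right (heb i) (he i)
      _ ≤ 4 / m * b * (4 * Ψ) := by
          rw [← Finset.mul_sum]
          exact mul_le_mul_of_nonneg_left hwΨ (by positivity)
      _ = _ := by ring
  have hB : 0 ≤ C * k * U * L * (4 * N + 13) := by positivity
  have hF : ∀ z ∈ F, ∀ i, |z i| ≤ e i := by
    rintro z ⟨S, hS, rfl⟩ i
    by_cases hi : cl i ∈ G
    · simp only [e, hi, if_true]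
      rw [abs_mul, abs_of_nonneg (hw i)]
      refine mul_le_mul_of_nonneg_left ((abs_pointCost_sub_le _ _ _).trans ?_) (hw i)
      linarith [hΔ _ hi]
    · simp [e, hi]
  have hnet' : ∀ h, 1 ≤ h → h ≤ 3 * N + 3 → ∃ 𝒩 : Finset (Fin m → ℝ),
      (𝒩.card : ℝ) ≤ Real.exp (C * k * U * L * (4 * N + 13) * 4 ^ h) ∧
      ∀ z ∈ F, ∃ g ∈ 𝒩, ∀ i, |g i - z i| ≤ (1 / 2) ^ h * e i := by
    intro h h1 h2
    obtain ⟨𝒩, h𝒩, hg⟩ := hnet h h1 h2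
    refine ⟨𝒩.image fun g i => if cl i ∈ G then w i * g i else 0,
      (Nat.cast_le.2 Finset.card_image_le).trans h𝒩, ?_⟩
    rintro z ⟨S, hS, rfl⟩
    obtain ⟨g, hg𝒩, hgi⟩ := hg S hS
    refine ⟨_, Finset.mem_image_of_mem _ hg𝒩, fun i => ?_⟩
    by_cases hi : cl i ∈ G
    · simp only [e, hi, if_true]
      rw [← mul_sub, abs_mul, abs_of_nonneg (hw i), mul_left_comm]
      exact mul_le_mul_of_nonneg_left (hgi i hi) (hw i)
    · simp [e, hi]
  have hN1 : (0 : ℝ) < N + 1 := by positivity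
  have hH : (((3 * N + 3 : ℕ)) : ℝ) = 3 * (N + 1) := by push_cast; ring
  -- Half of the allowed error is spread evenly over the `3 N + 3` links; the other half is left for
  -- the residual at the finest level.
  have ht : 0 ≤ ε / (N + 1) ^ 2 * X / (2 * (3 * (N + 1))) := by positivity
  have htB : 72 * (C * k * U * L * (4 * N + 13)) * (16 * b * Ψ / m)
      ≤ (ε / (N + 1) ^ 2 * X / (2 * (3 * (N + 1)))) ^ 2 := by
    have e1 : (ε / (N + 1) ^ 2 * X / (2 * (3 * ((N : ℝ) + 1)))) ^ 2
        = ε ^ 2 * m * X ^ 2 / (36 * (N + 1) ^ 6 * m) := by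
      field_simp
      norm_num
    rw [e1, le_div_iff₀ (by positivity)]
    refine le_trans ?_ hmC
    have e2 : (4 * (N : ℝ) + 13) ≤ 13 * (N + 1) := by
      have : (0 : ℝ) ≤ N := Nat.cast_nonneg N
      linarith
    have e3 : 72 * (C * k * U * L * (4 * N + 13)) * (16 * b * Ψ / m) * (36 * (N + 1) ^ 6 * m)
        = 41472 * (C * (N + 1) ^ 6 * L * (k * U * (b * Ψ))) * (4 * N + 13) := by
      field_simp
      ring
    rw [e3]
    calc _ ≤ 41472 * (C * (N + 1) ^ 6 * L * (k * U * (b * Ψ))) * (13 * (N + 1)) := by gcongr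
      _ = _ := by ring
  refine le_trans (mass_mono (prodWeight_nonneg coin_nonneg) ?_)
    ((mass_chaining_le F e (3 * N + 3) hV heV hB hF hnet' ht htB).trans ?_)
  · rintro σ ⟨S, hS, hlt⟩
    refine ⟨_, ⟨S, hS, rfl⟩, lt_of_le_of_lt ?_ hlt⟩
    have h1 : (1 / 2 : ℝ) ^ (3 * N + 3) * ∑ i, e i ≤ ε / (N + 1) ^ 2 * X / 2 := by
      have h2 : ∑ i, e i ≤ 4 * X := hwΨ.trans (by linarith)
      -- Of the three factors `2⁻ᴺ`, one is at most `ε` and the other two pay for `(N + 1)²`.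
      have h3 : (1 / 2 : ℝ) ^ (3 * N + 3) ≤ ε / (N + 1) ^ 2 / 8 := by
        have h4 := add_one_le_two_pow N
        have h5 : ((N : ℝ) + 1) ^ 2 ≤ (2 ^ N) ^ 2 := by gcongr
        rw [one_div, inv_pow, ← one_div, div_div, div_le_div_iff₀ (by positivity) (by positivity)]
        rw [pow_add, mul_comm 3 N, pow_mul]
        have h6 : ((2 : ℝ) ^ N) ^ 2 ≤ ((2 : ℝ) ^ N) ^ 2 * (ε * 2 ^ N) :=
          le_mul_of_one_le_right (by positivity) hεN
        nlinarith
      calc (1 / 2 : ℝ) ^ (3 * N + 3) * ∑ i, e i ≤ ε / (N + 1) ^ 2 / 8 * (4 * X) := by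
            gcongr
            exact Finset.sum_nonneg fun i _ => he i
        _ = _ := by ring
    have h2 : (((3 * N + 3 : ℕ)) : ℝ) * (ε / (N + 1) ^ 2 * X / (2 * (3 * (N + 1))))
        = ε / (N + 1) ^ 2 * X / 2 := by
      rw [hH]
      field_simp
    linarith
  · refine mul_le_mul_of_nonneg_left (Real.exp_le_exp.2 (neg_le_neg ?_)) (by positivity)
    have : (1 : ℝ) ≤ C * U * L :=
      one_le_mul_of_one_le_of_one_le (one_le_mul_of_one_le_of_one_le hC hU) hL
    have h2 : 0 ≤ (k : ℝ) * (4 * N + 13) := by positivity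
    nlinarith

/-- The error of the sample on the clusters in `G`, for all centers with
`cost(a_j, S) ∈ [T Δ_j, 2 T Δ_j]` for `j ∈ G`, where `T = 2 ^ t`. -/
theorem mass_class_le (q : Fin m → Pt d) (a : Fin k → Pt d)
    (cl : Fin m → Fin k) (Δ : Fin k → ℝ) (w : Fin m → ℝ) (hw : ∀ i, 0 ≤ w i)
    (G : Finset (Fin k)) {Φ Ψ b ε : ℝ} {N t : ℕ} (htN : t ≤ N)
    (hΔ : ∀ j ∈ G, 0 < Δ j) (hb : 0 < b) (hΨ : 0 < Ψ) (hΨΦ : Ψ ≤ Φ) (hbΦ : b ≤ Φ) (hm : 1 ≤ m)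
    (hk : 1 ≤ k) (hε : 0 < ε) (hεN : 1 ≤ ε * 2 ^ N) (hG : G.Nonempty)
    (hGb : G.card * b ≤ 2 * k * Ψ)
    (hwb : ∀ i, cl i ∈ G → w i * (dist (q i) (a (cl i)) + Δ (cl i)) ≤ 4 / m * b)
    (hwΨ : ∑ i, (if cl i ∈ G then w i * (dist (q i) (a (cl i)) + Δ (cl i)) else 0) ≤ 4 * Ψ)
    (hmC : 539136 * 1101609 * (N + 1) ^ 7 * Real.log (2 * (m + k : ℕ) + 1) * (k * 2 ^ t)
        ≤ ε ^ 2 * m ∨ (1 ≤ t ∧ 539136 * 1101609 * (N + 1) ^ 7 *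
          Real.log (2 * (m + k : ℕ) + 1) * (2 * k ^ 2 / (2 ^ t) ^ 2) ≤ ε ^ 2 * m)) :
    mass (prodWeight coin m) {σ | ∃ S : Fin k → Pt d,
        (∀ j ∈ G, pointCost S (a j) ≤ 2 * 2 ^ t * Δ j ∧
          (1 ≤ t → 2 ^ t * Δ j ≤ pointCost S (a j))) ∧
        ε / (N + 1) ^ 2 * max Φ (2 ^ t * Ψ) < |∑ i, sgn (σ i) *
        (if cl i ∈ G then w i * (pointCost S (q i) - pointCost S (a (cl i))) else 0)|}
      ≤ 2 * (3 * N + 3 : ℕ) * Real.exp (-(8 * (k * (4 * N + 13)))) := by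
  set L := Real.log (2 * (m + k : ℕ) + 1) with hLd
  have hL : 1 ≤ L := one_le_log_two_mul_add_one (by lia)
  set T : ℝ := 2 ^ t with hT
  have hT1 : 1 ≤ T := one_le_pow₀ one_le_two
  set X := max Φ (T * Ψ) with hX
  have hXΦ : Φ ≤ X := le_max_left _ _
  have hXT : T * Ψ ≤ X := le_max_right _ _
  have hX0 : 0 < X := hΨ.trans_le (hΨΦ.trans hXΦ)
  have hN0 : (0 : ℝ) ≤ N := Nat.cast_nonneg N
  have hk0 : (0 : ℝ) ≤ k := Nat.cast_nonneg k
  have hα : ∀ h : ℕ, (1 : ℝ) / ((1 / 2) ^ h) ^ 2 = 4 ^ h := by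
    intro h
    rw [← pow_mul, mul_comm, pow_mul, one_div, ← inv_pow]
    norm_num
  rcases hmC with hmC | ⟨ht, hmC⟩
  · refine mass_class_le_of_net (U := T ^ 2) (C := 1101609) (L := L) q a cl Δ w hw G
      {S | ∀ j ∈ G, pointCost S (a j) ≤ 2 * T * Δ j ∧ (1 ≤ t → T * Δ j ≤ pointCost S (a j))}
      hΔ hb hΨ hΨΦ hm hk (by norm_num) hL (one_le_pow₀ hT1) hε hεN hwb hwΨ ?_ ?_
    · intro h _ _
      obtain ⟨𝒩, h𝒩, hg⟩ := exists_costDiff_net_near hk q a cl Δ G hΔ hT1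
        (α := (1 / 2) ^ h) (by positivity) (pow_le_one₀ (by norm_num) (by norm_num))
      refine ⟨𝒩, h𝒩.trans (Real.exp_le_exp.2 ?_), fun S hS => hg S fun j hj => (hS j hj).1⟩
      have e1 : 176000 * k * T ^ 2 / ((1 / 2) ^ h) ^ 2 * L = 176000 * (k * T ^ 2 * L * 4 ^ h) := by
        rw [← hα h]; ring
      rw [e1]
      have e2 : 0 ≤ k * T ^ 2 * L * 4 ^ h := by positivity
      have e3 : 1101609 * k * T ^ 2 * L * (4 * N + 13) * 4 ^ h
        = (k * T ^ 2 * L * 4 ^ h) * (1101609 * (4 * N + 13)) := by ring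
      rw [e3]
      nlinarith
    -- One factor of the entropy `k T²` is absorbed by `T Ψ ≤ X`, so only `k T` remains.
    · have e1 : b * (T * Ψ) ≤ X * X := by gcongr; exact hbΦ.trans hXΦ
      calc 539136 * 1101609 * ((N : ℝ) + 1) ^ 7 * L * (k * T ^ 2 * (b * Ψ))
          = 539136 * 1101609 * ((N : ℝ) + 1) ^ 7 * L * (k * T) * (b * (T * Ψ)) := by ring
        _ ≤ ε ^ 2 * m * (X * X) := by gcongr
        _ = _ := by ring
  · have hn : (1 : ℝ) ≤ G.card := by exact_mod_cast hG.card_pos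
    refine mass_class_le_of_net (U := G.card) (C := 1101609) (L := L) q a cl Δ w hw G
      {S | ∀ j ∈ G, pointCost S (a j) ≤ 2 * T * Δ j ∧ (1 ≤ t → T * Δ j ≤ pointCost S (a j))}
      hΔ hb hΨ hΨΦ hm hk (by norm_num) hL hn hε hεN hwb hwΨ ?_ ?_
    · intro h _ hh
      obtain ⟨𝒩, h𝒩, hg⟩ := exists_costDiff_net_far hk q a cl Δ G hΔ hT1
        (α := (1 / 2) ^ h) (by positivity) (pow_le_one₀ (by norm_num) (by norm_num))
      refine ⟨𝒩, h𝒩.trans (Real.exp_le_exp.2 ?_), fun S hS => hg S (fun j hj => (hS j hj).1)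
        fun j hj => (hS j hj).2 ht⟩
      have e1 : 1101608 / ((1 / 2 : ℝ) ^ h) ^ 2 * L = 1101608 * (4 ^ h * L) := by
        rw [← hα h]; ring
      rw [e1]
      -- Since `T ≤ 2ᴺ` and `h ≤ 3 N + 3`, rounding one cluster distance costs `O(N)`; this is why
      -- the entropy carries the factor `4 N + 13`.
      have e2 : Real.log (44 * T / (1 / 2) ^ h) ≤ 4 * N + 13 := by
        have h1 : 44 * T / (1 / 2) ^ h ≤ 2 ^ (4 * N + 9) := by
          rw [div_le_iff₀ (by positivity), one_div, inv_pow, ← div_eq_mul_inv,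
            le_div_iff₀ (by positivity)]
          calc 44 * T * 2 ^ h ≤ 2 ^ 6 * 2 ^ N * 2 ^ (3 * N + 3) := by
                rw [hT]
                gcongr <;> norm_num
            _ = _ := by rw [← pow_add, ← pow_add]; congr 1; ring
        have h2 : Real.log (44 * T / (1 / 2) ^ h) ≤ Real.log (2 ^ (4 * N + 9)) :=
          Real.log_le_log (by positivity) h1
        rw [Real.log_pow] at h2
        have h3 : Real.log 2 ≤ 1 := by linarith [Real.log_two_lt_d9]
        push_cast at h2
        nlinarith
      have e3 : (1 : ℝ) ≤ 4 ^ h := one_le_pow₀ (by norm_num)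
      have e4 : G.card * Real.log (44 * T / (1 / 2) ^ h) ≤ G.card * (L * 4 ^ h) * (4 * N + 13) := by
        have : (1 : ℝ) ≤ L * 4 ^ h := one_le_mul_of_one_le_of_one_le hL e3
        calc _ ≤ (G.card : ℝ) * (4 * N + 13) := by gcongr
          _ ≤ G.card * (L * 4 ^ h) * (4 * N + 13) := by
            gcongr
            exact le_mul_of_one_le_right (by positivity) this
      have e5 : 1101608 * (4 ^ h * L) ≤ 1101608 * (G.card * (L * 4 ^ h) * (4 * N + 13)) := by
        have a1 : 0 ≤ L * 4 ^ h := by positivity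
        have a2 : L * 4 ^ h ≤ G.card * (L * 4 ^ h) := le_mul_of_one_le_left a1 hn
        have a3 : G.card * (L * 4 ^ h) ≤ G.card * (L * 4 ^ h) * (4 * N + 13) :=
          le_mul_of_one_le_right (by positivity) (by linarith)
        linarith
      calc _ ≤ (k : ℝ) * (1101608 * (G.card * (L * 4 ^ h) * (4 * N + 13))
              + G.card * (L * 4 ^ h) * (4 * N + 13)) := by gcongr
        _ = _ := by ring
    -- The bound `G.card * b ≤ 2 k Ψ` removes `G.card`, and `Ψ² = (T Ψ)² / T²`.
    · calc 539136 * 1101609 * ((N : ℝ) + 1) ^ 7 * L * (k * G.card * (b * Ψ))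
          = 539136 * 1101609 * ((N : ℝ) + 1) ^ 7 * L * (k * (G.card * b) * Ψ) := by ring
        _ ≤ 539136 * 1101609 * ((N : ℝ) + 1) ^ 7 * L * (k * (2 * k * Ψ) * Ψ) := by gcongr
        _ = 539136 * 1101609 * ((N : ℝ) + 1) ^ 7 * L * (2 * k ^ 2 / T ^ 2) * (T * Ψ) ^ 2 := by
          field_simp
        _ ≤ ε ^ 2 * m * X ^ 2 := by gcongr

end ClassBound
-- Signed sums over all classes of clusters
section Core

variable {d k m : ℕ}

theorem lt_two_pow_log_floor (x : ℝ) : x < 2 ^ (Nat.log 2 ⌊x⌋₊ + 1) := by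
  have := Nat.lt_of_floor_lt (Nat.lt_pow_succ_log_self one_lt_two ⌊x⌋₊)
  exact_mod_cast this

/-- For `x < 1` the floor is `0` and `Nat.log 2 0 = 0`, so the left side is `1` and the bound fails;
the hypothesis excludes this case. -/
theorem two_pow_log_floor_le {x : ℝ} (h : 1 ≤ x ∨ 1 ≤ Nat.log 2 ⌊x⌋₊) :
    2 ^ Nat.log 2 ⌊x⌋₊ ≤ x := by
  have h0 : ⌊x⌋₊ ≠ 0 := by
    rcases h with h | h
    · exact (Nat.floor_pos.2 h).ne'
    · intro h0
      simp [h0] at h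
  have hx : 0 ≤ x := by
    by_contra hx
    exact h0 (Nat.floor_of_nonpos (not_le.1 hx).le)
  calc (2 : ℝ) ^ Nat.log 2 ⌊x⌋₊ ≤ (⌊x⌋₊ : ℝ) := by exact_mod_cast Nat.pow_log_le_self 2 h0
    _ ≤ x := Nat.floor_le hx

/-- Which clusters form a class depends on `S`, so the union bound runs over all `2 ^ k` subsets.
The failure probability, exponentially small in `k (4 N + 13)`, pays for them. -/
theorem class_count_mul_exp_le (N : ℕ) (hk : 1 ≤ k) :
    (((N + 1) * (N + 1) * 2 ^ k : ℕ) : ℝ) *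
      (2 * (3 * N + 3 : ℕ) * Real.exp (-(8 * (k * (4 * N + 13))))) ≤ 1 / 100 := by
  have hk1 : (1 : ℝ) ≤ k := by exact_mod_cast hk
  have hN0 : (0 : ℝ) ≤ N := Nat.cast_nonneg N
  have h1 : ((N : ℝ) + 1) ≤ Real.exp N := Real.add_one_le_exp _
  have h2 : (2 : ℝ) ^ k ≤ Real.exp k := by
    rw [← mul_one (k : ℝ), Real.exp_nat_mul]
    have := Real.add_one_le_exp (1 : ℝ)
    gcongr
    linarith
  have h3 : (600 : ℝ) ≤ Real.exp 103 := by
    have h := Real.add_one_le_exp (50 : ℝ)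
    have h' : Real.exp 103 = Real.exp 50 * Real.exp 50 * Real.exp 3 := by
      rw [← Real.exp_add, ← Real.exp_add]; norm_num
    have h'' := Real.one_le_exp (x := 3) (by norm_num)
    rw [h']
    nlinarith
  have h4 : Real.exp (-(8 * (k * (4 * N + 13)))) ≤ Real.exp (-(3 * N + k + 103)) := by
    refine Real.exp_le_exp.2 ?_
    nlinarith
  calc (((N + 1) * (N + 1) * 2 ^ k : ℕ) : ℝ) *
      (2 * (3 * N + 3 : ℕ) * Real.exp (-(8 * (k * (4 * N + 13)))))
      = 6 * (((N : ℝ) + 1) ^ 3 * 2 ^ k * Real.exp (-(8 * (k * (4 * N + 13))))) := by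
        push_cast; ring
    _ ≤ 6 * (Real.exp N ^ 3 * Real.exp k * Real.exp (-(3 * N + k + 103))) := by gcongr
    _ = 6 * (Real.exp 103)⁻¹ := by
        rw [← Real.exp_nat_mul, ← Real.exp_add, ← Real.exp_add, ← Real.exp_neg]
        congr 2
        push_cast
        ring
    _ ≤ 1 / 100 := by
        rw [← div_eq_mul_inv, div_le_div_iff₀ (Real.exp_pos _) (by norm_num)]
        linarith

/-- For fixed sample points, the signed sums of the cost differences are small for all centers
simultaneously. -/
theorem mass_core_le (q : Fin m → Pt d) (a : Fin k → Pt d)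
    (cl : Fin m → Fin k) (Δ n φ : Fin k → ℝ) (w : Fin m → ℝ) (hw : ∀ i, 0 ≤ w i)
    {ε : ℝ} {N : ℕ} (hΔ : ∀ j, 0 ≤ Δ j) (hn : ∀ j, 0 ≤ n j) (hφ : ∀ j, φ j = n j * Δ j)
    (hm : 1 ≤ m) (hk : 1 ≤ k) (hε : 0 < ε) (hεN : 1 ≤ ε * 2 ^ N)
    (hwb : ∀ i, w i * (dist (q i) (a (cl i)) + Δ (cl i)) ≤ 4 / m * min (∑ j, φ j) (k * φ (cl i)))
    (hwφ : ∀ j, ∑ i, (if cl i = j then w i * (dist (q i) (a (cl i)) + Δ (cl i)) else 0) ≤ 4 * φ j)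
    (hmC : ∀ t ≤ N, 539136 * 1101609 * (N + 1) ^ 7 * Real.log (2 * (m + k : ℕ) + 1) * (k * 2 ^ t)
        ≤ ε ^ 2 * m ∨ (1 ≤ t ∧ 539136 * 1101609 * (N + 1) ^ 7 *
          Real.log (2 * (m + k : ℕ) + 1) * (2 * k ^ 2 / (2 ^ t) ^ 2) ≤ ε ^ 2 * m)) :
    mass (prodWeight coin m) {σ | ∃ S : Fin k → Pt d,
        5 * ε * (∑ j, φ j + ∑ j, n j * pointCost S (a j)) < |∑ i, sgn (σ i) *
        (w i * (pointCost S (q i) - pointCost S (a (cl i))))|} ≤ 1 / 100 := by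
  classical
  set Φ := ∑ j, φ j with hΦ
  have hφ0 : ∀ j, 0 ≤ φ j := fun j => by rw [hφ]; exact mul_nonneg (hn j) (hΔ j)
  have hΔpos : ∀ j, 0 < φ j → 0 < Δ j := by
    intro j hj
    refine (hΔ j).lt_of_ne fun h => ?_
    rw [hφ, ← h, mul_zero] at hj
    exact lt_irrefl _ hj
  have hk1 : (1 : ℝ) ≤ k := by exact_mod_cast hk
  have hΦφ : ∀ j, φ j ≤ Φ := fun j => Finset.single_le_sum (fun i _ => hφ0 i) (Finset.mem_univ j)
  -- For `φ j > 0`, `Φ / 2 ^ lc j` is the common scale `b`: it lies between `min Φ (k φ j)` and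
  -- twice that value.
  let lc : Fin k → ℕ := fun j => Nat.log 2 ⌊Φ / min Φ (k * φ j)⌋₊
  have hmin : ∀ j, 0 < φ j → 0 < min Φ (k * φ j) := fun j hj =>
    lt_min (hj.trans_le (hΦφ j)) (mul_pos (by linarith) hj)
  have hlc1 : ∀ j, 0 < φ j → min Φ (k * φ j) ≤ Φ / 2 ^ lc j := by
    intro j hj
    have h1 := hmin j hj
    have h2 : 1 ≤ Φ / min Φ (k * φ j) := by
      rw [le_div_iff₀ h1, one_mul]; exact min_le_left _ _
    have h3 := two_pow_log_floor_le (Or.inl h2)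
    rw [le_div_iff₀ h1] at h3
    rw [le_div_iff₀ (by positivity), mul_comm]
    exact h3
  have hlc2 : ∀ j, 0 < φ j → Φ / 2 ^ lc j ≤ 2 * (k * φ j) := by
    intro j hj
    have h1 := hmin j hj
    have h3 := (lt_two_pow_log_floor (Φ / min Φ (k * φ j))).le
    rw [div_le_iff₀ h1, pow_succ] at h3
    rw [div_le_iff₀ (by positivity)]
    have h4 : min Φ (k * φ j) ≤ k * φ j := min_le_right _ _
    calc Φ ≤ 2 ^ lc j * 2 * min Φ (k * φ j) := h3
      _ ≤ 2 ^ lc j * 2 * (k * φ j) := by gcongr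
      _ = _ := by ring
  let adm : Finset ((ℕ × ℕ) × Finset (Fin k)) :=
    ((Finset.range (N + 1) ×ˢ Finset.range (N + 1)) ×ˢ Finset.univ).filter fun x =>
      x.2.Nonempty ∧ ∀ j ∈ x.2, 0 < φ j ∧ lc j = x.1.2
  let bad : (ℕ × ℕ) × Finset (Fin k) → Set (Fin m → Bool) := fun x =>
    {σ | ∃ S : Fin k → Pt d, (∀ j ∈ x.2, pointCost S (a j) ≤ 2 * 2 ^ x.1.1 * Δ j ∧
          (1 ≤ x.1.1 → 2 ^ x.1.1 * Δ j ≤ pointCost S (a j))) ∧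
        ε / (N + 1) ^ 2 * max Φ (2 ^ x.1.1 * ∑ j ∈ x.2, φ j) < |∑ i, sgn (σ i) *
        (if cl i ∈ x.2 then w i * (pointCost S (q i) - pointCost S (a (cl i))) else 0)|}
  have hnn : ∀ σ, 0 ≤ prodWeight coin m σ := prodWeight_nonneg coin_nonneg
  have hbad : ∀ x ∈ adm, mass (prodWeight coin m) (bad x)
      ≤ 2 * (3 * N + 3 : ℕ) * Real.exp (-(8 * (k * (4 * N + 13)))) := by
    rintro ⟨⟨t, l⟩, G⟩ hx
    obtain ⟨hx1, hGne, hGl⟩ := Finset.mem_filter.1 hx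
    simp only [Finset.mem_product, Finset.mem_range, Finset.mem_univ, and_true] at hx1
    simp only at hGl hGne
    obtain ⟨j0, hj0⟩ := hGne
    have hΦ0 : 0 < Φ := (hGl j0 hj0).1.trans_le (hΦφ j0)
    refine mass_class_le q a cl Δ w hw G (Φ := Φ) (Ψ := ∑ j ∈ G, φ j) (b := Φ / 2 ^ l)
      (Nat.lt_succ_iff.1 hx1.1) (fun j hj => hΔpos j (hGl j hj).1) (by positivity)
      (Finset.sum_pos (fun j hj => (hGl j hj).1) ⟨j0, hj0⟩)
      (Finset.sum_le_univ_sum_of_nonneg hφ0) (div_le_self hΦ0.le (one_le_pow₀ one_le_two))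
      hm hk hε hεN ⟨j0, hj0⟩ ?_ ?_ ?_ (hmC t (Nat.lt_succ_iff.1 hx1.1))
    · rw [Finset.mul_sum, ← nsmul_eq_mul]
      refine Finset.card_nsmul_le_sum _ _ _ fun j hj => ?_
      have := hlc2 j (hGl j hj).1
      rw [(hGl j hj).2] at this
      linarith
    · intro i hi
      refine (hwb i).trans ?_
      have := hlc1 _ (hGl _ hi).1
      rw [(hGl _ hi).2] at this
      gcongr
    · rw [Finset.mul_sum]
      refine le_trans (le_of_eq ?_) (Finset.sum_le_sum fun j (_ : j ∈ G) => hwφ j)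
      rw [Finset.sum_comm]
      refine Finset.sum_congr rfl fun i _ => ?_
      rw [Finset.sum_ite_eq]
  refine le_trans (mass_mono hnn (B := ⋃ x ∈ adm, bad x) ?_)
    ((mass_biUnion_le_card_mul hnn adm bad hbad).trans ?_)
  swap
  · refine le_trans (mul_le_mul_of_nonneg_right ?_ (by positivity)) (class_count_mul_exp_le N hk)
    refine Nat.cast_le.2 ((Finset.card_filter_le _ _).trans (le_of_eq ?_))
    simp [Finset.card_product]
  rintro σ ⟨S, hS⟩
  by_contra hcon
  simp only [Set.mem_iUnion, not_exists] at hcon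
  refine absurd hS (not_lt.2 ?_)
  set D : Fin k → ℝ := fun j => pointCost S (a j) with hD
  have hD0 : ∀ j, 0 ≤ D j := fun j => pointCost_nonneg S _
  have hnD : ∀ j, 0 ≤ n j * D j := fun j => mul_nonneg (hn j) (hD0 j)
  set W := Φ + ∑ j, n j * D j with hW
  have hΦ0 : 0 ≤ Φ := Finset.sum_nonneg fun j _ => hφ0 j
  have hnD0 : 0 ≤ ∑ j, n j * D j := Finset.sum_nonneg fun j _ => hnD j
  -- Class `0` contains all ratios below `2`, including those near `0`; a lower bound on `D j` is
  -- available only for `tc j ≥ 1`.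
  let tc : Fin k → ℕ := fun j => Nat.log 2 ⌊D j / Δ j⌋₊
  have htc1 : ∀ j, 0 < φ j → D j ≤ 2 * 2 ^ tc j * Δ j := by
    intro j hj
    have h3 := (lt_two_pow_log_floor (D j / Δ j)).le
    rw [div_le_iff₀ (hΔpos j hj), pow_succ] at h3
    linarith
  have htc2 : ∀ j, 0 < φ j → 1 ≤ tc j → 2 ^ tc j * Δ j ≤ D j := by
    intro j hj h
    have h3 := two_pow_log_floor_le (x := D j / Δ j) (Or.inr h)
    rwa [le_div_iff₀ (hΔpos j hj)] at h3
  let G : ℕ × ℕ → Finset (Fin k) := fun x =>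
    Finset.univ.filter fun j => 0 < φ j ∧ tc j = x.1 ∧ lc j = x.2
  let R := Finset.range (N + 1) ×ˢ Finset.range (N + 1)
  let y : Fin m → ℝ := fun i => w i * (pointCost S (q i) - pointCost S (a (cl i)))
  let good : Fin k → Prop := fun j => 0 < φ j ∧ tc j < N + 1 ∧ lc j < N + 1
  have hsplit : ∀ i, y i = ∑ x ∈ R, (if cl i ∈ G x then y i else 0)
      + (if good (cl i) then 0 else y i) := by
    intro i
    by_cases hg : good (cl i)
    · rw [if_pos hg, add_zero, Finset.sum_eq_single (tc (cl i), lc (cl i))]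
      · simp [G, hg.1]
      · intro x _ hx
        rw [if_neg]
        intro hmem
        obtain ⟨_, h1, h2⟩ := (Finset.mem_filter.1 hmem).2
        exact hx (Prod.ext h1.symm h2.symm)
      · intro h
        exact absurd (Finset.mk_mem_product (Finset.mem_range.2 hg.2.1)
          (Finset.mem_range.2 hg.2.2)) h
    · rw [if_neg hg, Finset.sum_eq_zero, zero_add]
      intro x hx
      rw [if_neg]
      intro hmem
      obtain ⟨h0, h1, h2⟩ := (Finset.mem_filter.1 hmem).2
      have hx' := Finset.mem_product.1 hx
      refine hg ⟨h0, ?_, ?_⟩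
      · rw [h1]; exact Finset.mem_range.1 hx'.1
      · rw [h2]; exact Finset.mem_range.1 hx'.2
  have hmain : ∑ i, sgn (σ i) * y i
      = ∑ x ∈ R, ∑ i, sgn (σ i) * (if cl i ∈ G x then y i else 0)
        + ∑ i, sgn (σ i) * (if good (cl i) then 0 else y i) := by
    rw [Finset.sum_comm, ← Finset.sum_add_distrib]
    refine Finset.sum_congr rfl fun i _ => ?_
    rw [← Finset.mul_sum, ← mul_add, ← hsplit i]
  have hN1 : (0 : ℝ) < N + 1 := by positivity
  have hclass : ∀ x ∈ R, |∑ i, sgn (σ i) * (if cl i ∈ G x then y i else 0)|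
      ≤ ε / (N + 1) ^ 2 * W := by
    intro x hx
    have hW0 : 0 ≤ W := add_nonneg hΦ0 hnD0
    have hmem : ∀ j ∈ G x, 0 < φ j ∧ tc j = x.1 ∧ lc j = x.2 := fun j hj =>
      (Finset.mem_filter.1 hj).2
    rcases (G x).eq_empty_or_nonempty with he | hne
    · simp only [he, Finset.notMem_empty, if_false, mul_zero, Finset.sum_const_zero, abs_zero]
      positivity
    · have hadm : (x, G x) ∈ adm := Finset.mem_filter.2
        ⟨Finset.mk_mem_product hx (Finset.mem_univ _), hne,
          fun j hj => ⟨(hmem j hj).1, (hmem j hj).2.2⟩⟩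
      have h1 : |∑ i, sgn (σ i) * (if cl i ∈ G x then y i else 0)|
          ≤ ε / (N + 1) ^ 2 * max Φ (2 ^ x.1 * ∑ j ∈ G x, φ j) := by
        by_contra hc
        refine hcon (x, G x) hadm ⟨S, fun j hj => ?_, not_le.1 hc⟩
        obtain ⟨h0, h1, -⟩ := hmem j hj
        exact ⟨h1 ▸ htc1 j h0, fun h => h1 ▸ htc2 j h0 (h1 ▸ h)⟩
      refine h1.trans (mul_le_mul_of_nonneg_left (max_le (by linarith) ?_) (by positivity))
      rcases Nat.eq_zero_or_pos x.1 with hx0 | hx0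
      · rw [hx0, pow_zero, one_mul]
        have : ∑ j ∈ G x, φ j ≤ Φ := Finset.sum_le_univ_sum_of_nonneg hφ0
        linarith
      · rw [Finset.mul_sum]
        have : ∑ j ∈ G x, 2 ^ x.1 * φ j ≤ ∑ j ∈ G x, n j * D j := by
          refine Finset.sum_le_sum fun j hj => ?_
          obtain ⟨h0, h1, -⟩ := hmem j hj
          have h2 := htc2 j h0 (by lia)
          rw [h1] at h2
          rw [hφ]
          nlinarith [mul_le_mul_of_nonneg_left h2 (hn j)]
        have h3 : ∑ j ∈ G x, n j * D j ≤ ∑ j, n j * D j :=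
          Finset.sum_le_univ_sum_of_nonneg hnD
        linarith
  have hyφ : ∀ i, |y i| ≤ w i * (dist (q i) (a (cl i)) + Δ (cl i)) := by
    intro i
    simp only [y]
    rw [abs_mul, abs_of_nonneg (hw i)]
    refine mul_le_mul_of_nonneg_left ((abs_pointCost_sub_le _ _ _).trans ?_) (hw i)
    linarith [hΔ (cl i)]
  have hrest : |∑ i, sgn (σ i) * (if good (cl i) then 0 else y i)| ≤ 4 * ε * W := by
    have h1 := abs_sum_sgn_le σ (fun i => if good (cl i) then 0 else y i)
      (fun i => if good (cl i) then 0 else w i * (dist (q i) (a (cl i)) + Δ (cl i)))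
      (fun i => by by_cases h : good (cl i) <;> simp [h, hyφ])
    refine h1.trans ?_
    have h2 : ∑ i, (if good (cl i) then 0 else w i * (dist (q i) (a (cl i)) + Δ (cl i)))
        ≤ ∑ j, if good j then 0 else 4 * φ j := by
      calc _ = ∑ j, ∑ i, (if cl i = j then
              (if good j then 0 else w i * (dist (q i) (a (cl i)) + Δ (cl i))) else 0) := by
            rw [Finset.sum_comm]
            refine Finset.sum_congr rfl fun i _ => ?_
            rw [Finset.sum_ite_eq, if_pos (Finset.mem_univ _)]
        _ ≤ _ := by
            refine Finset.sum_le_sum fun j _ => ?_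
            by_cases h : good j
            · simp [h]
            · simp only [h, if_false]
              exact hwφ j
    refine h2.trans ?_
    -- A cluster of positive cost in no class either has a large ratio, and `φ j ≤ ε n j D j`, or it
    -- has `k φ j ≤ ε Φ` and is charged to its share `Φ / k`.
    have h3 : ∀ j, (if good j then 0 else 4 * φ j) ≤ 4 * ε * (n j * D j) + 4 * ε * (Φ / k) := by
      intro j
      have h0 : 0 ≤ 4 * ε * (n j * D j) := mul_nonneg (by positivity) (hnD j)
      have h0' : 0 ≤ 4 * ε * (Φ / k) := by positivity
      by_cases h : good j
      · simp only [h, if_true]; linarith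
      · simp only [h, if_false]
        rcases (hφ0 j).eq_or_lt with he | hpos
        · rw [← he]; linarith
        by_cases ht : tc j < N + 1
        · have hl : N + 1 ≤ lc j := by
            by_contra hl
            exact h ⟨hpos, ht, not_le.1 hl⟩
          have a1 := hlc1 j hpos
          have a2 : (2 : ℝ) ^ (N + 1) ≤ 2 ^ lc j := pow_le_pow_right₀ one_le_two hl
          have hΦpos : 0 < Φ := hpos.trans_le (hΦφ j)
          -- Strictness excludes that the minimum is `Φ`.
          have a3 : Φ / 2 ^ lc j < Φ := by
            refine div_lt_self hΦpos (lt_of_lt_of_le ?_ a2)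
            exact one_lt_pow₀ one_lt_two (by lia)
          have a4 : min Φ (k * φ j) = k * φ j := by
            rcases min_choice Φ (k * φ j) with h' | h'
            · rw [h'] at a1; linarith
            · exact h'
          rw [a4, le_div_iff₀ (by positivity)] at a1
          have a5 : φ j ≤ ε * (Φ / k) := by
            rw [mul_div_assoc', le_div_iff₀ (by linarith)]
            rw [pow_succ] at a2
            have a6 : φ j * k ≤ ε * 2 ^ N * (φ j * k) :=
              le_mul_of_one_le_left (by positivity) hεN
            have a7 : (k * φ j) * 2 ^ N ≤ Φ := by
              refine le_trans ?_ a1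
              have : (0 : ℝ) ≤ 2 ^ N := by positivity
              exact mul_le_mul_of_nonneg_left (by linarith) (by positivity)
            nlinarith
          linarith
        · have a1 := htc2 j hpos (by lia)
          have a2 : (2 : ℝ) ^ N ≤ 2 ^ tc j := pow_le_pow_right₀ one_le_two (by lia)
          have a3 : φ j ≤ ε * (n j * D j) := by
            have a4 : 2 ^ N * Δ j ≤ D j := le_trans (by gcongr; exact hΔ j) a1
            have a5 : φ j ≤ ε * 2 ^ N * φ j := le_mul_of_one_le_left hpos.le hεN
            have a6 : 2 ^ N * φ j ≤ n j * D j := by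
              rw [hφ]
              nlinarith [mul_le_mul_of_nonneg_left a4 (hn j)]
            nlinarith
          linarith
    refine (Finset.sum_le_sum fun j _ => h3 j).trans (le_of_eq ?_)
    rw [Finset.sum_add_distrib, ← Finset.mul_sum, Finset.sum_const, Finset.card_univ,
      Fintype.card_fin, nsmul_eq_mul, hW]
    field_simp
    ring
  show |∑ i, sgn (σ i) * y i| ≤ 5 * ε * W
  rw [hmain]
  refine (abs_add_le _ _).trans ?_
  have h5 : |∑ x ∈ R, ∑ i, sgn (σ i) * (if cl i ∈ G x then y i else 0)| ≤ ε * W := by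
    refine (Finset.abs_sum_le_sum_abs _ _).trans ((Finset.sum_le_card_nsmul R _ _ hclass).trans
      (le_of_eq ?_))
    rw [Finset.card_product, Finset.card_range, nsmul_eq_mul]
    push_cast
    field_simp
  linarith

end Core
-- Bernstein's inequality
section Deviation

variable {α : Type*} [Fintype α] {m : ℕ}

/-- Integrate `exp y ≤ 1 + y + y²`, valid for `|y| ≤ 1`, and use `1 + z ≤ exp z`. -/
theorem sum_mul_exp_le {μ : α → ℝ} (hμ : ∀ a, 0 ≤ μ a) (hμ1 : ∑ a, μ a = 1) (x : α → ℝ)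
    {l v : ℝ} (hx : ∀ a, |l * x a| ≤ 1) (hv : ∑ a, μ a * x a ^ 2 ≤ v) :
    ∑ a, μ a * Real.exp (l * x a) ≤ Real.exp (l * ∑ a, μ a * x a + l ^ 2 * v) := by
  have h1 : ∑ a, μ a * Real.exp (l * x a) ≤ ∑ a, μ a * (1 + l * x a + (l * x a) ^ 2) := by
    refine Finset.sum_le_sum fun a _ => mul_le_mul_of_nonneg_left ?_ (hμ a)
    have := (abs_le.1 (Real.abs_exp_sub_one_sub_id_le (hx a))).2
    linarith
  have h2 : ∑ a, μ a * (1 + l * x a + (l * x a) ^ 2)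
      = ∑ a, μ a + l * ∑ a, μ a * x a + l ^ 2 * ∑ a, μ a * x a ^ 2 := by
    rw [Finset.mul_sum, Finset.mul_sum, ← Finset.sum_add_distrib, ← Finset.sum_add_distrib]
    exact Finset.sum_congr rfl fun a _ => by ring
  rw [hμ1] at h2
  have h3 := Real.add_one_le_exp (l * ∑ a, μ a * x a + l ^ 2 * v)
  have h4 := mul_le_mul_of_nonneg_left hv (sq_nonneg l)
  linarith

/-- Bernstein's inequality for independent samples of a bounded function. -/
theorem mass_sample_deviation_le {μ : α → ℝ} (hμ : ∀ a, 0 ≤ μ a) (hμ1 : ∑ a, μ a = 1)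
    (hm : 1 ≤ m) (x : α → ℝ) {κ δ : ℝ} (hκ : 0 < κ) (hx : ∀ a, |x a| ≤ κ / m)
    (hx1 : ∑ a, μ a * |x a| ≤ 1 / m) (hδ : 0 < δ) (hδ1 : δ ≤ 1) :
    mass (prodWeight μ m) {q | δ < |∑ i, x (q i) - m * ∑ a, μ a * x a|}
      ≤ 2 * Real.exp (-(δ ^ 2 * m / (4 * κ))) := by
  have hm0 : (0 : ℝ) < m := by exact_mod_cast hm
  have hv : ∑ a, μ a * x a ^ 2 ≤ κ / m * (1 / m) := by
    calc ∑ a, μ a * x a ^ 2 ≤ ∑ a, κ / m * (μ a * |x a|) := by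
          refine Finset.sum_le_sum fun a _ => ?_
          rw [← sq_abs, sq, mul_left_comm]
          exact mul_le_mul_of_nonneg_right (hx a) (mul_nonneg (hμ a) (abs_nonneg _))
      _ ≤ _ := by
          rw [← Finset.mul_sum]
          exact mul_le_mul_of_nonneg_left hx1 (by positivity)
  -- This `l` minimizes the exponent `l² κ / m - l δ`.
  set l := δ * m / (2 * κ) with hl
  have hl0 : 0 ≤ l := by positivity
  have hlx : ∀ a, |l * x a| ≤ 1 := by
    intro a
    rw [abs_mul, abs_of_nonneg hl0]
    calc l * |x a| ≤ l * (κ / m) := mul_le_mul_of_nonneg_left (hx a) hl0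
      _ = δ / 2 := by rw [hl]; field_simp
      _ ≤ 1 := by linarith
  set E := ∑ a, μ a * x a with hE
  have hneg : ∑ a, μ a * -x a = -E := by
    rw [hE, ← Finset.sum_neg_distrib]
    exact Finset.sum_congr rfl fun a _ => by ring
  have h := mass_lt_abs_sum_le (m := m) (t := δ) (u := m * E) (l := l) hμ (fun _ => x)
    (fun _ => l * E + l ^ 2 * (κ / m * (1 / m))) (fun _ => l * -E + l ^ 2 * (κ / m * (1 / m))) hl0
    (fun _ => sum_mul_exp_le hμ hμ1 x hlx hv) (fun _ => by
      rw [← hneg]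
      exact sum_mul_exp_le hμ hμ1 (fun a => -x a) (by simpa only [mul_neg, abs_neg] using hlx)
        (by simpa only [neg_sq] using hv))
  refine h.trans (le_of_eq ?_)
  simp only [Finset.sum_const, Finset.card_univ, Fintype.card_fin, nsmul_eq_mul]
  have e1 : m * (l * E + l ^ 2 * (κ / m * (1 / m))) - l * (m * E + δ) = -(δ ^ 2 * m / (4 * κ)) := by
    rw [hl]; field_simp; ring
  have e2 : m * (l * -E + l ^ 2 * (κ / m * (1 / m))) - l * (δ - m * E)
      = -(δ ^ 2 * m / (4 * κ)) := by
    rw [hl]; field_simp; ring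
  rw [e1, e2, two_mul]

end Deviation

/-! ### Symmetrization -/

section Symmetrization

variable {α : Type*} [Fintype α] {m : ℕ}

theorem mass_fst_preimage {Ω : Type*} [Fintype Ω] {ω : Ω → ℝ} (hω1 : ∑ x, ω x = 1)
    (A : Set Ω) : mass (fun x : Ω × Ω => ω x.1 * ω x.2) (Prod.fst ⁻¹' A) = mass ω A := by
  rw [mass, mass, Fintype.sum_prod_type]
  refine Finset.sum_congr rfl fun x _ => ?_
  by_cases h : x ∈ A
  · simp [Set.indicator, h, ← Finset.mul_sum, hω1]
  · simp [Set.indicator, h]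

theorem mass_snd_preimage {Ω : Type*} [Fintype Ω] {ω : Ω → ℝ} (hω1 : ∑ x, ω x = 1)
    (A : Set Ω) : mass (fun x : Ω × Ω => ω x.1 * ω x.2) (Prod.snd ⁻¹' A) = mass ω A := by
  rw [mass, mass, Fintype.sum_prod_type_right]
  refine Finset.sum_congr rfl fun x _ => ?_
  by_cases h : x ∈ A
  · simp [Set.indicator, h, ← Finset.sum_mul, hω1]
  · simp [Set.indicator, h]

/-- Exchange of the coordinates `i` with `σ i = false` between two samples. -/
def swapEquiv (σ : Fin m → Bool) : ((Fin m → α) × (Fin m → α)) ≃ ((Fin m → α) × (Fin m → α)) :=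
  Function.Involutive.toPerm
    (fun x => (fun i => if σ i then x.1 i else x.2 i, fun i => if σ i then x.2 i else x.1 i))
    (fun x => by
      refine Prod.ext (funext fun i => ?_) (funext fun i => ?_) <;> cases h : σ i <;> simp [h])

omit [Fintype α] in
theorem swapEquiv_apply (σ : Fin m → Bool) (x : (Fin m → α) × (Fin m → α)) :
    swapEquiv σ x
      = (fun i => if σ i then x.1 i else x.2 i, fun i => if σ i then x.2 i else x.1 i) := rfl

/-- Symmetrization: the deviation of a sample from its mean is controlled by signed sums. -/
theorem mass_symmetrization_le {μ : α → ℝ} (hμ : ∀ a, 0 ≤ μ a) (hμ1 : ∑ a, μ a = 1)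
    {ι : Type*} (f : ι → α → ℝ) (u θ : ι → ℝ) (E : Set (Fin m → α)) {δ : ℝ} (hδ : 0 ≤ δ)
    (hghost : ∀ S, mass (prodWeight μ m) {q | θ S < |∑ i, f S (q i) - u S|} ≤ 1 / 2)
    (hE : ∀ q ∈ E, mass (prodWeight coin m) {σ | ∃ S, θ S / 2 < |∑ i, sgn (σ i) * f S (q i)|} ≤ δ) :
    mass (prodWeight μ m) {q | ∃ S, 2 * θ S < |∑ i, f S (q i) - u S|}
      ≤ 4 * (mass (prodWeight μ m) Eᶜ + δ) := by
  set ω := prodWeight μ m with hω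
  have hω0 : ∀ q, 0 ≤ ω q := prodWeight_nonneg hμ
  have hω1 : ∑ q, ω q = 1 := sum_prodWeight hμ1
  let ω₂ : (Fin m → α) × (Fin m → α) → ℝ := fun x => ω x.1 * ω x.2
  have hω₂ : ∀ x, 0 ≤ ω₂ x := fun x => mul_nonneg (hω0 _) (hω0 _)
  let pairs : (Fin m → Bool) → Set ((Fin m → α) × (Fin m → α)) := fun σ =>
    {x | ∃ S, θ S < |∑ i, sgn (σ i) * (f S (x.1 i) - f S (x.2 i))|}
  set bad := {q : Fin m → α | ∃ S, 2 * θ S < |∑ i, f S (q i) - u S|} with hbad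
  let sbad : (Fin m → Bool) → Set (Fin m → α) := fun σ =>
    {q | ∃ S, θ S / 2 < |∑ i, sgn (σ i) * f S (q i)|}
  -- If `S` is bad for `q`, an independent ghost sample is within `θ S` of `u S` with probability at
  -- least `1 / 2`, and then the two sums differ by more than `θ S`.
  have hA : mass ω bad ≤ 2 * mass ω₂ (pairs fun _ => true) := by
    rw [mass, mass, Fintype.sum_prod_type, Finset.mul_sum]
    refine Finset.sum_le_sum fun q _ => ?_
    by_cases hq : q ∈ bad
    · rw [Set.indicator_of_mem hq]
      obtain ⟨S, hS⟩ := hq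
      have h1 : (1 : ℝ) / 2 ≤ mass ω {q | θ S < |∑ i, f S (q i) - u S|}ᶜ := by
        rw [mass_compl, hω1]
        linarith [hghost S]
      have h2 : ω q * mass ω {q | θ S < |∑ i, f S (q i) - u S|}ᶜ
          ≤ ∑ q', (pairs fun _ => true).indicator ω₂ (q, q') := by
        rw [mass, Finset.mul_sum]
        refine Finset.sum_le_sum fun q' _ => ?_
        by_cases hq' : θ S < |∑ i, f S (q' i) - u S|
        · rw [Set.indicator_of_notMem (by simpa using hq'), mul_zero]
          exact Set.indicator_nonneg (fun x _ => hω₂ x) _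
        · rw [Set.indicator_of_mem (by simpa using hq'), Set.indicator_of_mem]
          refine ⟨S, ?_⟩
          simp only [sgn, if_true, one_mul, Finset.sum_sub_distrib]
          have h3 : ∑ i, f S (q i) - u S = (∑ i, f S (q i) - ∑ i, f S (q' i))
              + (∑ i, f S (q' i) - u S) := by ring
          rw [h3] at hS
          have h4 := abs_add_le (∑ i, f S (q i) - ∑ i, f S (q' i)) (∑ i, f S (q' i) - u S)
          linarith
      nlinarith [hω0 q]
    · rw [Set.indicator_of_notMem hq]
      exact mul_nonneg zero_le_two
        (Finset.sum_nonneg fun q' _ => Set.indicator_nonneg (fun x _ => hω₂ x) _)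
  -- Exchanging a coordinate of the two samples preserves the product weight and flips the sign of
  -- its difference, so arbitrary signs can be inserted.
  have hB : ∀ σ, mass ω₂ (pairs fun _ => true) = mass ω₂ (pairs σ) := by
    intro σ
    rw [mass, mass, ← Equiv.sum_comp (swapEquiv σ)]
    refine Finset.sum_congr rfl fun x _ => ?_
    have hw : ω₂ (swapEquiv σ x) = ω₂ x := by
      simp only [ω₂, hω, prodWeight]
      rw [← Finset.prod_mul_distrib, ← Finset.prod_mul_distrib]
      refine Finset.prod_congr rfl fun i _ => ?_
      cases h : σ i <;> simp [swapEquiv_apply, h, mul_comm]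
    have hmem : swapEquiv σ x ∈ (pairs fun _ => true) ↔ x ∈ pairs σ := by
      have : ∀ S, ∑ i, sgn true * (f S ((swapEquiv σ x).1 i) - f S ((swapEquiv σ x).2 i))
          = ∑ i, sgn (σ i) * (f S (x.1 i) - f S (x.2 i)) := by
        intro S
        refine Finset.sum_congr rfl fun i _ => ?_
        cases h : σ i <;> simp [swapEquiv_apply, h, sgn]
      simp only [pairs, Set.mem_ofPred_eq, this]
    by_cases h : x ∈ pairs σ
    · rw [Set.indicator_of_mem h, Set.indicator_of_mem (hmem.2 h), hw]
    · rw [Set.indicator_of_notMem h, Set.indicator_of_notMem (fun h' => h (hmem.1 h'))]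
  -- One of the two samples must carry more than half of the threshold.
  have hC : ∀ σ, mass ω₂ (pairs σ) ≤ 2 * mass ω (sbad σ) := by
    intro σ
    refine le_trans (mass_mono hω₂ (B := Prod.fst ⁻¹' (sbad σ) ∪ Prod.snd ⁻¹' (sbad σ)) ?_)
      ((mass_union_le hω₂ _ _).trans (le_of_eq ?_))
    · rintro x ⟨S, hS⟩
      by_contra hcon
      rw [Set.mem_union, not_or] at hcon
      have h1 : |∑ i, sgn (σ i) * f S (x.1 i)| ≤ θ S / 2 :=
        not_lt.1 fun h => hcon.1 ⟨S, h⟩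
      have h2 : |∑ i, sgn (σ i) * f S (x.2 i)| ≤ θ S / 2 :=
        not_lt.1 fun h => hcon.2 ⟨S, h⟩
      simp only [mul_sub, Finset.sum_sub_distrib] at hS
      have := abs_sub (∑ i, sgn (σ i) * f S (x.1 i)) (∑ i, sgn (σ i) * f S (x.2 i))
      linarith
    · rw [mass_fst_preimage hω1, mass_snd_preimage hω1, two_mul]
  have hcoin1 : ∑ σ, prodWeight coin m σ = 1 := sum_prodWeight (by norm_num [coin])
  have hcoin0 : ∀ σ, 0 ≤ prodWeight coin m σ := prodWeight_nonneg coin_nonneg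
  have hD : mass ω bad ≤ ∑ σ, prodWeight coin m σ * (4 * mass ω (sbad σ)) := by
    rw [← one_mul (mass ω bad), ← hcoin1, Finset.sum_mul]
    refine Finset.sum_le_sum fun σ _ => mul_le_mul_of_nonneg_left ?_ (hcoin0 σ)
    have h1 := hB σ
    have h2 := hC σ
    linarith
  refine hD.trans ?_
  have hF : ∑ σ, prodWeight coin m σ * (4 * mass ω (sbad σ))
      = 4 * ∑ q, ω q * mass (prodWeight coin m) {σ | q ∈ sbad σ} := by
    simp only [mass, Finset.mul_sum]
    rw [Finset.sum_comm]
    refine Finset.sum_congr rfl fun q _ => Finset.sum_congr rfl fun σ _ => ?_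
    by_cases h : q ∈ sbad σ
    · simp only [Set.indicator, h, if_true, Set.mem_ofPred_eq]; ring
    · simp [Set.indicator, h]
  rw [hF]
  refine mul_le_mul_of_nonneg_left ?_ (by norm_num)
  calc ∑ q, ω q * mass (prodWeight coin m) {σ | q ∈ sbad σ}
      ≤ ∑ q, (Eᶜ.indicator ω q + ω q * δ) := by
        refine Finset.sum_le_sum fun q _ => ?_
        by_cases h : q ∈ E
        · rw [Set.indicator_of_notMem (by simpa using h), zero_add]
          exact mul_le_mul_of_nonneg_left (hE q h) (hω0 q)
        · rw [Set.indicator_of_mem (by simpa using h)]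
          have h1 : mass (prodWeight coin m) {σ | q ∈ sbad σ} ≤ 1 := by
            rw [← hcoin1, ← mass_univ]
            exact mass_mono hcoin0 (Set.subset_univ _)
          have h2 := hω0 q
          nlinarith [mul_nonneg h2 hδ]
    _ = mass ω Eᶜ + δ := by
        rw [Finset.sum_add_distrib, ← Finset.sum_mul, hω1, one_mul, mass]

end Symmetrization

/-! ### The sample law as a finite product weight -/

section SampleLaw

variable {d k m : ℕ}

theorem prob_nonneg (P : Finset (Pt d)) (A : Fin k → Pt d) (τ : Pt d → Fin k) (p : P) :
    0 ≤ prob P A τ p :=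
  div_nonneg (score_pos P A τ p.2).le (Finset.sum_nonneg fun _ hq => (score_pos P A τ hq).le)

theorem sampleMeasure_singleton (P : Finset (Pt d)) (A : Fin k → Pt d) (τ : Pt d → Fin k)
    (p : P) : sampleMeasure P A τ {p} = ENNReal.ofReal (prob P A τ p) := by
  classical
  rw [sampleMeasure, Measure.coe_finsetSum, Finset.sum_apply, Finset.sum_eq_single p]
  · simp
  · intro b _ hb
    simp [hb]
  · simp

theorem sampleLaw_eq_mass (P : Finset (Pt d)) (A : Fin k → Pt d) (τ : Pt d → Fin k)
    (hP : P.Nonempty) (B : Set (Fin m → P)) :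
    sampleLaw P A τ m B
      = ENNReal.ofReal (mass (prodWeight (fun p : P => prob P A τ p) m) B) := by
  classical
  have := isProbabilityMeasure_sampleMeasure P A τ hP
  have h0 : ∀ q, 0 ≤ prodWeight (fun p : P => prob P A τ p) m q :=
    prodWeight_nonneg (prob_nonneg P A τ)
  have hB : B = ((Finset.univ.filter fun q => q ∈ B : Finset (Fin m → P)) : Set (Fin m → P)) := by
    ext; simp
  conv_lhs => rw [hB, ← sum_measure_singleton]
  rw [mass, Finset.sum_indicator_eq_sum_filter Finset.univ (fun _ => prodWeight _ m) (fun _ => B)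
    (fun q => q), ENNReal.ofReal_sum_of_nonneg fun q _ => h0 q]
  refine Finset.sum_congr rfl fun q _ => ?_
  rw [sampleLaw, Measure.pi_singleton, prodWeight,
    ENNReal.ofReal_prod_of_nonneg fun i _ => prob_nonneg P A τ (q i)]
  exact Finset.prod_congr rfl fun i _ => sampleMeasure_singleton P A τ (q i)

end SampleLaw
-- Scores, weights and cluster estimates
section Sampling

variable {d k m : ℕ} (P : Finset (Pt d)) (A : Fin k → Pt d) (τ : Pt d → Fin k)

theorem sum_eq_sum_cluster (f : Pt d → ℝ) : ∑ p ∈ P, f p = ∑ j, ∑ p ∈ cluster P τ j, f p :=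
  (Finset.sum_fiberwise P τ f).symm

theorem cost_eq_sum_cost_cluster : cost P A = ∑ j, cost (cluster P τ j) A :=
  sum_eq_sum_cluster P τ _

/-- Each of the four terms sums to at most `1` before the factor `1 / 4`, since `0 / 0 = 0`.
Normalization therefore only raises probabilities (`score_le_prob`), and the weight bounds survive
degenerate clusterings. -/
theorem sum_score_le_one (hk : 1 ≤ k) : ∑ p ∈ P, score P A τ p ≤ 1 := by
  have hk0 : (0 : ℝ) < k := by exact_mod_cast hk
  have hΦ : 0 ≤ cost P A := cost_nonneg P A
  have key : ∀ j, ∑ p ∈ cluster P τ j, score P A τ p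
      ≤ (1 / 4) * (1 / k + 1 / k + cost (cluster P τ j) A / cost P A
        + cost (cluster P τ j) A / cost P A) := by
    intro j
    have hj : ∀ p ∈ cluster P τ j, score P A τ p
        = (1 / 4) * (1 / ((k : ℝ) * ((cluster P τ j).card : ℝ))
          + pointCost A p / ((k : ℝ) * cost (cluster P τ j) A)
          + pointCost A p / cost P A
          + cost (cluster P τ j) A / ((cluster P τ j).card : ℝ) / cost P A) := by
      intro p hp
      have : τ p = j := (Finset.mem_filter.1 hp).2
      simp only [score, avgCost, this]
    have hs : ∑ p ∈ cluster P τ j, pointCost A p = cost (cluster P τ j) A := rfl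
    rw [Finset.sum_congr rfl hj, ← Finset.mul_sum]
    simp only [Finset.sum_add_distrib, Finset.sum_const, nsmul_eq_mul, ← Finset.sum_div, hs]
    have h0 := cost_nonneg (cluster P τ j) A
    have e1 : ((cluster P τ j).card : ℝ) * (1 / (k * ((cluster P τ j).card : ℝ))) ≤ 1 / k := by
      rw [mul_one_div, mul_comm (k : ℝ), ← div_div]
      gcongr
      exact div_self_le_one _
    have e2 : cost (cluster P τ j) A / (k * cost (cluster P τ j) A) ≤ 1 / k := by
      rw [mul_comm (k : ℝ), ← div_div]
      gcongr
      exact div_self_le_one _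
    have e3 : ((cluster P τ j).card : ℝ) *
        (cost (cluster P τ j) A / ((cluster P τ j).card : ℝ) / cost P A)
        ≤ cost (cluster P τ j) A / cost P A := by
      rw [← mul_div_assoc, mul_div_left_comm]
      gcongr
      exact mul_le_of_le_one_right h0 (div_self_le_one _)
    gcongr
  rw [sum_eq_sum_cluster P τ]
  refine (Finset.sum_le_sum fun j _ => key j).trans ?_
  rw [← Finset.mul_sum]
  simp only [Finset.sum_add_distrib, Finset.sum_const, nsmul_eq_mul, ← Finset.sum_div,
    ← cost_eq_sum_cost_cluster P A τ, Finset.card_univ, Fintype.card_fin]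
  rw [mul_one_div, div_self hk0.ne']
  linarith [div_self_le_one (cost P A)]

theorem sum_prob (hP : P.Nonempty) : ∑ p : P, prob P A τ p = 1 := by
  have hs : 0 < ∑ q ∈ P, score P A τ q := Finset.sum_pos (fun q hq => score_pos P A τ hq) hP
  rw [Finset.sum_coe_sort P (fun p => prob P A τ p)]
  simp only [prob]
  rw [← Finset.sum_div, div_self hs.ne']

theorem score_le_prob (hk : 1 ≤ k) {p : Pt d} (hp : p ∈ P) : score P A τ p ≤ prob P A τ p := by
  have hs : 0 < ∑ q ∈ P, score P A τ q :=
    Finset.sum_pos (fun q hq => score_pos P A τ hq) ⟨p, hp⟩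
  rw [prob, le_div_iff₀ hs]
  exact mul_le_of_le_one_right (score_pos P A τ hp).le (sum_score_le_one P A τ hk)

theorem weight_nonneg (p : P) : 0 ≤ weight P A τ m p :=
  one_div_nonneg.2 (mul_nonneg (Nat.cast_nonneg _) (prob_nonneg P A τ p))

theorem prob_mul_weight (hk : 1 ≤ k) {p : Pt d} (hp : p ∈ P) :
    prob P A τ p * weight P A τ m p = 1 / m := by
  have h := (score_pos P A τ hp).trans_le (score_le_prob P A τ hk hp)
  rw [weight, mul_one_div, mul_comm (m : ℝ), ← div_div, div_self h.ne']

theorem weight_mul_le (hk : 1 ≤ k) (hm : 1 ≤ m) {p : Pt d} (hp : p ∈ P) {y c : ℝ} (hy : 0 ≤ y)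
    (hyc : y ≤ 4 * c * score P A τ p) : weight P A τ m p * y ≤ 4 / m * c := by
  have h0 := score_pos P A τ hp
  have h1 := score_le_prob P A τ hk hp
  have hm0 : (0 : ℝ) < m := by exact_mod_cast hm
  have h2 := h0.trans_le h1
  have hc : 0 ≤ 4 * c := by
    by_contra h
    nlinarith
  rw [weight, one_div_mul_eq_div, div_le_iff₀ (by positivity)]
  calc y ≤ 4 * c * score P A τ p := hyc
    _ ≤ 4 * c * prob P A τ p := by gcongr
    _ = _ := by field_simp

theorem card_cluster_pos {p : Pt d} (hp : p ∈ P) : 0 < ((cluster P τ (τ p)).card : ℝ) := by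
  exact_mod_cast Finset.card_pos.2 ⟨p, by simp [cluster, hp]⟩

theorem pointCost_le_cost_cluster {p : Pt d} (hp : p ∈ P) :
    pointCost A p ≤ cost (cluster P τ (τ p)) A :=
  Finset.single_le_sum (f := fun p => pointCost A p) (fun q _ => pointCost_nonneg A q)
    (by simp [cluster, hp])

theorem cost_cluster_le_cost (j : Fin k) : cost (cluster P τ j) A ≤ cost P A :=
  Finset.sum_le_sum_of_subset_of_nonneg (Finset.filter_subset _ _)
    fun q _ _ => pointCost_nonneg A q

theorem avgCost_nonneg (p : Pt d) : 0 ≤ avgCost P A τ p :=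
  div_nonneg (cost_nonneg _ _) (Nat.cast_nonneg _)

theorem four_mul_score_eq (p : Pt d) : 4 * score P A τ p =
    1 / ((k : ℝ) * ((cluster P τ (τ p)).card : ℝ))
    + pointCost A p / ((k : ℝ) * cost (cluster P τ (τ p)) A)
    + pointCost A p / cost P A + avgCost P A τ p / cost P A := by
  rw [score]; ring

/-- The first term of the score alone suffices. The bound limits the weights when cluster sizes are
estimated. -/
theorem one_le_mul_score (hk : 1 ≤ k) {p : Pt d} (hp : p ∈ P) :
    1 ≤ 4 * (k * ((cluster P τ (τ p)).card : ℝ)) * score P A τ p := by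
  have hk0 : (0 : ℝ) < k := by exact_mod_cast hk
  have hc := card_cluster_pos P τ hp
  have h1 := pointCost_nonneg A p
  have h2 := cost_nonneg (cluster P τ (τ p)) A
  have h3 := cost_nonneg P A
  have h4 := avgCost_nonneg P A τ p
  rw [mul_right_comm, four_mul_score_eq]
  rw [← div_le_iff₀ (by positivity)]
  have : 0 ≤ pointCost A p / ((k : ℝ) * cost (cluster P τ (τ p)) A)
    + pointCost A p / cost P A + avgCost P A τ p / cost P A := by positivity
  linarith

/-- These are the third and fourth terms of the score. -/
theorem pointCost_add_avgCost_le_cost_mul_score (hk : 1 ≤ k) {p : Pt d} (hp : p ∈ P) :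
    pointCost A p + avgCost P A τ p ≤ 4 * cost P A * score P A τ p := by
  have hk0 : (0 : ℝ) < k := by exact_mod_cast hk
  have hc := card_cluster_pos P τ hp
  have h1 := pointCost_nonneg A p
  have h1' := pointCost_le_cost_cluster P A τ hp
  have h2 := cost_nonneg (cluster P τ (τ p)) A
  have h2' := cost_cluster_le_cost P A τ (τ p)
  have h4 := avgCost_nonneg P A τ p
  rcases (cost_nonneg P A).eq_or_lt with h3 | h3
  · have e1 : cost (cluster P τ (τ p)) A = 0 := le_antisymm (by linarith) h2
    have e2 : pointCost A p = 0 := le_antisymm (by linarith) h1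
    rw [avgCost, e1, e2, ← h3]
    simp
  · rw [mul_right_comm, four_mul_score_eq, ← div_le_iff₀ h3, add_div]
    have : 0 ≤ 1 / ((k : ℝ) * ((cluster P τ (τ p)).card : ℝ))
      + pointCost A p / ((k : ℝ) * cost (cluster P τ (τ p)) A) := by positivity
    linarith

/-- These are the second and first terms of the score, because `Δ_p / cost(C_j, A) = 1 / |C_j|`. -/
theorem pointCost_add_avgCost_le_cluster_mul_score (hk : 1 ≤ k) {p : Pt d} (hp : p ∈ P) :
    pointCost A p + avgCost P A τ p ≤ 4 * (k * cost (cluster P τ (τ p)) A) * score P A τ p := by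
  have hk0 : (0 : ℝ) < k := by exact_mod_cast hk
  have hc := card_cluster_pos P τ hp
  have h1 := pointCost_nonneg A p
  have h1' := pointCost_le_cost_cluster P A τ hp
  have h3 := cost_nonneg P A
  have h4 := avgCost_nonneg P A τ p
  rcases (cost_nonneg (cluster P τ (τ p)) A).eq_or_lt with h2 | h2
  · have e2 : pointCost A p = 0 := le_antisymm (by linarith) h1
    rw [avgCost, ← h2, e2]
    simp
  · rw [mul_right_comm, four_mul_score_eq, ← div_le_iff₀ (by positivity), add_div]
    have e1 : avgCost P A τ p / (k * cost (cluster P τ (τ p)) A)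
        = 1 / (k * ((cluster P τ (τ p)).card : ℝ)) := by
      rw [avgCost]
      field_simp
    have : 0 ≤ pointCost A p / cost P A + avgCost P A τ p / cost P A := by positivity
    rw [e1]
    linarith

/-- The sample estimates the sum of a nonnegative function over one cluster. -/
theorem mass_cluster_deviation_le (hP : P.Nonempty) (hk : 1 ≤ k) (hm : 1 ≤ m) (j : Fin k)
    (h : Pt d → ℝ) (hh : ∀ p, 0 ≤ h p) {ε : ℝ} (hε : 0 < ε) (hε1 : ε ≤ 1)
    (hb : ∀ p ∈ P, τ p = j →
      weight P A τ m p * h p ≤ 4 / m * (k * ∑ p ∈ cluster P τ j, h p)) :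
    mass (prodWeight (fun p : P => prob P A τ p) m)
      {q | ε * ∑ p ∈ cluster P τ j, h p < |∑ i, (if τ (q i) = j then
        weight P A τ m (q i) * h (q i) else 0) - ∑ p ∈ cluster P τ j, h p|}
      ≤ 2 * Real.exp (-(ε ^ 2 * m / (16 * k))) := by
  set s := ∑ p ∈ cluster P τ j, h p with hs
  have hs0 : 0 ≤ s := Finset.sum_nonneg fun p _ => hh p
  have hm0 : (0 : ℝ) < m := by exact_mod_cast hm
  have hk0 : (0 : ℝ) < k := by exact_mod_cast hk
  have hμ : ∀ p : P, 0 ≤ prob P A τ p := prob_nonneg P A τ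
  let y : P → ℝ := fun p => if τ p = j then weight P A τ m p * h p else 0
  have hy0 : ∀ p, 0 ≤ y p := by
    intro p
    by_cases hp : τ p = j
    · simp only [y, hp, if_true]
      exact mul_nonneg (weight_nonneg P A τ p) (hh p)
    · simp [y, hp]
  have hyb : ∀ p, y p ≤ 4 / m * (k * s) := by
    intro p
    by_cases hp : τ p = j
    · simp only [y, hp, if_true]
      exact hb p p.2 hp
    · simp only [y, hp, if_false]
      positivity
  have hmean : ∑ p : P, prob P A τ p * y p = s / m := by
    have e1 : ∀ p : P, prob P A τ p * y p = if τ p = j then h p / m else 0 := by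
      intro p
      by_cases hp : τ p = j
      · simp only [y, hp, if_true]
        rw [← mul_assoc, prob_mul_weight P A τ hk p.2]
        ring
      · simp [y, hp]
    rw [Finset.sum_congr rfl fun p _ => e1 p,
      Finset.sum_coe_sort P (fun p => if τ p = j then h p / m else 0), ← Finset.sum_filter,
      ← Finset.sum_div]
    rfl
  rcases hs0.eq_or_lt with h0 | h0
  · have : ∀ p, y p = 0 := fun p => le_antisymm ((hyb p).trans (by rw [← h0]; simp)) (hy0 p)
    have hempty : {q : Fin m → P | ε * s < |∑ i, y (q i) - s|} = ∅ := by
      ext q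
      simp [this, ← h0]
    change mass _ {q : Fin m → P | ε * s < |∑ i, y (q i) - s|} ≤ _
    rw [hempty, mass_empty]
    positivity
  · have hdev := mass_sample_deviation_le (m := m) hμ (sum_prob P A τ hP) hm (fun p => y p / s)
      (κ := 4 * k) (δ := ε) (by positivity) (fun p => by
        rw [abs_of_nonneg (div_nonneg (hy0 p) hs0), div_le_iff₀ h0]
        refine (hyb p).trans (le_of_eq ?_)
        ring) (by
        have e1 : ∀ p : P, prob P A τ p * |y p / s| = prob P A τ p * y p / s := by
          intro p
          rw [abs_of_nonneg (div_nonneg (hy0 p) hs0), mul_div_assoc]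
        rw [Finset.sum_congr rfl fun p _ => e1 p, ← Finset.sum_div, hmean]
        apply le_of_eq
        field_simp) hε hε1
    have e16 : ε ^ 2 * m / (16 * (k : ℝ)) = ε ^ 2 * m / (4 * (4 * k)) := by ring
    rw [e16]
    refine le_trans (mass_mono (prodWeight_nonneg hμ) ?_) hdev
    intro q hq
    change ε * s < |∑ i, y (q i) - s| at hq
    show ε < |∑ i, y (q i) / s - m * ∑ p : P, prob P A τ p * (y p / s)|
    have e1 : ∑ p : P, prob P A τ p * (y p / s) = 1 / m := by
      rw [Finset.sum_congr rfl fun p _ => (mul_div_assoc _ _ _).symm, ← Finset.sum_div, hmean]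
      field_simp
    rw [e1, mul_one_div_cancel hm0.ne', ← Finset.sum_div, ← div_self h0.ne', ← sub_div, abs_div,
      abs_of_pos h0, lt_div_iff₀ h0]
    exact hq

end Sampling
-- From signed sums to the coreset error
section Coreset

variable {d k m : ℕ} (P : Finset (Pt d)) (A : Fin k → Pt d) (τ : Pt d → Fin k)

/-- The error scale: the cost of `A` plus the distances of the centers of `A` to `S`, weighted with
the cluster sizes. -/
def errScale (S : Fin k → Pt d) : ℝ :=
  cost P A + ∑ j, ((cluster P τ j).card : ℝ) * pointCost S (A j)

theorem sum_card_mul_eq (S : Fin k → Pt d) :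
    ∑ j, ((cluster P τ j).card : ℝ) * pointCost S (A j) = ∑ p ∈ P, pointCost S (A (τ p)) := by
  rw [sum_eq_sum_cluster P τ]
  refine Finset.sum_congr rfl fun j _ => ?_
  rw [← nsmul_eq_mul, ← Finset.sum_const]
  refine Finset.sum_congr rfl fun p hp => ?_
  rw [(Finset.mem_filter.1 hp).2]

/-- By the triangle inequality `cost(a_j, S) ≤ cost(p, A) + cost(p, S)` for `p ∈ C_j`, so the error
scale is at most `2 cost(P, A) + cost(P, S)`. -/
theorem errScale_le {γ : ℝ} (hA : IsApproxSolution γ P A) (hτ : IsNearestAssignment P A τ)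
    (S : Fin k → Pt d) : errScale P A τ S ≤ (1 + 2 * γ) * cost P S := by
  have h1 : ∑ p ∈ P, pointCost S (A (τ p)) ≤ cost P A + cost P S := by
    rw [cost, cost, ← Finset.sum_add_distrib]
    refine Finset.sum_le_sum fun p hp => ?_
    rw [← hτ p hp, dist_comm]
    exact pointCost_le_dist_add S _ _
  rw [errScale, sum_card_mul_eq]
  linarith [hA S]

/-- The event that the sample estimates the size and the cost of every cluster. -/
def clusterEvent (ε : ℝ) (m : ℕ) : Set (Fin m → P) :=
  {q | ∀ j, |∑ i, (if τ (q i) = j then weight P A τ m (q i) * 1 else 0)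
      - ∑ _p ∈ cluster P τ j, (1 : ℝ)| ≤ ε * ∑ _p ∈ cluster P τ j, (1 : ℝ) ∧
    |∑ i, (if τ (q i) = j then weight P A τ m (q i) * pointCost A (q i) else 0)
      - ∑ p ∈ cluster P τ j, pointCost A p| ≤ ε * ∑ p ∈ cluster P τ j, pointCost A p}

theorem exp_neg_le_of_log_le (hk : 1 ≤ k) {ε : ℝ} (h : 16 * k * Real.log (400 * k) ≤ ε ^ 2 * m) :
    Real.exp (-(ε ^ 2 * m / (16 * k))) ≤ 1 / (400 * k) := by
  have hk0 : (0 : ℝ) < k := by exact_mod_cast hk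
  rw [Real.exp_neg, one_div]
  refine inv_anti₀ (by positivity) ?_
  rw [← Real.log_le_iff_le_exp (by positivity), le_div_iff₀ (by positivity)]
  linarith

theorem mass_clusterEvent_compl_le (hP : P.Nonempty) (hk : 1 ≤ k) (hm : 1 ≤ m) {ε : ℝ}
    (hε : 0 < ε) (hε1 : ε ≤ 1) (hmk : 16 * k * Real.log (400 * k) ≤ ε ^ 2 * m) :
    mass (prodWeight (fun p : P => prob P A τ p) m) (clusterEvent P A τ ε m)ᶜ ≤ 1 / 100 := by
  classical
  have hk0 : (0 : ℝ) < k := by exact_mod_cast hk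
  have hnn : ∀ q, 0 ≤ prodWeight (fun p : P => prob P A τ p) m q :=
    prodWeight_nonneg (prob_nonneg P A τ)
  let dev : (Pt d → ℝ) → Fin k → Set (Fin m → P) := fun h j =>
    {q | ε * ∑ p ∈ cluster P τ j, h p < |∑ i, (if τ (q i) = j then
        weight P A τ m (q i) * h (q i) else 0) - ∑ p ∈ cluster P τ j, h p|}
  have hexp := exp_neg_le_of_log_le (m := m) hk hmk
  have h1 : ∀ j, mass (prodWeight (fun p : P => prob P A τ p) m) (dev (fun _ => 1) j)
      ≤ 2 * (1 / (400 * k)) := by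
    intro j
    refine (mass_cluster_deviation_le P A τ hP hk hm j (fun _ => 1) (fun _ => zero_le_one)
      hε hε1 ?_).trans (by linarith)
    intro p hp hpj
    refine weight_mul_le P A τ hk hm hp zero_le_one ?_
    rw [← hpj, Finset.sum_const, nsmul_eq_mul, mul_one]
    exact one_le_mul_score P A τ hk hp
  have h2 : ∀ j, mass (prodWeight (fun p : P => prob P A τ p) m) (dev (pointCost A) j)
      ≤ 2 * (1 / (400 * k)) := by
    intro j
    refine (mass_cluster_deviation_le P A τ hP hk hm j (pointCost A) (pointCost_nonneg A)
      hε hε1 ?_).trans (by linarith)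
    intro p hp hpj
    refine weight_mul_le P A τ hk hm hp (pointCost_nonneg A p) ?_
    rw [← hpj]
    have := pointCost_add_avgCost_le_cluster_mul_score P A τ hk hp
    exact (le_add_of_nonneg_right (avgCost_nonneg P A τ p)).trans this
  refine le_trans (mass_mono hnn (B := ⋃ j ∈ (Finset.univ : Finset (Fin k)),
    (dev (fun _ => 1) j ∪ dev (pointCost A) j)) ?_)
    ((mass_biUnion_le_card_mul hnn Finset.univ _ (δ := 4 * (1 / (400 * k)))
      fun j _ => ?_).trans ?_)
  · intro q hq
    simp only [clusterEvent, Set.mem_compl_iff, Set.mem_ofPred_eq, not_forall, not_and_or,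
      not_le] at hq
    obtain ⟨j, hj⟩ := hq
    simp only [Set.mem_iUnion]
    exact ⟨j, Finset.mem_univ j, hj⟩
  · refine (mass_union_le hnn _ _).trans ?_
    have := h1 j
    have := h2 j
    linarith
  · rw [Finset.card_univ, Fintype.card_fin]
    apply le_of_eq
    field_simp
    norm_num

/-- The weighted cost difference between a point and the center of its cluster. -/
def weightedDiff (m : ℕ) (S : Fin k → Pt d) (p : P) : ℝ :=
  weight P A τ m p * (pointCost S p - pointCost S (A (τ p)))

/-- For one fixed `S` Bernstein's inequality suffices, without any net. The factor `10` is chosen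
for the symmetrization: half of it is the `5` of `mass_core_le`. -/
theorem mass_ghost_le (hP : P.Nonempty) (hk : 1 ≤ k) (hm : 1 ≤ m)
    (hτ : IsNearestAssignment P A τ) {ε : ℝ}
    (hε : 0 < ε) (hε1 : ε ≤ 1) (hmk : 16 * k * Real.log (400 * k) ≤ ε ^ 2 * m)
    (S : Fin k → Pt d) :
    mass (prodWeight (fun p : P => prob P A τ p) m)
      {q | 10 * ε * errScale P A τ S < |∑ i, weightedDiff P A τ m S (q i)
        - ∑ p ∈ P, (pointCost S p - pointCost S (A (τ p)))|} ≤ 1 / 2 := by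
  have hk1 : (1 : ℝ) ≤ k := by exact_mod_cast hk
  have hm0 : (0 : ℝ) < m := by exact_mod_cast hm
  have hnn : ∀ q, 0 ≤ prodWeight (fun p : P => prob P A τ p) m q :=
    prodWeight_nonneg (prob_nonneg P A τ)
  have hW : cost P A ≤ errScale P A τ S :=
    le_add_of_nonneg_right (Finset.sum_nonneg fun j _ =>
      mul_nonneg (Nat.cast_nonneg _) (pointCost_nonneg _ _))
  have hf : ∀ p : P, |pointCost S p - pointCost S (A (τ p))| ≤ pointCost A p := by
    intro p
    rw [← hτ p p.2]
    exact abs_pointCost_sub_le S _ _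
  have hz : ∀ p, |weightedDiff P A τ m S p| ≤ 4 / m * cost P A := by
    intro p
    rw [weightedDiff, abs_mul, abs_of_nonneg (weight_nonneg P A τ p)]
    refine (mul_le_mul_of_nonneg_left (hf p) (weight_nonneg P A τ p)).trans
      (weight_mul_le P A τ hk hm p.2 (pointCost_nonneg A p) ?_)
    exact (le_add_of_nonneg_right (avgCost_nonneg P A τ p)).trans
      (pointCost_add_avgCost_le_cost_mul_score P A τ hk p.2)
  have hmean : ∀ p : P, prob P A τ p * weightedDiff P A τ m S p
      = (pointCost S p - pointCost S (A (τ p))) / m := by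
    intro p
    rw [weightedDiff, ← mul_assoc, prob_mul_weight P A τ hk p.2]
    ring
  rcases (cost_nonneg P A).eq_or_lt with h0 | h0
  · have h1 : ∀ p, weightedDiff P A τ m S p = 0 := fun p =>
      abs_nonpos_iff.1 ((hz p).trans (by rw [← h0, mul_zero]))
    have h2 : ∀ p ∈ P, pointCost S p - pointCost S (A (τ p)) = 0 := by
      intro p hp
      have := hmean ⟨p, hp⟩
      rw [h1, mul_zero] at this
      have h3 := (div_eq_zero_iff.1 this.symm).resolve_right hm0.ne'
      exact h3
    have hempty : {q : Fin m → P | 10 * ε * errScale P A τ S < |∑ i, weightedDiff P A τ m S (q i)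
        - ∑ p ∈ P, (pointCost S p - pointCost S (A (τ p)))|} = ∅ := by
      ext q
      rw [Finset.sum_eq_zero h2]
      have : 0 ≤ 10 * ε * errScale P A τ S := mul_nonneg (by positivity) (h0.le.trans hW)
      simpa [h1] using this
    rw [hempty, mass_empty]
    norm_num
  · have hdev := mass_sample_deviation_le (m := m) (prob_nonneg P A τ) (sum_prob P A τ hP) hm
      (fun p => weightedDiff P A τ m S p / cost P A) (κ := 4) (δ := ε) (by norm_num) (fun p => by
        rw [abs_div, abs_of_pos h0, div_le_iff₀ h0]
        exact hz p) (by
        have e1 : ∀ p : P, prob P A τ p * |weightedDiff P A τ m S p / cost P A|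
            ≤ pointCost A p / m / cost P A := by
          intro p
          rw [abs_div, abs_of_pos h0, ← mul_div_assoc]
          gcongr
          rw [← abs_of_nonneg (prob_nonneg P A τ p), ← abs_mul, hmean, abs_div,
            abs_of_pos hm0]
          gcongr
          exact hf p
        refine (Finset.sum_le_sum fun p _ => e1 p).trans (le_of_eq ?_)
        rw [Finset.sum_coe_sort P (fun p => pointCost A p / m / cost P A), ← Finset.sum_div,
          ← Finset.sum_div]
        change cost P A / m / cost P A = 1 / m
        field_simp) hε hε1
    refine le_trans (mass_mono hnn ?_) (hdev.trans ?_)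
    · intro q hq
      show ε < |∑ i, weightedDiff P A τ m S (q i) / cost P A
        - m * ∑ p : P, prob P A τ p * (weightedDiff P A τ m S p / cost P A)|
      have e1 : m * ∑ p : P, prob P A τ p * (weightedDiff P A τ m S p / cost P A)
          = (∑ p ∈ P, (pointCost S p - pointCost S (A (τ p)))) / cost P A := by
        rw [Finset.sum_congr rfl fun p _ => (mul_div_assoc _ _ _).symm,
          Finset.sum_congr rfl fun p _ => congrArg (· / cost P A) (hmean p),
          Finset.sum_coe_sort P
            (fun p => (pointCost S p - pointCost S (A (τ p))) / m / cost P A),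
          ← Finset.sum_div, ← Finset.sum_div]
        field_simp
      rw [e1, ← Finset.sum_div, ← sub_div, abs_div, abs_of_pos h0, lt_div_iff₀ h0]
      refine lt_of_le_of_lt ?_ hq
      nlinarith
    · have hexp := exp_neg_le_of_log_le (m := m) hk hmk
      have h1 : Real.exp (-(ε ^ 2 * m / (4 * 4))) ≤ Real.exp (-(ε ^ 2 * m / (16 * k))) := by
        refine Real.exp_le_exp.2 (neg_le_neg ?_)
        refine div_le_div_of_nonneg_left (by positivity) (by norm_num) (by linarith)
      have h2 : (1 : ℝ) / (400 * k) ≤ 1 / 4 :=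
        one_div_le_one_div_of_le (by norm_num) (by linarith)
      linarith

/-- On the cluster event, the signed sums of the weighted cost differences are small. -/
theorem mass_signs_le (hk : 1 ≤ k) (hm : 1 ≤ m)
    (hτ : IsNearestAssignment P A τ) {ε : ℝ} {N : ℕ}
    (hε : 0 < ε) (hε1 : ε ≤ 1) (hεN : 1 ≤ ε * 2 ^ N)
    (hmC : ∀ t ≤ N, 539136 * 1101609 * (N + 1) ^ 7 * Real.log (2 * (m + k : ℕ) + 1) * (k * 2 ^ t)
        ≤ ε ^ 2 * m ∨ (1 ≤ t ∧ 539136 * 1101609 * (N + 1) ^ 7 *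
          Real.log (2 * (m + k : ℕ) + 1) * (2 * k ^ 2 / (2 ^ t) ^ 2) ≤ ε ^ 2 * m))
    (q : Fin m → P) (hq : q ∈ clusterEvent P A τ ε m) :
    mass (prodWeight coin m) {σ | ∃ S, 10 * ε * errScale P A τ S / 2
      < |∑ i, sgn (σ i) * weightedDiff P A τ m S (q i)|} ≤ 1 / 100 := by
  have hdist : ∀ i, dist (q i : Pt d) (A (τ (q i))) = pointCost A (q i) := fun i => hτ _ (q i).2
  have hcore := mass_core_le (fun i => (q i : Pt d)) A (fun i => τ (q i))
    (fun j => cost (cluster P τ j) A / ((cluster P τ j).card : ℝ))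
    (fun j => ((cluster P τ j).card : ℝ)) (fun j => cost (cluster P τ j) A)
    (fun i => weight P A τ m (q i)) (fun i => weight_nonneg P A τ (q i)) (ε := ε) (N := N)
    (fun j => div_nonneg (cost_nonneg _ _) (Nat.cast_nonneg _)) (fun j => Nat.cast_nonneg _)
    (fun j => by
      rcases (cluster P τ j).eq_empty_or_nonempty with h | h
      · simp [h, cost]
      · have : ((cluster P τ j).card : ℝ) ≠ 0 := by exact_mod_cast h.card_pos.ne'
        field_simp) hm hk hε hεN
    (fun i => by
      simp only [hdist]
      rw [← cost_eq_sum_cost_cluster]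
      have hnn : 0 ≤ pointCost A (q i) + avgCost P A τ (q i) :=
        add_nonneg (pointCost_nonneg _ _) (avgCost_nonneg _ _ _ _)
      have h1 := weight_mul_le P A τ hk hm (q i).2 hnn
        (pointCost_add_avgCost_le_cost_mul_score P A τ hk (q i).2)
      have h2 := weight_mul_le P A τ hk hm (q i).2 hnn
        (pointCost_add_avgCost_le_cluster_mul_score P A τ hk (q i).2)
      rw [mul_min_of_nonneg _ _ (by positivity)]
      exact le_min h1 h2)
    (fun j => by
      obtain ⟨h1, h2⟩ := hq j
      simp only [hdist]
      set Δ := cost (cluster P τ j) A / ((cluster P τ j).card : ℝ) with hΔ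
      have hΔ0 : 0 ≤ Δ := div_nonneg (cost_nonneg _ _) (Nat.cast_nonneg _)
      have hn : Δ * ((cluster P τ j).card : ℝ) ≤ cost (cluster P τ j) A := by
        rw [hΔ, div_mul_comm]
        exact mul_le_of_le_one_left (cost_nonneg _ _) (div_self_le_one _)
      have e1 : ∀ i, (if τ (q i) = j then weight P A τ m (q i) * (pointCost A (q i)
            + cost (cluster P τ (τ (q i))) A / ((cluster P τ (τ (q i))).card : ℝ)) else 0)
          = (if τ (q i) = j then weight P A τ m (q i) * pointCost A (q i) else 0)
            + Δ * (if τ (q i) = j then weight P A τ m (q i) * 1 else 0) := by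
        intro i
        by_cases h : τ (q i) = j
        · simp only [h, if_true, hΔ]; ring
        · simp [h]
      rw [Finset.sum_congr rfl fun i _ => e1 i, Finset.sum_add_distrib, ← Finset.mul_sum]
      rw [Finset.sum_const, nsmul_eq_mul, mul_one] at h1
      change |_ - cost (cluster P τ j) A| ≤ ε * cost (cluster P τ j) A at h2
      have h3 := (abs_le.1 h1).2
      have h4 := (abs_le.1 h2).2
      have h5 := cost_nonneg (cluster P τ j) A
      have h6 : (0 : ℝ) ≤ (cluster P τ j).card := Nat.cast_nonneg _
      -- As `ε ≤ 1`, size and cost of a cluster are overestimated at most twofold; the two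
      -- contributions give `4 cost(C_j, A)`.
      have h7 : ∑ i, (if τ (q i) = j then weight P A τ m (q i) * 1 else 0)
          ≤ 2 * (cluster P τ j).card := by nlinarith
      have h8 := mul_le_mul_of_nonneg_left h7 hΔ0
      nlinarith) hmC
  refine le_trans (le_of_eq ?_) hcore
  congr 1
  ext σ
  simp only [Set.mem_ofPred_eq, weightedDiff, errScale]
  rw [← cost_eq_sum_cost_cluster]
  refine exists_congr fun S => ?_
  rw [show 10 * ε * (cost P A + ∑ j, ((cluster P τ j).card : ℝ) * pointCost S (A j)) / 2
    = 5 * ε * (cost P A + ∑ j, ((cluster P τ j).card : ℝ) * pointCost S (A j)) by ring]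

/-- With probability at least `2 / 3` the sampling error is at most `21 ε` times the error scale,
for all centers simultaneously. -/
theorem mass_error_le (hP : P.Nonempty) (hk : 1 ≤ k) (hm : 1 ≤ m)
    (hτ : IsNearestAssignment P A τ) {ε : ℝ} {N : ℕ}
    (hε : 0 < ε) (hε1 : ε ≤ 1) (hεN : 1 ≤ ε * 2 ^ N)
    (hmk : 16 * k * Real.log (400 * k) ≤ ε ^ 2 * m)
    (hmC : ∀ t ≤ N, 539136 * 1101609 * (N + 1) ^ 7 * Real.log (2 * (m + k : ℕ) + 1) * (k * 2 ^ t)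
        ≤ ε ^ 2 * m ∨ (1 ≤ t ∧ 539136 * 1101609 * (N + 1) ^ 7 *
          Real.log (2 * (m + k : ℕ) + 1) * (2 * k ^ 2 / (2 ^ t) ^ 2) ≤ ε ^ 2 * m)) :
    mass (prodWeight (fun p : P => prob P A τ p) m) {q | ∃ S : Fin k → Pt d,
      21 * ε * errScale P A τ S < |∑ i, weight P A τ m (q i) * pointCost S (q i) - cost P S|}
      ≤ 1 / 3 := by
  have hnn : ∀ q, 0 ≤ prodWeight (fun p : P => prob P A τ p) m q :=
    prodWeight_nonneg (prob_nonneg P A τ)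
  have hE := mass_clusterEvent_compl_le P A τ hP hk hm hε hε1 hmk
  have hsym := mass_symmetrization_le (prob_nonneg P A τ) (sum_prob P A τ hP)
    (weightedDiff P A τ m) (fun S => ∑ p ∈ P, (pointCost S p - pointCost S (A (τ p))))
    (fun S => 10 * ε * errScale P A τ S) (clusterEvent P A τ ε m) (δ := 1 / 100) (by norm_num)
    (fun S => mass_ghost_le P A τ hP hk hm hτ hε hε1 hmk S)
    (fun q hq => mass_signs_le P A τ hk hm hτ hε hε1 hεN hmC q hq)
  -- The failure probability is at most `1/100 + 4 (1/100 + 1/100)`.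
  refine le_trans (mass_mono hnn ?_) ((mass_union_le hnn (clusterEvent P A τ ε m)ᶜ _).trans
    ((add_le_add hE hsym).trans (by linarith)))
  rintro q ⟨S, hS⟩
  by_contra hcon
  rw [Set.mem_union, not_or] at hcon
  have hq : q ∈ clusterEvent P A τ ε m := by
    by_contra h
    exact hcon.1 h
  have h1 : |∑ i, weightedDiff P A τ m S (q i)
      - ∑ p ∈ P, (pointCost S p - pointCost S (A (τ p)))| ≤ 2 * (10 * ε * errScale P A τ S) :=
    not_lt.1 fun h => hcon.2 ⟨S, h⟩
  set n : Fin k → ℝ := fun j => ((cluster P τ j).card : ℝ) with hn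
  set s : Fin k → ℝ := fun j => ∑ i, (if τ (q i) = j then weight P A τ m (q i) * 1 else 0) with hs
  have hD0 : ∀ j, 0 ≤ pointCost S (A j) := fun j => pointCost_nonneg _ _
  have h2 : |∑ j, s j * pointCost S (A j) - ∑ j, n j * pointCost S (A j)|
      ≤ ε * errScale P A τ S := by
    rw [← Finset.sum_sub_distrib]
    calc |∑ j, (s j * pointCost S (A j) - n j * pointCost S (A j))|
        ≤ ∑ j, ε * (n j * pointCost S (A j)) := by
          refine (Finset.abs_sum_le_sum_abs _ _).trans (Finset.sum_le_sum fun j _ => ?_)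
          rw [← sub_mul, abs_mul, abs_of_nonneg (hD0 j), ← mul_assoc]
          refine mul_le_mul_of_nonneg_right ?_ (hD0 j)
          have := (hq j).1
          rwa [Finset.sum_const, nsmul_eq_mul, mul_one] at this
      _ ≤ _ := by
          rw [← Finset.mul_sum]
          exact mul_le_mul_of_nonneg_left (le_add_of_nonneg_left (cost_nonneg P A)) hε.le
  have h3 : ∑ j, s j * pointCost S (A j) = ∑ i, weight P A τ m (q i) * pointCost S (A (τ (q i))) := by
    simp only [hs, Finset.sum_mul]
    rw [Finset.sum_comm]
    refine Finset.sum_congr rfl fun i _ => ?_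
    rw [Finset.sum_eq_single (τ (q i))]
    · simp
    · intro j _ hj
      rw [if_neg hj.symm, zero_mul]
    · simp
  -- The differences contribute `20 ε` and the estimated cluster sizes `ε`, in total `21 ε`.
  have h4 : ∑ i, weight P A τ m (q i) * pointCost S (q i) - cost P S
      = (∑ i, weightedDiff P A τ m S (q i) - ∑ p ∈ P, (pointCost S p - pointCost S (A (τ p))))
        + (∑ j, s j * pointCost S (A j) - ∑ j, n j * pointCost S (A j)) := by
    rw [h3, hn, sum_card_mul_eq P A τ S]
    simp only [weightedDiff, mul_sub, Finset.sum_sub_distrib]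
    rw [cost]
    ring
  rw [h4] at hS
  have h5 := abs_add_le (∑ i, weightedDiff P A τ m S (q i)
    - ∑ p ∈ P, (pointCost S p - pointCost S (A (τ p))))
    (∑ j, s j * pointCost S (A j) - ∑ j, n j * pointCost S (A j))
  linarith

end Coreset
-- Arithmetic of the sample size
section SampleSize

theorem natCast_le_mul_log {y g e : ℝ} {n : ℕ} (hg : 3 ≤ g) (hy : 1 / 2 ≤ y) (he : 0 < e)
    (hey : Real.log (1 / e) ≤ y) (hn : (2 : ℝ) ^ n ≤ g / e) : ((n + 1 : ℕ) : ℝ) + 1 ≤ 8 * g * y := by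
  have h1 : n * Real.log 2 ≤ g + y := by
    rw [← Real.log_pow]
    refine (Real.log_le_log (by positivity) hn).trans ?_
    rw [div_eq_mul_one_div, Real.log_mul (by positivity) (by positivity)]
    have := Real.log_le_self (x := g) (by linarith)
    linarith
  have h2 : (1 : ℝ) / 2 ≤ Real.log 2 := by linarith [Real.log_two_gt_d9]
  have h3 : (n : ℝ) * (1 / 2) ≤ n * Real.log 2 := by gcongr
  push_cast
  nlinarith

/-- The entropy contains `log m`, so the condition on `m` is implicit. Splitting `log (5 M)` into
`log (M / (2 B)) + log (10 B)` absorbs the first part into `M / 2` and bounds the second by a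
multiple of `y`. -/
theorem mul_log_le_of_mul_le {K X y M : ℝ} (hK : 1 ≤ K) (hX : 0 < X) (hy : 1 / 2 ≤ y)
    (hXy : Real.log X ≤ 3 * y) (hM : 0 < M) (h : 2 * K * (20 * K + 10) * X * y ^ 8 ≤ M) :
    K * y ^ 7 * X * Real.log (5 * M) ≤ M := by
  have hy0 : 0 < y := by linarith
  set B := K * y ^ 7 * X with hB
  have hB0 : 0 < B := by positivity
  have h1 : Real.log (5 * M) = Real.log (M / (2 * B)) + Real.log (10 * B) := by
    rw [← Real.log_mul (by positivity) (by positivity)]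
    congr 1
    field_simp
    norm_num
  have h2 : Real.log (M / (2 * B)) ≤ M / (2 * B) := Real.log_le_self (by positivity)
  have h3 : Real.log (10 * B) ≤ (20 * K + 10) * y := by
    have e1 : 10 * B = (10 * K) * y ^ 7 * X := by rw [hB]; ring
    rw [e1, Real.log_mul (by positivity) hX.ne', Real.log_mul (by positivity) (by positivity),
      Real.log_pow]
    have e2 := Real.log_le_self (x := 10 * K) (by linarith)
    have e3 := Real.log_le_self hy0.le
    push_cast
    nlinarith
  have h4 : B * (M / (2 * B)) = M / 2 := by field_simp
  have h5 : B * ((20 * K + 10) * y) ≤ M / 2 := by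
    have : B * ((20 * K + 10) * y) = (2 * K * (20 * K + 10) * X * y ^ 8) / 2 := by
      rw [hB]; ring
    linarith
  rw [h1]
  have h6 := mul_le_mul_of_nonneg_left (add_le_add h2 h3) hB0.le
  rw [mul_add B (M / (2 * B)), h4] at h6
  linarith

/-- One of the two nets is small enough for every ratio `2 ^ t ≤ 2 g / ε`. -/
theorem net_option_le {k t : ℕ} {e g : ℝ} (hk : 1 ≤ k) (he : 0 < e) (hg : 1 ≤ g)
    (ht : (2 : ℝ) ^ t ≤ 2 * g / e) :
    (k : ℝ) * 2 ^ t ≤ 4 * g * min ((k : ℝ) ^ ((4 : ℝ) / 3) / e ^ 2) ((k : ℝ) / e ^ 3) * e ^ 2 ∨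
      1 ≤ t ∧ 2 * (k : ℝ) ^ 2 / (2 ^ t) ^ 2
        ≤ 4 * g * min ((k : ℝ) ^ ((4 : ℝ) / 3) / e ^ 2) ((k : ℝ) / e ^ 3) * e ^ 2 := by
  have hk1 : (1 : ℝ) ≤ k := by exact_mod_cast hk
  have hk0 : (0 : ℝ) < k := by linarith
  -- At `2 ^ t = k ^ (1/3)` the costs `k 2 ^ t` and `k² / (2 ^ t)²` balance: below it the near net
  -- is used, above it the far net.
  set c : ℝ := (k : ℝ) ^ ((1 : ℝ) / 3) with hc
  have hc0 : 0 < c := Real.rpow_pos_of_pos hk0 _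
  have hc3 : c ^ 3 = k := by
    rw [hc, ← Real.rpow_natCast, ← Real.rpow_mul hk0.le]
    norm_num
  have hkc : (k : ℝ) ^ ((4 : ℝ) / 3) = k * c := by
    rw [hc, ← Real.rpow_one_add' hk0.le (by norm_num)]
    norm_num
  have key : ∀ Q : ℝ, Q ≤ 4 * g * (k * c) → Q ≤ 4 * g * (k / e) →
      Q ≤ 4 * g * min ((k : ℝ) ^ ((4 : ℝ) / 3) / e ^ 2) ((k : ℝ) / e ^ 3) * e ^ 2 := by
    intro Q h1 h2
    have h3 : Q / (4 * g * e ^ 2) ≤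
        min ((k : ℝ) ^ ((4 : ℝ) / 3) / e ^ 2) ((k : ℝ) / e ^ 3) := by
      refine le_min ?_ ?_
      · rw [hkc, div_le_div_iff₀ (by positivity) (by positivity)]
        have := mul_le_mul_of_nonneg_right h1 (sq_nonneg e)
        linarith
      · rw [div_le_div_iff₀ (by positivity) (by positivity)]
        have h4 := mul_le_mul_of_nonneg_right h2 (pow_nonneg he.le 3)
        have h5 : 4 * g * ((k : ℝ) / e) * e ^ 3 = k * (4 * g * e ^ 2) := by
          field_simp
        linarith
    rw [div_le_iff₀ (by positivity)] at h3
    linarith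
  have h2t : (0 : ℝ) < 2 ^ t := by positivity
  have hke : (k : ℝ) * 2 ^ t ≤ 2 * g * (k / e) := by
    calc (k : ℝ) * 2 ^ t ≤ k * (2 * g / e) := by gcongr
      _ = _ := by ring
  have hke0 : 0 ≤ 2 * g * ((k : ℝ) / e) := by positivity
  rcases le_or_gt ((2 : ℝ) ^ t) c with h | h
  · left
    refine key _ ?_ (by linarith)
    have h1 : (k : ℝ) * 2 ^ t ≤ k * c := by gcongr
    have h2 : 0 ≤ (k : ℝ) * c := by positivity
    nlinarith
  · right
    have hk8 : (k : ℝ) ≤ (2 ^ t) ^ 3 := by rw [← hc3]; gcongr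
    refine ⟨?_, key _ ?_ ?_⟩
    · by_contra h0
      have ht0 : t = 0 := by lia
      rw [ht0, pow_zero] at h
      have : c ^ 3 < 1 := pow_lt_one₀ hc0.le h (by norm_num)
      linarith
    · rw [div_le_iff₀ (by positivity)]
      have h1 : c ^ 2 ≤ (2 ^ t) ^ 2 := by gcongr
      have h2 : (k : ℝ) ^ 2 = (k * c) * c ^ 2 := by
        nth_rewrite 2 [← hc3]
        rw [sq]
        nth_rewrite 1 [← hc3]
        rw [← hc3]
        ring
      have h3 : 0 ≤ (k : ℝ) * c := by positivity
      rw [h2]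
      calc 2 * (k * c * c ^ 2) ≤ 2 * (k * c * (2 ^ t) ^ 2) := by gcongr
        _ ≤ 4 * g * (k * c * (2 ^ t) ^ 2) := by
          refine mul_le_mul_of_nonneg_right (by linarith) (by positivity)
        _ = _ := by ring
    · rw [div_le_iff₀ (by positivity)]
      have h1 : (k : ℝ) * k ≤ k * (2 ^ t) ^ 3 := by gcongr
      have h2 := mul_le_mul_of_nonneg_right hke (sq_nonneg ((2 : ℝ) ^ t))
      nlinarith

/-- The sample size of the theorem suffices for all estimates of `mass_error_le`. -/
theorem sample_size_suffices {g K e : ℝ} {k m : ℕ} (hg : 3 ≤ g)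
    (hK : K = 539136 * 1101609 * 8 ^ 7 * 4 * g ^ 10) (hk : 1 ≤ k) (he : 0 < e) (he1 : e < 1)
    (hm : 2 * K * (20 * K + 10) * min ((k : ℝ) ^ ((4 : ℝ) / 3) / e ^ 2) ((k : ℝ) / e ^ 3)
      * Real.log (2 * (k : ℝ) / e) ^ 8 ≤ m) :
    1 ≤ m ∧ 16 * k * Real.log (400 * k) ≤ (e / g) ^ 2 * m ∧ ∃ N : ℕ, 1 ≤ e / g * 2 ^ N ∧
      ∀ t ≤ N, 539136 * 1101609 * (N + 1) ^ 7 * Real.log (2 * (m + k : ℕ) + 1) * (k * 2 ^ t)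
        ≤ (e / g) ^ 2 * m ∨ (1 ≤ t ∧ 539136 * 1101609 * (N + 1) ^ 7 *
          Real.log (2 * (m + k : ℕ) + 1) * (2 * k ^ 2 / (2 ^ t) ^ 2) ≤ (e / g) ^ 2 * m) := by
  have hk1 : (1 : ℝ) ≤ k := by exact_mod_cast hk
  have hg0 : 0 < g := by linarith
  set y := Real.log (2 * (k : ℝ) / e) with hy
  set X := min ((k : ℝ) ^ ((4 : ℝ) / 3) / e ^ 2) ((k : ℝ) / e ^ 3) with hX
  have h2ke : 2 ≤ 2 * (k : ℝ) / e := by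
    rw [le_div_iff₀ he]
    nlinarith
  have hyhalf : 1 / 2 ≤ y := by
    have := Real.log_le_log two_pos h2ke
    linarith [Real.log_two_gt_d9]
  have hy0 : 0 < y := by linarith
  have hkX : (k : ℝ) ≤ e ^ 2 * X := by
    have h1 : (k : ℝ) / e ^ 2 ≤ X := by
      refine le_min ?_ ?_
      · gcongr
        exact Real.self_le_rpow_of_one_le hk1 (by norm_num)
      · exact div_le_div_of_nonneg_left (by linarith) (by positivity)
          (pow_le_pow_of_le_one he.le he1.le (by norm_num))
    rw [div_le_iff₀ (by positivity)] at h1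
    linarith
  have hX0 : 0 < X := by
    by_contra h
    have := mul_nonneg (sq_nonneg e) (neg_nonneg.2 (not_lt.1 h))
    linarith
  have hkX' : (k : ℝ) ≤ X := by
    have : e ^ 2 ≤ 1 := pow_le_one₀ he.le he1.le
    nlinarith
  have hlogX : Real.log X ≤ 3 * y := by
    have h1 : X ≤ (2 * (k : ℝ) / e) ^ 3 := by
      refine (min_le_right _ _).trans ?_
      rw [div_pow]
      gcongr
      have : (k : ℝ) ≤ k ^ 3 := le_self_pow₀ hk1 (by norm_num)
      rw [mul_pow]
      linarith
    have h2 := Real.log_le_log hX0 h1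
    rw [Real.log_pow] at h2
    simpa only [Nat.cast_ofNat] using h2
  have hg10 : 1 ≤ g ^ 10 := one_le_pow₀ (by linarith)
  have hg2 : g ^ 2 ≤ g ^ 10 := pow_le_pow_right₀ (by linarith) (by norm_num)
  have hK1 : 1000000 * g ^ 2 ≤ K := by
    rw [hK]
    norm_num
    linarith
  have hK1' : 1000000 ≤ K := by
    rw [hK]
    norm_num
    linarith
  have hy8 : 1 / 256 ≤ y ^ 8 := by
    have : (1 / 2 : ℝ) ^ 8 ≤ y ^ 8 := by gcongr
    norm_num at this
    linarith
  have hy7 : y ≤ 128 * y ^ 8 := by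
    have : (1 / 2 : ℝ) ^ 7 ≤ y ^ 7 := by gcongr
    have h2 : y ^ 8 = y ^ 7 * y := by ring
    rw [h2]
    norm_num at this
    nlinarith
  have hC : K ≤ 2 * K * (20 * K + 10) := by nlinarith
  have hKm : K * X * y ^ 8 ≤ m := by
    refine le_trans ?_ hm
    gcongr
  have hXm : X ≤ m := by
    have h1 : 1000000 * X * (1 / 256) ≤ K * X * y ^ 8 := by gcongr
    linarith
  have hm1 : (1 : ℝ) ≤ m := by linarith
  refine ⟨by exact_mod_cast hm1, ?_, ?_⟩
  · have h1 : Real.log (400 * k) ≤ 401 * y := by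
      have e1 : (400 : ℝ) * k = 200 * (2 * k) := by ring
      rw [e1, Real.log_mul (by norm_num) (by positivity)]
      have e2 := Real.log_le_self (x := 200) (by norm_num)
      have e3 : Real.log (2 * k) ≤ y := by
        refine Real.log_le_log (by positivity) ?_
        rw [le_div_iff₀ he]
        nlinarith
      linarith
    have h2 : Real.log (400 * k) ≤ 401 * (128 * y ^ 8) := h1.trans (by linarith)
    have h3 : 0 ≤ Real.log (400 * k) := Real.log_nonneg (by linarith)
    rw [div_pow, div_mul_eq_mul_div, le_div_iff₀ (by positivity)]
    calc 16 * k * Real.log (400 * k) * g ^ 2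
        ≤ 16 * (e ^ 2 * X) * (401 * (128 * y ^ 8)) * g ^ 2 := by
          gcongr
      _ = e ^ 2 * (821248 * g ^ 2 * X * y ^ 8) := by ring
      _ ≤ e ^ 2 * (K * X * y ^ 8) := by
          gcongr
          nlinarith
      _ ≤ e ^ 2 * m := by gcongr
  · obtain ⟨n, hn1, hn2⟩ := exists_nat_pow_near (x := g / e) (y := (2 : ℝ))
      (by rw [le_div_iff₀ he]; linarith) one_lt_two
    have hmain : K * y ^ 7 * X * Real.log (5 * m) ≤ m :=
      mul_log_le_of_mul_le (by linarith) hX0 hyhalf hlogX (by linarith) hm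
    have hN : ((n + 1 : ℕ) : ℝ) + 1 ≤ 8 * g * y := by
      refine natCast_le_mul_log hg hyhalf he (Real.log_le_log (by positivity) ?_) hn1
      gcongr
      linarith
    set L := Real.log (2 * (m + k : ℕ) + 1) with hL
    have hL5 : L ≤ Real.log (5 * m) := by
      refine Real.log_le_log (by positivity) ?_
      push_cast
      linarith
    have hL0 : 0 ≤ L := by linarith [one_le_log_two_mul_add_one (M := m + k) (by lia)]
    have hlog5 : 0 ≤ Real.log (5 * m) := hL0.trans hL5
    -- The power `g ^ 10` in `K` consists of `g ^ 7` from `N + 1`, `g` from the choice of net and `g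
    -- ^ 2` from the accuracy `e / g`.
    have hfin : ∀ Q : ℝ, 0 ≤ Q → Q ≤ 4 * g * X * e ^ 2 →
        539136 * 1101609 * (((n + 1 : ℕ) : ℝ) + 1) ^ 7 * L * Q ≤ (e / g) ^ 2 * m := by
      intro Q hQ0 hQ
      calc 539136 * 1101609 * (((n + 1 : ℕ) : ℝ) + 1) ^ 7 * L * Q
          ≤ 539136 * 1101609 * (8 * g * y) ^ 7 * Real.log (5 * m) * (4 * g * X * e ^ 2) := by
            gcongr
        _ = (e / g) ^ 2 * (K * y ^ 7 * X * Real.log (5 * m)) := by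
            rw [hK]
            field_simp
        _ ≤ (e / g) ^ 2 * m := by gcongr
    refine ⟨n + 1, ?_, fun t ht => ?_⟩
    · rw [div_lt_iff₀ he] at hn2
      rw [div_mul_eq_mul_div, le_div_iff₀ hg0]
      linarith
    · have ht2 : (2 : ℝ) ^ t ≤ 2 * g / e := by
        calc (2 : ℝ) ^ t ≤ 2 ^ (n + 1) := pow_le_pow_right₀ one_le_two ht
          _ = 2 * 2 ^ n := by rw [pow_succ]; ring
          _ ≤ 2 * (g / e) := by gcongr
          _ = _ := by ring
      rcases net_option_le hk he (by linarith) ht2 with h | ⟨h1, h2⟩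
      · exact Or.inl (hfin _ (by positivity) h)
      · exact Or.inr ⟨h1, hfin _ (by positivity) h2⟩

end SampleSize
end KMedian

end

/-! ### Proof of the theorem -/

theorem mainTheorem6 (γ : ℝ) (hγ : 1 ≤ γ) :
    ∃ (C : ℝ) (c : ℕ), 0 < C ∧
      ∀ (d k m : ℕ) (ε : ℝ) (P : Finset (KMedian.Pt d)) (A : Fin k → KMedian.Pt d)
        (τ : KMedian.Pt d → Fin k),
        1 ≤ k → 0 < ε → ε < 1 → P.Nonempty →
        KMedian.IsApproxSolution γ P A →
        KMedian.IsNearestAssignment P A τ →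
        C * min ((k : ℝ) ^ ((4 : ℝ) / 3) / ε ^ 2) ((k : ℝ) / ε ^ 3)
            * Real.log (2 * (k : ℝ) / ε) ^ c ≤ (m : ℝ) →
        (2 / 3 : ℝ≥0∞) ≤ KMedian.sampleLaw P A τ m
          {q | KMedian.IsCoreset k ε P (fun i => (q i : KMedian.Pt d))
            (fun i => KMedian.weight P A τ m (q i : KMedian.Pt d))} := by
  have hg : (3 : ℝ) ≤ 21 * (1 + 2 * γ) := by linarith
  have hg0 : 0 < 21 * (1 + 2 * γ) := by linarith
  set K := 539136 * 1101609 * 8 ^ 7 * 4 * (21 * (1 + 2 * γ)) ^ 10 with hK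
  have hK0 : 0 < K := by positivity
  -- Seven of the logarithms come from the `N + 1` scales, the eighth from `log m`. The previous
  -- estimates are applied with accuracy `ε / (21 (1 + 2 γ))`.
  refine ⟨2 * K * (20 * K + 10), 8, by positivity, ?_⟩
  intro d k m ε P A τ hk hε hε1 hP hA hτ hm
  obtain ⟨hm1, hmk, N, hN, hmC⟩ := KMedian.sample_size_suffices hg hK hk hε hε1 hm
  have hεg : ε / (21 * (1 + 2 * γ)) ≤ 1 := by
    rw [div_le_one hg0]
    linarith
  have herr := KMedian.mass_error_le P A τ hP hk hm1 hτ (div_pos hε hg0) hεg hN hmk hmC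
  rw [KMedian.sampleLaw_eq_mass P A τ hP]
  set B : Set (Fin m → P) := {q | KMedian.IsCoreset k ε P (fun i => (q i : KMedian.Pt d))
    (fun i => KMedian.weight P A τ m (q i : KMedian.Pt d))} with hB
  have hsub : KMedian.mass (KMedian.prodWeight (fun p : P => KMedian.prob P A τ p) m) Bᶜ
      ≤ 1 / 3 := by
    refine le_trans (KMedian.mass_mono
      (KMedian.prodWeight_nonneg (KMedian.prob_nonneg P A τ)) ?_) herr
    intro q hq
    have hq' : ¬ KMedian.IsCoreset k ε P (fun i => (q i : KMedian.Pt d))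
      (fun i => KMedian.weight P A τ m (q i : KMedian.Pt d)) := hq
    rw [KMedian.IsCoreset] at hq'
    push Not at hq'
    obtain ⟨S, hS⟩ := hq'
    refine ⟨S, lt_of_le_of_lt ?_ hS⟩
    have h1 := KMedian.errScale_le P A τ hA hτ S
    calc 21 * (ε / (21 * (1 + 2 * γ))) * KMedian.errScale P A τ S
        ≤ 21 * (ε / (21 * (1 + 2 * γ))) * ((1 + 2 * γ) * KMedian.cost P S) := by gcongr
      _ = ε * KMedian.cost P S := by
        have : 1 + 2 * γ ≠ 0 := by linarith
        field_simp
  rw [KMedian.mass_compl, KMedian.sum_prodWeight (KMedian.sum_prob P A τ hP)] at hsub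
  have h23 : (2 / 3 : ℝ≥0∞) = ENNReal.ofReal (2 / 3) := by
    rw [ENNReal.ofReal_div_of_pos (by norm_num)]
    simp
  rw [h23]
  exact ENNReal.ofReal_le_ofReal (by linarith)
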